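/- Let $d\ge 1$, let $D\subset\mathbf R^d$ be a bounded open set with smooth boundary, let $0<p<1$, $c>0$, and let $u_0$ be a bounded measurable function on $D$. Let $Y$ be a Poisson random measure on $D\times(0,\infty)$ with intensity $dx\,c\,y^{-(p+1)}dy$, with atoms $(x^{(i)},y_i)$, and let $L(A)=\sum_{x^{(i)}\in A}y_i$ be the associated one-sided $p$-stable random measure on $D$. Let $G(t,x,y)$ be the fundamental solution of the heat equation $\partial_t u=\Delta u$ in $D$ with Dirichlet boundary conditions. Let $\mathcal X_n$ be the set of $(x_1,\dots,x_n)\in D^n$ with $x_i\neq x_{i+1}$ for $1\le i<n$, and for $x\in D$ let $\mathcal X_n^x=\{(x_1,\dots,x_n):(x_1,\dots,x_n,x)\in\mathcal X_{n+1}\}$. For $T>0$, a measurable function $u(t,x,\omega)$ is called a solution on $(0,T]$ of $$\frac{\partial u}{\partial t}=\Delta u+u\star\dot L(x),\qquad u(0,x)=u_0(x),$$ if there are measurable functions $f_n(t,x;x_1,\dots,x_n)$, $n\ge 0$, such that for every $t\in(0,T]$ and every $x\in D$, almost surely, $$u(t,x)=\sum_{n\ge0}\int_{\mathcal X_n}f_n(t,x;x_1,\dots,x_n)\,L(dx_1)\cdots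 L(dx_n)$$ and $$u(t,x)=\int_D G(t,x,y)u_0(y)\,dy+\sum_{n\ge 0}\int_{\mathcal X_{n+1}}\Big(\int_0^tG(t-s,x,x_{n+1})f_n(s,x_{n+1};x_1,\dots,x_n)\,ds\Big)L(dx_1)\cdots L(dx_{n+1}),$$ and such that for every $t\in(0,T]$, almost surely, both identities also hold at every atom $x$ of $L$, with $\mathcal X_n,\mathcal X_{n+1}$ replaced by $\mathcal X_n^x,\mathcal X_{n+1}^x$; all these series of integrals are required to converge absolutely. (The last series is the $\star$-integral $\int_D\big(\int_0^tG(t-s,x,y)u(s,y)\,ds\big)\star L(dy)$, in which only adjacent diagonal terms are removed.) Assume that either $d\le 4$, or $d\ge5$ and $p<\frac12+\frac1{d-2}$. Then the equation has a unique solution: there is a $u$ that is a solution on $(0,T]$ for every $T>0$, and if $v$ is a solution on $(0,T]$ for some $T>0$, then for all $t\in(0,T]$ and $x\in D$ one has $v(t,x)=u(t,x)$ almost surely. -/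

import Mathlib

open Set MeasureTheory ProbabilityTheory
open scoped ENNReal NNReal

noncomputable section

namespace StableHeat

/-- `ℝ^d` with the Euclidean norm. -/
abbrev Sp (d : ℕ) : Type := EuclideanSpace ℝ (Fin d)

/-! ### The domain -/

/-- `D` has a smooth boundary: near each boundary point, `D` is the sublevel set of a smooth
function whose differential does not vanish at that point. -/
def HasSmoothBoundary {d : ℕ} (D : Set (Sp d)) : Prop :=
  ∀ z ∈ frontier D, ∃ U : Set (Sp d), IsOpen U ∧ z ∈ U ∧
    ∃ ρ : Sp d → ℝ, ContDiff ℝ ((⊤ : ℕ∞) : WithTop ℕ∞) ρ ∧ ρ z = 0 ∧ fderiv ℝ ρ z ≠ 0 ∧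
      D ∩ U = {x | ρ x < 0} ∩ U

/-! ### Heat kernels -/

/-- The heat kernel `(4 π t)^{-d/2} exp (-|x|² / (4 t))` of `∂ₜ - Δ` on `ℝ^d`. -/
def heatKernel {d : ℕ} (t : ℝ) (x : Sp d) : ℝ :=
  (4 * Real.pi * t) ^ (-(d : ℝ) / 2) * Real.exp (-‖x‖ ^ 2 / (4 * t))

/-- `v` is a classical subsolution of the heat equation on `(0, ∞) × D`, continuous up to the
boundary, with initial values at most `0` and lateral boundary values at most `b`. -/
structure IsHeatSubsolution {d : ℕ} (D : Set (Sp d)) (b v : ℝ → Sp d → ℝ) : Prop where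
  continuousOn : ContinuousOn (Function.uncurry v) (Ici 0 ×ˢ closure D)
  contDiffOn : ContDiffOn ℝ 2 (Function.uncurry v) (Ioi 0 ×ˢ D)
  sub : ∀ t > 0, ∀ x ∈ D, deriv (fun s => v s x) t ≤ Laplacian.laplacian (v t) x
  initial : ∀ x ∈ closure D, v 0 x ≤ 0
  lateral : ∀ t > 0, ∀ x ∈ frontier D, v t x ≤ b t x

/-- The fundamental solution `G(t, x, y)` of the heat equation in `D` with Dirichlet boundary
conditions: the free heat kernel with pole `y` minus its corrector. The corrector is the
solution of the heat equation in `D` with zero initial values and with the boundary values of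
the free heat kernel; it is given by Perron's method, as the largest subsolution. When `D` is
bounded with smooth boundary, the corrector is itself classical (it is a member of the family),
so this is the classical Dirichlet heat kernel. -/
def dirichletKernel {d : ℕ} (D : Set (Sp d)) (t : ℝ) (x y : Sp d) : ℝ :=
  heatKernel t (x - y) -
    sSup {r : ℝ | ∃ v : ℝ → Sp d → ℝ,
      IsHeatSubsolution D (fun s z => heatKernel s (z - y)) v ∧ r = v t x}

/-! ### The noise -/

/-- `Y` is a Poisson random measure with intensity `μ`. -/
structure IsPoissonRandomMeasure {X Ω : Type*} [MeasurableSpace X] [MeasurableSpace Ω]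
    (Y : Ω → Measure X) (μ : Measure X) (P : Measure Ω) : Prop where
  measurable : Measurable Y
  law : ∀ A : Set X, MeasurableSet A → μ A ≠ ∞ →
    P.map (fun ω => Y ω A) = (poissonMeasure (μ A).toNNReal).map (fun n : ℕ => (n : ℝ≥0∞))
  indep : ∀ (n : ℕ) (A : Fin n → Set X), (∀ i, MeasurableSet (A i)) →
    Pairwise (fun i j => Disjoint (A i) (A j)) → iIndepFun (fun i ω => Y ω (A i)) P

/-- The intensity `dx · c y^{-(p+1)} dy` on `D × (0, ∞)`. -/
def stableIntensity {d : ℕ} (D : Set (Sp d)) (p c : ℝ) : Measure (Sp d × ℝ) :=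
  ((volume : Measure (Sp d)).restrict D).prod
    (((volume : Measure ℝ).restrict (Ioi 0)).withDensity
      (fun y => ENNReal.ofReal (c * y ^ (-(p + 1)))))

/-- The random measure `L(A) = ∑_{x⁽ⁱ⁾ ∈ A} yᵢ`, where `(x⁽ⁱ⁾, yᵢ)` are the atoms of `Y`. -/
def noise {d : ℕ} {Ω : Type*} (Y : Ω → Measure (Sp d × ℝ)) (ω : Ω) : Measure (Sp d) :=
  ((Y ω).withDensity (fun z => ENNReal.ofReal z.2)).map Prod.fst

/-! ### Multiple integrals without adjacent diagonal terms -/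

/-- The `n`-tuples in which no two adjacent entries are equal. -/
def noAdjacent {d : ℕ} (n : ℕ) : Set (Fin n → Sp d) :=
  {ξ | ∀ i j : Fin n, (j : ℕ) = (i : ℕ) + 1 → ξ i ≠ ξ j}

/-- The `n`-tuples `(x₁, …, xₙ)` such that `(x₁, …, xₙ, x)` has no two adjacent entries equal. -/
def noAdjacentTo {d : ℕ} (x : Sp d) (n : ℕ) : Set (Fin n → Sp d) :=
  {ξ | (Fin.snoc ξ x : Fin (n + 1) → Sp d) ∈ noAdjacent (d := d) (n + 1)}

/-- `∫_A f(x₁, …, xₙ) L(dx₁) ⋯ L(dxₙ)`; with `A = noAdjacent n` this is `Jₙ(f)`. -/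
def multInt {d n : ℕ} (L : Measure (Sp d)) (A : Set (Fin n → Sp d))
    (f : (Fin n → Sp d) → ℝ) : ℝ :=
  ∫ ξ in A, f ξ ∂(Measure.pi fun _ : Fin n => L)

/-- `∫_A f(x₁, …, xₙ) L(dx₁) ⋯ L(dxₙ)`, for `f` with values in `[0, ∞]`. -/
def multLInt {d n : ℕ} (L : Measure (Sp d)) (A : Set (Fin n → Sp d))
    (f : (Fin n → Sp d) → ℝ≥0∞) : ℝ≥0∞ :=
  ∫⁻ ξ in A, f ξ ∂(Measure.pi fun _ : Fin n => L)

/-- `v = ∑ₙ ∫_{Aₙ} fₙ dLⁿ`, the whole series converging absolutely. -/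
def HasExpansion {d : ℕ} (L : Measure (Sp d)) (A : (n : ℕ) → Set (Fin n → Sp d))
    (f : (n : ℕ) → (Fin n → Sp d) → ℝ) (v : ℝ) : Prop :=
  ∑' n, multLInt L (A n) (fun ξ => ‖f n ξ‖ₑ) ≠ ∞ ∧ v = ∑' n, multInt L (A n) (f n)

/-- `v = ∫ (∫₀ᵗ g(s, y) ds) ⋆ L(dy)` for a field `g(s, y)` with the expansion
`∑ₙ ∫ kₙ(s, y; x₁, …, xₙ) L(dx₁) ⋯ L(dxₙ)`: the `n`-th term becomes the `(n+1)`-fold integral of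
`∫₀ᵗ kₙ(s, xₙ₊₁; x₁, …, xₙ) ds` over tuples in `Aₙ₊₁`, everything converging absolutely. -/
def HasStarIntegral {d : ℕ} (L : Measure (Sp d)) (A : (n : ℕ) → Set (Fin n → Sp d)) (t : ℝ)
    (k : (n : ℕ) → ℝ → Sp d → (Fin n → Sp d) → ℝ) (v : ℝ) : Prop :=
  ∑' n, multLInt L (A (n + 1)) (fun ξ =>
      ∫⁻ s in Ioc 0 t, ‖k n s (ξ (Fin.last n)) (Fin.init ξ)‖ₑ) ≠ ∞ ∧
    v = ∑' n, multInt L (A (n + 1)) (fun ξ =>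
      ∫ s in Ioc 0 t, k n s (ξ (Fin.last n)) (Fin.init ξ))

/-! ### Solutions -/

/-- The value `v` of a field at `(t, x)` has the expansion with the kernels `fₙ(t, x; ·)` and
satisfies
`v = ∫_D G(t,x,y) u₀(y) dy + ∫_D (∫₀ᵗ G(t-s,x,y) u(s,y) ds) ⋆ L(dy)`,
where `u` is the field with the kernels `fₙ`. -/
def SolvesAt {d : ℕ} (D : Set (Sp d)) (u₀ : Sp d → ℝ) (L : Measure (Sp d))
    (A : (n : ℕ) → Set (Fin n → Sp d)) (f : (n : ℕ) → ℝ → Sp d → (Fin n → Sp d) → ℝ)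
    (t : ℝ) (x : Sp d) (v : ℝ) : Prop :=
  HasExpansion L A (fun n => f n t x) v ∧
    HasStarIntegral L A t (fun n s y ξ => dirichletKernel D (t - s) x y * f n s y ξ)
      (v - ∫ y in D, dirichletKernel D t x y * u₀ y)

/-- `u` is a solution on `(0, T] × D` of `∂ₜ u = Δ u + u ⋆ L̇`, `u(0, ·) = u₀`, with Dirichlet
boundary conditions.

The expansion and the equation hold at each deterministic point `x` of `D` almost surely (there
`(x₁, …, xₙ)` ranges over the tuples without equal adjacent entries), and also, almost surely, at
`L`-almost every point `x`, that is, at the atoms of `L` (there `(x₁, …, xₙ, x)` has no equal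
adjacent entries). The second clause says that the integrand of the `⋆`-integral is represented
at the points that the integrator `L` charges; at a deterministic `x` both sets of tuples
agree up to a null set. -/
def IsSolution {d : ℕ} {Ω : Type*} [MeasurableSpace Ω] (D : Set (Sp d)) (u₀ : Sp d → ℝ)
    (L : Ω → Measure (Sp d)) (P : Measure Ω) (T : ℝ) (u : ℝ → Sp d → Ω → ℝ) : Prop :=
  Measurable (fun z : ℝ × Sp d × Ω => u z.1 z.2.1 z.2.2) ∧
  ∃ f : (n : ℕ) → ℝ → Sp d → (Fin n → Sp d) → ℝ,
    (∀ n, Measurable (fun z : ℝ × Sp d × (Fin n → Sp d) => f n z.1 z.2.1 z.2.2)) ∧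
    ∀ t ∈ Ioc 0 T,
      (∀ x ∈ D, ∀ᵐ ω ∂P, SolvesAt D u₀ (L ω) noAdjacent f t x (u t x ω)) ∧
      (∀ᵐ ω ∂P, ∀ᵐ x ∂(L ω), SolvesAt D u₀ (L ω) (noAdjacentTo x) f t x (u t x ω))

end StableHeat

end

open Set MeasureTheory ProbabilityTheory
open scoped ENNReal NNReal

noncomputable section

namespace StableHeat

open Filter Topology Laplacian


/-! ### The Laplacian along lines -/

/-! The kernels of a solution are deterministic, and the sum of their multiple integrals is a field
satisfying a linear Volterra equation, u = `freeTerm` + ⋆-integral of u. By Fubini this equation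
sees the kernels only through the field and its absolute sum (`solvesAt_iff`). Since 0 ≤ G ≤ h, with
h the free heat kernel, weighting time by e^{-θt} bounds the ⋆-integral by the operator on L²(L)
with kernel g_θ(x-y), x ≠ y, where g_θ = ∫₀^∞ e^{-θs} h(s,·) ds is `potential`. For every β > 0 with
β > d/2 - 1 one has g_θ(x) ≤ C θ^{-γ} |x|^{-2β}, γ = β - d/2 + 1 > 0. The squared Hilbert–Schmidt
norm is therefore at most C² θ^{-2γ} times the energy ∬_{x≠y} |x-y|^{-4β} L(dx)L(dy), and drops
below 1 for large θ once the energy is finite (`exists_hsSq_lt_one`).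

The energy is almost surely finite because Y gives every set mass 0 or at least 1: for such measures
(∫φ)^q ≤ ∫φ^q when 0 < q ≤ 1 (`ZeroOrGeOne.lintegral_rpow_le`), and the mean of the right side, off
the diagonal, is computed from independence. It is finite if p < q and 4βq < d. Some admissible β
and q exist when p < d/(2d-4) = 1/2 + 1/(d-2), and for every p < 1 if d ≤ 4 (`exists_exponents`).

Existence is then a Neumann series: the n-th multiple integral of the iterated kernels `solKer` is
at most C e^{θt} times the n-th iterate of the operator applied to 1 (`multLInt_solKer_le`).

For uniqueness, the Laplace transform H of the difference of two fields satisfies H ≤ K H with K a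
contraction of L²(L), but nothing says that H lies in L²(L). The way out is thinning: as the kernels
are deterministic, an equation that holds almost surely for Y also holds almost surely after the
points in a set of finite intensity are deleted, because with positive probability there are none,
independently of the rest (`ae_restrict_compl`). Deleting the atoms of size in (δ, ε] and letting δ
→ 0 gives the equation for the noise made of the atoms larger than ε. There are finitely many of
these, so finiteness of H at each atom puts H in L² and the fields agree (`ae_valSum_eq_of_atomic`).
Letting ε → 0 gives agreement at the atoms of L (`ae_valSum_eq_solKer`), and the equation carries it
to deterministic points. Finiteness of H at the atoms comes from a lower bound for G near the
diagonal (`ae_lintegral_absSum_ne_top`).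

About G only joint measurability, 0 ≤ G ≤ h and that lower bound are needed; all three follow from
Perron's definition and the maximum principle. -/

lemma deriv_deriv_comp_line {E : Type*} [NormedAddCommGroup E] [NormedSpace ℝ E] {f : E → ℝ}
    {x e : E} (hf : ContDiffAt ℝ 2 f x) :
    deriv (deriv fun s : ℝ => f (x + s • e)) 0 = iteratedFDeriv ℝ 2 f x ![e, e] := by
  have hline : ∀ s : ℝ, HasDerivAt (fun s : ℝ => x + s • e) e s := fun s => by
    simpa using ((hasDerivAt_id s).smul_const e).const_add x
  have hcont : Tendsto (fun s : ℝ => x + s • e) (𝓝 0) (𝓝 x) := by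
    have := (hline 0).continuousAt.tendsto
    simpa using this
  have h1 : ∀ᶠ s in 𝓝 (0 : ℝ), deriv (fun s : ℝ => f (x + s • e)) s
      = fderiv ℝ f (x + s • e) e := by
    filter_upwards [hcont.eventually (hf.eventually (by simp))] with s hs
    exact ((hs.differentiableAt (by norm_num)).hasFDerivAt.comp_hasDerivAt s (hline s)).deriv
  have h2 : HasFDerivAt (fderiv ℝ f) (fderiv ℝ (fderiv ℝ f) x) (x + (0 : ℝ) • e) := by
    have : ContDiffAt ℝ 1 (fderiv ℝ f) x := hf.fderiv_right (by norm_num)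
    simpa using (this.differentiableAt (by norm_num)).hasFDerivAt
  have h3 : HasDerivAt (fun s : ℝ => fderiv ℝ f (x + s • e)) (fderiv ℝ (fderiv ℝ f) x e) 0 :=
    h2.comp_hasDerivAt (0 : ℝ) (hline 0)
  have h4 : HasDerivAt (fun s : ℝ => fderiv ℝ f (x + s • e) e)
      (fderiv ℝ (fderiv ℝ f) x e e) 0 :=
    (ContinuousLinearMap.apply ℝ ℝ e).hasFDerivAt.comp_hasDerivAt (0 : ℝ) h3
  rw [EventuallyEq.deriv_eq (f₁ := deriv fun s : ℝ => f (x + s • e)) h1, h4.deriv,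
    iteratedFDeriv_two_apply]
  rfl

lemma laplacian_eq_sum_line {d : ℕ} {f : Sp d → ℝ} {x : Sp d} (hf : ContDiffAt ℝ 2 f x) :
    Δ f x = ∑ i : Fin d,
      deriv (deriv fun s : ℝ => f (x + s • EuclideanSpace.basisFun (Fin d) ℝ i)) 0 := by
  rw [InnerProductSpace.laplacian_eq_iteratedFDeriv_orthonormalBasis f
    (EuclideanSpace.basisFun (Fin d) ℝ)]
  exact Finset.sum_congr rfl fun i _ => (deriv_deriv_comp_line hf).symm

/-- A positive second derivative would make the point a local minimum as well, hence the function
locally constant and the second derivative zero. -/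
lemma deriv_deriv_nonpos_of_isLocalMax {φ : ℝ → ℝ} {s : ℝ} (h : IsLocalMax φ s)
    (hc : ContinuousAt φ s) : deriv (deriv φ) s ≤ 0 := by
  by_contra! hpos
  have hmin := isLocalMin_of_deriv_deriv_pos hpos h.deriv_eq_zero hc
  have heq : φ =ᶠ[𝓝 s] fun _ => φ s := by
    filter_upwards [h, hmin] with r h1 h2 using le_antisymm h1 h2
  have h2 : deriv φ =ᶠ[𝓝 s] fun _ => 0 := by simpa using heq.deriv
  rw [h2.deriv_eq] at hpos
  simp at hpos

lemma laplacian_nonpos_of_isLocalMax {d : ℕ} {f : Sp d → ℝ} {x : Sp d}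
    (hf : ContDiffAt ℝ 2 f x) (h : IsLocalMax f x) : Δ f x ≤ 0 := by
  rw [laplacian_eq_sum_line hf]
  refine Finset.sum_nonpos fun i _ => ?_
  set e := EuclideanSpace.basisFun (Fin d) ℝ i
  have hl : ContinuousAt (fun s : ℝ => x + s • e) 0 := by fun_prop
  have ht : Tendsto (fun s : ℝ => x + s • e) (𝓝 0) (𝓝 x) := by simpa using hl.tendsto
  refine deriv_deriv_nonpos_of_isLocalMax ?_ ?_
  · filter_upwards [ht.eventually h] with s hs
    simpa using hs
  · exact ContinuousAt.comp (f := fun s : ℝ => x + s • e) (g := f)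
      (by simpa using hf.continuousAt) hl

lemma norm_line_sq {d : ℕ} (x : Sp d) (i : Fin d) (s : ℝ) :
    ‖x + s • EuclideanSpace.basisFun (Fin d) ℝ i‖ ^ 2 = ‖x‖ ^ 2 + 2 * s * x i + s ^ 2 := by
  rw [norm_add_sq_real, inner_smul_right, norm_smul, real_inner_comm]
  simp [EuclideanSpace.inner_single_left]
  ring

/-- The Laplacian of a radial function. -/
lemma laplacian_radial {d : ℕ} {Φ Φ₁ Φ₂ : ℝ → ℝ} (h0 : ContDiff ℝ 2 Φ)
    (h1 : ∀ r, HasDerivAt Φ (Φ₁ r) r) (h2 : ∀ r, HasDerivAt Φ₁ (Φ₂ r) r) (x y : Sp d) :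
    Δ (fun z : Sp d => Φ (‖z - y‖ ^ 2)) x
      = 4 * ‖x - y‖ ^ 2 * Φ₂ (‖x - y‖ ^ 2) + 2 * d * Φ₁ (‖x - y‖ ^ 2) := by
  have hC : ContDiff ℝ 2 (fun z : Sp d => Φ (‖z - y‖ ^ 2)) :=
    h0.comp ((contDiff_id.sub contDiff_const).norm_sq ℝ)
  rw [laplacian_eq_sum_line hC.contDiffAt]
  have key : ∀ i : Fin d, deriv (deriv fun s : ℝ =>
      Φ (‖x + s • EuclideanSpace.basisFun (Fin d) ℝ i - y‖ ^ 2)) 0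
      = 4 * ((x - y) i) ^ 2 * Φ₂ (‖x - y‖ ^ 2) + 2 * Φ₁ (‖x - y‖ ^ 2) := by
    intro i
    set u := ‖x - y‖ ^ 2
    set c := (x - y) i
    have e1 : (fun s : ℝ => Φ (‖x + s • EuclideanSpace.basisFun (Fin d) ℝ i - y‖ ^ 2))
        = fun s => Φ (u + 2 * s * c + s ^ 2) := by
      funext s
      rw [show x + s • EuclideanSpace.basisFun (Fin d) ℝ i - y
        = (x - y) + s • EuclideanSpace.basisFun (Fin d) ℝ i by abel, norm_line_sq]
    have hq : ∀ s : ℝ, HasDerivAt (fun s => u + 2 * s * c + s ^ 2) (2 * c + 2 * s) s := by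
      intro s
      have := (((hasDerivAt_id s).const_mul 2).mul_const c).const_add u |>.add
        ((hasDerivAt_id s).pow 2)
      refine this.congr_deriv ?_
      simp
    have e2 : deriv (fun s => Φ (u + 2 * s * c + s ^ 2))
        = fun s => Φ₁ (u + 2 * s * c + s ^ 2) * (2 * c + 2 * s) := by
      funext s
      exact ((h1 _).comp s (hq s)).deriv
    have h3 : HasDerivAt (fun s : ℝ => 2 * c + 2 * s) 2 0 := by
      simpa using ((hasDerivAt_id (0 : ℝ)).const_mul 2).const_add (2 * c)
    have h4 : HasDerivAt (fun s => Φ₁ (u + 2 * s * c + s ^ 2) * (2 * c + 2 * s)) _ 0 :=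
      ((h2 _).comp 0 (hq 0)).mul h3
    rw [e1, e2, h4.deriv]
    simp
    ring
  simp only [key, Finset.sum_add_distrib, ← Finset.sum_mul, ← Finset.mul_sum]
  have hn : ∑ i, (x - y) i ^ 2 = ‖x - y‖ ^ 2 := by simp [EuclideanSpace.norm_sq_eq]
  rw [hn]
  simp only [Finset.sum_const, Finset.card_univ, Fintype.card_fin, nsmul_eq_mul]
  ring

/-! ### The maximum principle -/

/-- Only the past is compared, because the maximum over a cylinder may be attained at the final
time. -/
lemma deriv_nonneg_of_le_left {φ : ℝ → ℝ} {φ' a t : ℝ} (hat : a < t) (h : HasDerivAt φ φ' t)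
    (hle : ∀ s ∈ Icc a t, φ s ≤ φ t) : 0 ≤ φ' := by
  have h1 : Tendsto (slope φ t) (𝓝[<] t) (𝓝 φ') :=
    (hasDerivAt_iff_tendsto_slope.1 h).mono_left (nhdsWithin_mono _ fun s hs => ne_of_lt hs)
  refine ge_of_tendsto h1 ?_
  filter_upwards [Ioo_mem_nhdsLT hat] with s hs
  rw [slope_def_field]
  exact div_nonneg_of_nonpos (by linarith [hle s ⟨hs.1.le, hs.2.le⟩]) (by linarith [hs.2])

/-- The weak maximum principle for the heat equation on a bounded cylinder. -/
theorem heat_max_principle {d : ℕ} {D : Set (Sp d)} (hDo : IsOpen D)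
    (hDb : Bornology.IsBounded D) {F : ℝ → Sp d → ℝ} {a b M : ℝ}
    (hc : ContinuousOn (Function.uncurry F) (Icc a b ×ˢ closure D))
    (hC : ∀ t ∈ Ioc a b, ∀ x ∈ D, ContDiffAt ℝ 2 (Function.uncurry F) (t, x))
    (hsub : ∀ t ∈ Ioc a b, ∀ x ∈ D, deriv (fun s => F s x) t ≤ Δ (F t) x)
    (hinit : ∀ x ∈ closure D, F a x ≤ M)
    (hlat : ∀ t ∈ Ioc a b, ∀ x ∈ frontier D, F t x ≤ M) :
    ∀ t ∈ Icc a b, ∀ x ∈ closure D, F t x ≤ M := by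
  intro t₀ ht₀ x₀ hx₀
  by_contra! hgt
  have hat : a < t₀ := lt_of_le_of_ne ht₀.1 fun h => by
    subst h; linarith [hinit x₀ hx₀]
  -- With this ε the penalty ε(t - a) uses up half of the excess at (t₀, x₀), so the maximum of F -
  -- ε(t - a) still exceeds M and lies off the parabolic boundary. There the Laplacian is ≤ 0 and
  -- the time derivative of F is ≥ ε, against `hsub`.
  set ε := (F t₀ x₀ - M) / (2 * (t₀ - a)) with hε
  have hεpos : 0 < ε := div_pos (by linarith) (by linarith)
  have hε' : ε * (t₀ - a) = (F t₀ x₀ - M) / 2 := by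
    rw [hε]; field_simp [show t₀ - a ≠ 0 by linarith]
  have hcomp : IsCompact (Icc a b ×ˢ closure D) := isCompact_Icc.prod hDb.isCompact_closure
  obtain ⟨⟨t, x⟩, ⟨ht, hx⟩, hmax⟩ := hcomp.exists_isMaxOn ⟨(t₀, x₀), ht₀, hx₀⟩
    (f := fun z : ℝ × Sp d => Function.uncurry F z - ε * (z.1 - a))
    (hc.sub (by fun_prop))
  simp only at ht hx
  have hmax' : ∀ s ∈ Icc a b, ∀ z ∈ closure D, F s z - ε * (s - a) ≤ F t x - ε * (t - a) :=
    fun s hs z hz => hmax (show (s, z) ∈ Icc a b ×ˢ closure D from ⟨hs, hz⟩)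
  have hval : M < F t x - ε * (t - a) := by
    have := hmax' t₀ ht₀ x₀ hx₀
    linarith
  have hta : a < t := lt_of_le_of_ne ht.1 fun h => by
    subst h; linarith [hinit x hx, show ε * (a - a) = 0 by ring]
  have hxD : x ∈ D := by
    by_contra hxD
    have : x ∈ frontier D := by rw [hDo.frontier_eq]; exact ⟨hx, hxD⟩
    have h1 := hlat t ⟨hta, ht.2⟩ x this
    have : 0 ≤ ε * (t - a) := mul_nonneg hεpos.le (by linarith)
    linarith
  have hCt := hC t ⟨hta, ht.2⟩ x hxD
  have hlap : Δ (F t) x ≤ 0 := by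
    have h1 : ContDiffAt ℝ 2 (F t) x :=
      ContDiffAt.comp (f := fun z : Sp d => (t, z)) (g := Function.uncurry F) x hCt (by fun_prop)
    refine laplacian_nonpos_of_isLocalMax h1 ?_
    filter_upwards [hDo.mem_nhds hxD] with z hz
    have := hmax' t ht z (subset_closure hz)
    linarith
  have hder : HasDerivAt (fun s => F s x) (deriv (fun s => F s x) t) t := by
    have h1 : ContDiffAt ℝ 2 (fun s => F s x) t :=
      ContDiffAt.comp (f := fun s : ℝ => (s, x)) (g := Function.uncurry F) t hCt (by fun_prop)
    exact (h1.differentiableAt (by norm_num)).hasDerivAt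
  have hnn : 0 ≤ deriv (fun s => F s x) t - ε := by
    refine deriv_nonneg_of_le_left hta (φ := fun s => F s x - ε * (s - a)) ?_ fun s hs =>
      hmax' s ⟨hs.1, hs.2.trans ht.2⟩ x hx
    have h2 : HasDerivAt (fun s => ε * (s - a)) ε t := by
      simpa using ((hasDerivAt_id t).sub_const a).const_mul ε
    exact hder.sub h2
  linarith [hsub t ⟨hta, ht.2⟩ x hxD]

/-- Comparison of a heat subsolution with a nonnegative supersolution. -/
theorem IsHeatSubsolution.le_of_supersolution {d : ℕ} {D : Set (Sp d)} (hDo : IsOpen D)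
    (hDb : Bornology.IsBounded D) {B v : ℝ → Sp d → ℝ} (hv : IsHeatSubsolution D B v)
    (hBC : ∀ t > 0, ∀ x, ContDiffAt ℝ 2 (Function.uncurry B) (t, x))
    (hBs : ∀ t > 0, ∀ x ∈ D, Δ (B t) x ≤ deriv (fun s => B s x) t)
    (hB0 : ∀ t > 0, ∀ x ∈ closure D, 0 ≤ B t x) :
    ∀ t > 0, ∀ x ∈ closure D, v t x ≤ B t x := by
  intro t ht x hx
  refine le_of_forall_pos_le_add fun ε hε => ?_
  have hcomp : IsCompact (closure D) := hDb.isCompact_closure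
  -- `B` is regular only at positive times, so the comparison starts at a time a > 0 so small that v
  -- ≤ ε there.
  have hsmall : ∃ a, 0 < a ∧ a < t ∧ ∀ z ∈ closure D, v a z ≤ ε := by
    have hcc : IsCompact (Icc (0 : ℝ) t ×ˢ closure D) := isCompact_Icc.prod hcomp
    have huc := hcc.uniformContinuousOn_of_continuous
      (hv.continuousOn.mono (prod_mono (fun s hs => hs.1) subset_rfl))
    rw [Metric.uniformContinuousOn_iff] at huc
    obtain ⟨δ, hδ, h⟩ := huc ε hε
    refine ⟨min (δ / 2) (t / 2), by positivity, by
      have := min_le_right (δ / 2) (t / 2); linarith, fun z hz => ?_⟩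
    have hm0 : 0 ≤ min (δ / 2) (t / 2) := by positivity
    have h1 := h (min (δ / 2) (t / 2), z) ⟨⟨hm0, by
      have := min_le_right (δ / 2) (t / 2); linarith⟩, hz⟩ (0, z) ⟨⟨le_rfl, ht.le⟩, hz⟩ (by
        rw [Prod.dist_eq, dist_self, Real.dist_eq, sub_zero, abs_of_nonneg hm0,
          max_eq_left hm0]
        have := min_le_left (δ / 2) (t / 2)
        linarith)
    have h2 := (abs_lt.1 (by simpa [Real.dist_eq] using h1)).2
    have h3 := hv.initial z hz
    linarith
  obtain ⟨a, ha, hat, hle⟩ := hsmall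
  have hBcont : ContinuousOn (Function.uncurry B) (Ioi 0 ×ˢ univ) := fun z hz =>
    ((hBC z.1 hz.1 z.2).continuousAt).continuousWithinAt
  have hvC : ∀ s > 0, ∀ z ∈ D, ContDiffAt ℝ 2 (Function.uncurry v) (s, z) := fun s hs z hz =>
    hv.contDiffOn.contDiffAt ((isOpen_Ioi.prod hDo).mem_nhds ⟨hs, hz⟩)
  have key := heat_max_principle hDo hDb (F := fun s z => v s z - B s z) (a := a) (b := t) (M := ε)
    ((hv.continuousOn.mono (prod_mono (fun s hs => ha.le.trans hs.1) subset_rfl)).sub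
      (hBcont.mono (prod_mono (fun s hs => lt_of_lt_of_le ha hs.1) (subset_univ _))))
    (fun s hs z hz => (hvC s (ha.trans hs.1) z hz).sub (hBC s (ha.trans hs.1) z))
    (fun s hs z hz => by
      have hs0 : 0 < s := ha.trans hs.1
      have hv1 := hvC s hs0 z hz
      have hB1 := hBC s hs0 z
      have hvx : ContDiffAt ℝ 2 (v s) z := ContDiffAt.comp (f := fun z : Sp d => (s, z))
        (g := Function.uncurry v) z hv1 (by fun_prop)
      have hBx : ContDiffAt ℝ 2 (B s) z := ContDiffAt.comp (f := fun z : Sp d => (s, z))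
        (g := Function.uncurry B) z hB1 (by fun_prop)
      have hvt : ContDiffAt ℝ 2 (fun r => v r z) s := ContDiffAt.comp (f := fun r : ℝ => (r, z))
        (g := Function.uncurry v) s hv1 (by fun_prop)
      have hBt : ContDiffAt ℝ 2 (fun r => B r z) s := ContDiffAt.comp (f := fun r : ℝ => (r, z))
        (g := Function.uncurry B) s hB1 (by fun_prop)
      have e1 : Δ (fun z => v s z - B s z) z = Δ (v s) z - Δ (B s) z := hvx.laplacian_sub hBx
      have e2 : deriv (fun r => v r z - B r z) s
          = deriv (fun r => v r z) s - deriv (fun r => B r z) s :=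
        deriv_sub (hvt.differentiableAt (by norm_num)) (hBt.differentiableAt (by norm_num))
      rw [e1, e2]
      linarith [hv.sub s hs0 z hz, hBs s hs0 z hz])
    (fun z hz => by linarith [hle z hz, hB0 a ha z hz])
    (fun s hs z hz => by linarith [hv.lateral s (ha.trans hs.1) z hz])
  linarith [key t ⟨hat.le, le_rfl⟩ x hx]

/-! ### The free heat kernel -/

lemma heatKernel_pos {d : ℕ} {t : ℝ} (ht : 0 < t) (x : Sp d) : 0 < heatKernel t x := by
  unfold heatKernel; positivity

lemma contDiffAt_heatKernel {d : ℕ} {t : ℝ} (ht : 0 < t) (x y : Sp d) :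
    ContDiffAt ℝ 2 (Function.uncurry fun (s : ℝ) (z : Sp d) => heatKernel s (z - y)) (t, x) := by
  unfold heatKernel Function.uncurry
  have h1 : ContDiffAt ℝ 2 (fun p : ℝ × Sp d => (4 * Real.pi * p.1) ^ (-(d : ℝ) / 2)) (t, x) :=
    ContDiffAt.rpow_const_of_ne (by fun_prop) (by simp; positivity)
  have h2 : ContDiffAt ℝ 2 (fun p : ℝ × Sp d => -‖p.2 - y‖ ^ 2 / (4 * p.1)) (t, x) := by
    refine ContDiffAt.div ?_ (by fun_prop) (by simp; positivity)
    exact (ContDiff.norm_sq ℝ (by fun_prop)).contDiffAt.neg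
  exact h1.mul h2.exp

lemma hasDerivAt_heatKernel_time {d : ℕ} {t : ℝ} (ht : 0 < t) (x : Sp d) :
    HasDerivAt (fun s => heatKernel s x)
      (heatKernel t x * (‖x‖ ^ 2 / (4 * t ^ 2) - d / (2 * t))) t := by
  unfold heatKernel
  have h1 : HasDerivAt (fun s : ℝ => (4 * Real.pi * s) ^ (-(d : ℝ) / 2))
      ((4 * Real.pi * t) ^ (-(d : ℝ) / 2) * (-(d : ℝ) / (2 * t))) t := by
    have hb : HasDerivAt (fun s : ℝ => 4 * Real.pi * s) (4 * Real.pi) t := by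
      simpa using (hasDerivAt_id t).const_mul (4 * Real.pi)
    have hpos : 0 < 4 * Real.pi * t := by positivity
    refine (hb.rpow_const (p := -(d : ℝ) / 2) (Or.inl hpos.ne')).congr_deriv ?_
    rw [Real.rpow_sub_one hpos.ne']
    field_simp
  have h2 : HasDerivAt (fun s : ℝ => -‖x‖ ^ 2 / (4 * s)) (‖x‖ ^ 2 / (4 * t ^ 2)) t := by
    have hb : HasDerivAt (fun s : ℝ => 4 * s) 4 t := by
      simpa using (hasDerivAt_id t).const_mul 4
    refine ((hasDerivAt_const t (-‖x‖ ^ 2)).div hb (by positivity)).congr_deriv ?_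
    field_simp
    ring
  refine (h1.mul h2.exp).congr_deriv ?_
  ring

lemma laplacian_heatKernel {d : ℕ} {t : ℝ} (ht : 0 < t) (x y : Sp d) :
    Δ (fun z : Sp d => heatKernel t (z - y)) x
      = heatKernel t (x - y) * (‖x - y‖ ^ 2 / (4 * t ^ 2) - d / (2 * t)) := by
  unfold heatKernel
  set N := (4 * Real.pi * t) ^ (-(d : ℝ) / 2)
  have hexp : ∀ r : ℝ, HasDerivAt (fun u => Real.exp (-u / (4 * t)))
      (Real.exp (-r / (4 * t)) * (-1 / (4 * t))) r := fun r =>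
    ((hasDerivAt_id r).neg.div_const (4 * t)).exp
  have h := laplacian_radial (Φ := fun u => N * Real.exp (-u / (4 * t)))
    (Φ₁ := fun u => N * (Real.exp (-u / (4 * t)) * (-1 / (4 * t))))
    (Φ₂ := fun u => N * (Real.exp (-u / (4 * t)) * (-1 / (4 * t)) * (-1 / (4 * t))))
    (by fun_prop) (fun r => (hexp r).const_mul N)
    (fun r => ((hexp r).mul_const _).const_mul N) x y
  rw [h]
  field_simp
  ring

lemma heat_equation_heatKernel {d : ℕ} {t : ℝ} (ht : 0 < t) (x y : Sp d) :
    deriv (fun s => heatKernel s (x - y)) t = Δ (fun z : Sp d => heatKernel t (z - y)) x := by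
  rw [(hasDerivAt_heatKernel_time ht (x - y)).deriv, laplacian_heatKernel ht]

/-! ### A localized heat kernel, which is a subsolution -/

/-- `e^{-κt} (1 - |x-y|²/R²)² h(t, x-y)`. -/
def localKernel {d : ℕ} (R κ : ℝ) (y : Sp d) (t : ℝ) (x : Sp d) : ℝ :=
  Real.exp (-κ * t) * (1 - ‖x - y‖ ^ 2 / R ^ 2) ^ 2 * heatKernel t (x - y)

lemma contDiffAt_localKernel {d : ℕ} (R κ : ℝ) {t : ℝ} (ht : 0 < t) (x y : Sp d) :
    ContDiffAt ℝ 2 (Function.uncurry (localKernel R κ y)) (t, x) := by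
  unfold localKernel Function.uncurry
  refine ContDiffAt.mul (ContDiffAt.mul (by fun_prop) ?_) (contDiffAt_heatKernel ht x y)
  have : ContDiff ℝ 2 fun p : ℝ × Sp d => ‖p.2 - y‖ ^ 2 := ContDiff.norm_sq ℝ (by fun_prop)
  exact ((contDiff_const.sub (this.div_const _)).pow 2).contDiffAt

/-- With X = R² - |x-y|², and up to positive factors, Δ - ∂ₜ of the localized kernel is (8R² -
(8+4d)X + κX²)/R⁴ plus a nonnegative cross term. The chosen κ is the one for which the discriminant
of the quadratic vanishes. -/
lemma localKernel_subsolution {d : ℕ} {R : ℝ} (hR : 0 < R) {t : ℝ} (ht : 0 < t) {x y : Sp d}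
    (hx : ‖x - y‖ ≤ R) :
    deriv (fun s => localKernel R ((8 + 4 * d) ^ 2 / (32 * R ^ 2)) y s x) t
      ≤ Δ (localKernel R ((8 + 4 * d) ^ 2 / (32 * R ^ 2)) y t) x := by
  set κ : ℝ := (8 + 4 * d) ^ 2 / (32 * R ^ 2) with hκ
  set u := ‖x - y‖ ^ 2 with hu
  set q := 1 - u / R ^ 2 with hq
  have hRu : R ^ 2 * q = R ^ 2 - u := by rw [hq]; field_simp
  have hq0 : 0 ≤ q := by
    have : u ≤ R ^ 2 := by rw [hu]; gcongr
    have h2 : 0 < R ^ 2 := by positivity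
    nlinarith
  have hH := heatKernel_pos ht (x - y)
  set H := heatKernel t (x - y) with hHdef
  -- time derivative
  have hdt : deriv (fun s => localKernel R κ y s x) t
      = Real.exp (-κ * t) * H * q ^ 2 * (-κ + u / (4 * t ^ 2) - d / (2 * t)) := by
    have h1 : HasDerivAt (fun s : ℝ => Real.exp (-κ * s)) (Real.exp (-κ * t) * (-κ)) t := by
      simpa using ((hasDerivAt_id t).const_mul (-κ)).exp
    have h2 : HasDerivAt (fun s => localKernel R κ y s x) _ t :=
      (h1.mul_const (q ^ 2)).mul (hasDerivAt_heatKernel_time ht (x - y))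
    rw [h2.deriv]
    ring
  have hlap : Δ (localKernel R κ y t) x = Real.exp (-κ * t) * H *
      (4 * u * (2 / R ^ 4 + q / (t * R ^ 2) + q ^ 2 / (16 * t ^ 2))
        - 2 * d * (2 * q / R ^ 2 + q ^ 2 / (4 * t))) := by
    set N := (4 * Real.pi * t) ^ (-(d : ℝ) / 2) with hN
    set E := Real.exp (-κ * t)
    have hexp : ∀ r : ℝ, HasDerivAt (fun u => Real.exp (-u / (4 * t)))
        (Real.exp (-r / (4 * t)) * (-1 / (4 * t))) r := fun r =>
      ((hasDerivAt_id r).neg.div_const (4 * t)).exp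
    have hlin : ∀ r : ℝ, HasDerivAt (fun u => 1 - u / R ^ 2) (-(1 / R ^ 2)) r := fun r => by
      simpa using ((hasDerivAt_id r).div_const (R ^ 2)).const_sub 1
    have h1 : ∀ r : ℝ, HasDerivAt (fun u => E * (1 - u / R ^ 2) ^ 2 *
        (N * Real.exp (-u / (4 * t))))
        (E * N * ((-(2 / R ^ 2) * (1 - r / R ^ 2) - 1 / (4 * t) * (1 - r / R ^ 2) ^ 2)
          * Real.exp (-r / (4 * t)))) r := fun r => by
      refine ((((hlin r).pow 2).const_mul E).mul ((hexp r).const_mul N)).congr_deriv ?_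
      simp
      ring
    have h2 : ∀ r : ℝ, HasDerivAt (fun r => E * N * ((-(2 / R ^ 2) * (1 - r / R ^ 2)
        - 1 / (4 * t) * (1 - r / R ^ 2) ^ 2) * Real.exp (-r / (4 * t))))
        (E * N * ((2 / R ^ 4 + (1 - r / R ^ 2) / (t * R ^ 2)
          + (1 - r / R ^ 2) ^ 2 / (16 * t ^ 2)) * Real.exp (-r / (4 * t)))) r := fun r => by
      refine (((((hlin r).const_mul _).sub (((hlin r).pow 2).const_mul _)).mul
        (hexp r)).const_mul (E * N)).congr_deriv ?_
      simp only [Nat.cast_ofNat, Nat.add_one_sub_one, pow_one, Pi.sub_apply, Pi.pow_apply]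
      field_simp
      ring
    have h := laplacian_radial (by fun_prop) h1 h2 x y
    have e : localKernel R κ y t = fun z : Sp d => E * (1 - ‖z - y‖ ^ 2 / R ^ 2) ^ 2 *
        (N * Real.exp (-‖z - y‖ ^ 2 / (4 * t))) := rfl
    have eH : H = N * Real.exp (-u / (4 * t)) := rfl
    rw [e, h, eH, ← hu, ← hq]
    ring
  rw [hdt, hlap, ← sub_nonneg]
  have hu' : u = R ^ 2 - R ^ 2 * q := by linarith
  have key : 0 ≤ 8 * R ^ 2 - (8 + 4 * d) * (R ^ 2 * q) + κ * (R ^ 2 * q) ^ 2 := by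
    have : 8 * R ^ 2 - (8 + 4 * d) * (R ^ 2 * q) + κ * (R ^ 2 * q) ^ 2
        = 8 * R ^ 2 * (1 - (8 + 4 * d) * q / 16) ^ 2 := by
      rw [hκ]; field_simp; ring
    rw [this]; positivity
  have hu0 : 0 ≤ u := by positivity
  have hfin : Real.exp (-κ * t) * H * (4 * u * (2 / R ^ 4 + q / (t * R ^ 2) + q ^ 2 / (16 * t ^ 2))
        - 2 * d * (2 * q / R ^ 2 + q ^ 2 / (4 * t)))
      - Real.exp (-κ * t) * H * q ^ 2 * (-κ + u / (4 * t ^ 2) - d / (2 * t))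
      = Real.exp (-κ * t) * H * ((8 * R ^ 2 - (8 + 4 * d) * (R ^ 2 * q) + κ * (R ^ 2 * q) ^ 2)
        / R ^ 4 + 4 * u * q / (t * R ^ 2)) := by
    have : 4 * u * (2 / R ^ 4) = 8 * (R ^ 2 - R ^ 2 * q) / R ^ 4 := by rw [hu']; ring
    have h2 : 4 * u * (2 / R ^ 4 + q / (t * R ^ 2) + q ^ 2 / (16 * t ^ 2))
      = 8 * (R ^ 2 - R ^ 2 * q) / R ^ 4 + 4 * u * (q / (t * R ^ 2) + q ^ 2 / (16 * t ^ 2)) := by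
      rw [← this]; ring
    rw [h2]
    field_simp
    ring
  rw [hfin]
  positivity

/-! ### Bounds for the Dirichlet heat kernel -/

section Bounds

variable {d : ℕ} {D : Set (Sp d)}

/-- This competitor makes the Perron family nonempty and the corrector nonnegative, which is the
upper bound G ≤ h. -/
lemma isHeatSubsolution_zero (y : Sp d) :
    IsHeatSubsolution D (fun s z => heatKernel s (z - y)) (fun _ _ => 0) where
  continuousOn := continuousOn_const
  contDiffOn := contDiffOn_const
  sub t ht x hx := by
    have : Δ (fun _ : Sp d => (0 : ℝ)) x = 0 := by
      rw [InnerProductSpace.laplacian_const]; rfl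
    simp [this]
  initial x hx := le_rfl
  lateral t ht x hx := (heatKernel_pos ht _).le

lemma IsHeatSubsolution.le_heatKernel (hDo : IsOpen D) (hDb : Bornology.IsBounded D) {y : Sp d}
    {v : ℝ → Sp d → ℝ} (hv : IsHeatSubsolution D (fun s z => heatKernel s (z - y)) v) {t : ℝ}
    (ht : 0 < t) {x : Sp d} (hx : x ∈ closure D) : v t x ≤ heatKernel t (x - y) :=
  hv.le_of_supersolution hDo hDb (fun _ ht x => contDiffAt_heatKernel ht x y)
    (fun _ ht x _ => (heat_equation_heatKernel ht x y).ge)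
    (fun _ ht _ _ => (heatKernel_pos ht _).le) t ht x hx

lemma bddAbove_subsolutions (hDo : IsOpen D) (hDb : Bornology.IsBounded D) (y : Sp d) {t : ℝ}
    (ht : 0 < t) {x : Sp d} (hx : x ∈ closure D) :
    BddAbove {r : ℝ | ∃ v : ℝ → Sp d → ℝ,
      IsHeatSubsolution D (fun s z => heatKernel s (z - y)) v ∧ r = v t x} :=
  ⟨heatKernel t (x - y), by rintro r ⟨v, hv, rfl⟩; exact hv.le_heatKernel hDo hDb ht hx⟩

lemma dirichletKernel_nonneg (hDo : IsOpen D) (hDb : Bornology.IsBounded D) (y : Sp d) {t : ℝ}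
    (ht : 0 < t) {x : Sp d} (hx : x ∈ closure D) : 0 ≤ dirichletKernel D t x y := by
  unfold dirichletKernel
  rw [sub_nonneg]
  refine csSup_le ⟨0, _, isHeatSubsolution_zero y, rfl⟩ ?_
  rintro r ⟨v, hv, rfl⟩
  exact hv.le_heatKernel hDo hDb ht hx

lemma dirichletKernel_le (hDo : IsOpen D) (hDb : Bornology.IsBounded D) (y : Sp d) {t : ℝ}
    (ht : 0 < t) {x : Sp d} (hx : x ∈ closure D) :
    dirichletKernel D t x y ≤ heatKernel t (x - y) := by
  unfold dirichletKernel
  rw [sub_le_self_iff]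
  exact le_csSup (bddAbove_subsolutions hDo hDb y ht hx) ⟨_, isHeatSubsolution_zero y, rfl⟩

/-- Every competitor v must lie below h minus the localized kernel on the ball. That difference is a
nonnegative supersolution there, and on the sphere the localized kernel vanishes, so the known bound
v ≤ h supplies the lateral values. -/
lemma localKernel_le_dirichletKernel (hDo : IsOpen D) (hDb : Bornology.IsBounded D) {y : Sp d}
    {R : ℝ} (hR : 0 < R) (hball : Metric.closedBall y R ⊆ D) {t : ℝ} (ht : 0 < t) {x : Sp d}
    (hx : x ∈ Metric.closedBall y R) :
    localKernel R ((8 + 4 * d) ^ 2 / (32 * R ^ 2)) y t x ≤ dirichletKernel D t x y := by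
  set κ : ℝ := (8 + 4 * d) ^ 2 / (32 * R ^ 2) with hκ
  have hκ0 : 0 ≤ κ := by positivity
  unfold dirichletKernel
  rw [le_sub_comm]
  refine csSup_le ⟨0, _, isHeatSubsolution_zero y, rfl⟩ ?_
  rintro r ⟨v, hv, rfl⟩
  set B : ℝ → Sp d → ℝ := fun s z => heatKernel s (z - y) - localKernel R κ y s z with hB
  have hcl : closure (Metric.ball y R) = Metric.closedBall y R := closure_ball y hR.ne'
  have hsubD : Metric.ball y R ⊆ D := Metric.ball_subset_closedBall.trans hball
  have hv' : IsHeatSubsolution (Metric.ball y R) B v :=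
    { continuousOn := hv.continuousOn.mono (prod_mono subset_rfl (closure_mono hsubD))
      contDiffOn := hv.contDiffOn.mono (prod_mono subset_rfl hsubD)
      sub := fun t ht x hx => hv.sub t ht x (hsubD hx)
      initial := fun x hx => hv.initial x (closure_mono hsubD hx)
      lateral := fun s hs z hz => by
        rw [frontier_ball y hR.ne', mem_sphere_iff_norm] at hz
        have h0 : localKernel R κ y s z = 0 := by
          unfold localKernel; rw [hz]; field_simp; ring
        have hzD : z ∈ closure D := subset_closure (hball (by
          rw [mem_closedBall_iff_norm, hz]))
        have := hv.le_heatKernel hDo hDb hs hzD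
        simp only [hB, h0, sub_zero]
        exact this }
  refine hv'.le_of_supersolution Metric.isOpen_ball Metric.isBounded_ball
    (fun s hs z => (contDiffAt_heatKernel hs z y).sub (contDiffAt_localKernel R κ hs z y))
    (fun s hs z hz => ?_) (fun s hs z hz => ?_) t ht x (hcl ▸ hx)
  · have h1 := contDiffAt_heatKernel hs z y
    have h2 := contDiffAt_localKernel R κ hs z y
    have h1x : ContDiffAt ℝ 2 (fun z : Sp d => heatKernel s (z - y)) z :=
      ContDiffAt.comp (f := fun z : Sp d => (s, z)) z h1 (by fun_prop)
    have h2x : ContDiffAt ℝ 2 (localKernel R κ y s) z :=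
      ContDiffAt.comp (f := fun z : Sp d => (s, z)) z h2 (by fun_prop)
    have h1t : ContDiffAt ℝ 2 (fun r => heatKernel r (z - y)) s :=
      ContDiffAt.comp (f := fun r : ℝ => (r, z)) s h1 (by fun_prop)
    have h2t : ContDiffAt ℝ 2 (fun r => localKernel R κ y r z) s :=
      ContDiffAt.comp (f := fun r : ℝ => (r, z)) s h2 (by fun_prop)
    have e1 : Δ (B s) z = Δ (fun z : Sp d => heatKernel s (z - y)) z - Δ (localKernel R κ y s) z :=
      h1x.laplacian_sub h2x
    have e2 : deriv (fun r => B r z) s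
        = deriv (fun r => heatKernel r (z - y)) s - deriv (fun r => localKernel R κ y r z) s :=
      deriv_sub (h1t.differentiableAt (by norm_num)) (h2t.differentiableAt (by norm_num))
    rw [e1, e2, heat_equation_heatKernel hs]
    have hz' : ‖z - y‖ ≤ R := (mem_ball_iff_norm.1 hz).le
    linarith [localKernel_subsolution hR hs hz']
  · rw [hcl, mem_closedBall_iff_norm] at hz
    have hq0 : 0 ≤ 1 - ‖z - y‖ ^ 2 / R ^ 2 := by
      rw [sub_nonneg, div_le_one (by positivity)]; gcongr
    have hq1 : 1 - ‖z - y‖ ^ 2 / R ^ 2 ≤ 1 := by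
      rw [sub_le_self_iff]; positivity
    have he : Real.exp (-κ * s) ≤ 1 := by
      rw [Real.exp_le_one_iff]; nlinarith
    have : Real.exp (-κ * s) * (1 - ‖z - y‖ ^ 2 / R ^ 2) ^ 2 ≤ 1 :=
      mul_le_one₀ he (by positivity) (pow_le_one₀ hq0 hq1)
    simp only [hB, localKernel, sub_nonneg]
    exact mul_le_of_le_one_left (heatKernel_pos hs _).le this

/-- Near the diagonal, the Dirichlet kernel is bounded below on compact time intervals. -/
lemma exists_pos_le_dirichletKernel (hDo : IsOpen D) (hDb : Bornology.IsBounded D) {y : Sp d}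
    (hy : y ∈ D) : ∃ R > 0, ∀ x ∈ Metric.ball y R, ∀ a > 0, ∀ b,
      ∃ c > 0, ∀ t ∈ Icc a b, c ≤ dirichletKernel D t x y := by
  obtain ⟨R, hR, hball⟩ := Metric.nhds_basis_closedBall.mem_iff.1 (hDo.mem_nhds hy)
  refine ⟨R, hR, fun x hx a ha b => ?_⟩
  set κ : ℝ := (8 + 4 * d) ^ 2 / (32 * R ^ 2)
  rcases (Icc a b).eq_empty_or_nonempty with hE | hne
  · exact ⟨1, one_pos, by simp [hE]⟩
  have hcont : ContinuousOn (fun t => localKernel R κ y t x) (Icc a b) := fun t ht =>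
    (ContDiffAt.comp (f := fun r : ℝ => (r, x)) (n := 2) t
      (contDiffAt_localKernel R κ (lt_of_lt_of_le ha ht.1) x y)
      (by fun_prop)).continuousAt.continuousWithinAt
  obtain ⟨t₀, ht₀, hmin⟩ := isCompact_Icc.exists_isMinOn hne hcont
  refine ⟨localKernel R κ y t₀ x, ?_, fun t ht => (hmin ht).trans
    (localKernel_le_dirichletKernel hDo hDb hR hball (lt_of_lt_of_le ha ht.1)
      (Metric.ball_subset_closedBall hx))⟩
  have hq : 0 < 1 - ‖x - y‖ ^ 2 / R ^ 2 := by
    rw [sub_pos, div_lt_one (by positivity)]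
    have := mem_ball_iff_norm.1 hx
    gcongr
  unfold localKernel
  have := heatKernel_pos (lt_of_lt_of_le ha ht₀.1) (x - y)
  positivity

end Bounds

/-! ### Size of the heat kernel -/

/-- Raise u/β ≤ e^{u/β} to the power β. -/
lemma exp_neg_le_rpow {β : ℝ} (hβ : 0 < β) {u : ℝ} (hu : 0 < u) :
    Real.exp (-u) ≤ (β / u) ^ β := by
  have h1 : u / β ≤ Real.exp (u / β) := by linarith [Real.add_one_le_exp (u / β)]
  have h2 : (u / β) ^ β ≤ Real.exp u := by
    calc (u / β) ^ β ≤ Real.exp (u / β) ^ β := by gcongr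
      _ = Real.exp u := by rw [← Real.exp_mul]; congr 1; field_simp
  have h3 : (β / u) ^ β = ((u / β) ^ β)⁻¹ := by
    rw [← Real.inv_rpow (by positivity), inv_div]
  rw [h3, Real.exp_neg]
  gcongr

/-- The heat kernel is bounded by a power of `t` and a negative power of `‖x‖`. -/
lemma heatKernel_le_rpow {d : ℕ} {β : ℝ} (hβ : 0 < β) {t : ℝ} (ht : 0 < t) {x : Sp d}
    (hx : x ≠ 0) :
    heatKernel t x ≤ (4 * Real.pi) ^ (-(d : ℝ) / 2) * (4 * β) ^ β
      * t ^ (β - d / 2) * ‖x‖ ^ (-(2 * β)) := by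
  have hx' : 0 < ‖x‖ := norm_pos_iff.2 hx
  unfold heatKernel
  have h1 : Real.exp (-‖x‖ ^ 2 / (4 * t)) ≤ (4 * β) ^ β * t ^ β * ‖x‖ ^ (-(2 * β)) := by
    have := exp_neg_le_rpow hβ (u := ‖x‖ ^ 2 / (4 * t)) (by positivity)
    rw [neg_div]
    refine this.trans_eq ?_
    rw [show β / (‖x‖ ^ 2 / (4 * t)) = (4 * β * t) * (‖x‖ ^ 2)⁻¹ by field_simp,
      Real.mul_rpow (by positivity) (by positivity), Real.mul_rpow (by positivity) ht.le,
      ← Real.rpow_natCast, ← Real.rpow_neg hx'.le, ← Real.rpow_mul hx'.le]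
    congr 2
    push_cast
    ring
  have h2 : (4 * Real.pi * t) ^ (-(d : ℝ) / 2)
      = (4 * Real.pi) ^ (-(d : ℝ) / 2) * t ^ (-(d : ℝ) / 2) :=
    Real.mul_rpow (by positivity) ht.le
  have h3 : t ^ (β - d / 2) = t ^ (-(d : ℝ) / 2) * t ^ β := by
    rw [← Real.rpow_add ht]; congr 1; ring
  rw [h2, h3]
  calc _ ≤ (4 * Real.pi) ^ (-(d : ℝ) / 2) * t ^ (-(d : ℝ) / 2)
        * ((4 * β) ^ β * t ^ β * ‖x‖ ^ (-(2 * β))) := by gcongr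
    _ = _ := by ring

/-- The resolvent kernel `∫₀^∞ e^{-θ s} h(s, x) ds`. -/
def potential {d : ℕ} (θ : ℝ) (x : Sp d) : ℝ≥0∞ :=
  ∫⁻ s in Ioi (0 : ℝ), ENNReal.ofReal (Real.exp (-θ * s) * heatKernel s x)

lemma lintegral_gamma {γ θ : ℝ} (hγ : 0 < γ) (hθ : 0 < θ) :
    ∫⁻ s in Ioi (0 : ℝ), ENNReal.ofReal (s ^ (γ - 1) * Real.exp (-(θ * s)))
      = ENNReal.ofReal (Real.Gamma γ * θ ^ (-γ)) := by
  have h := Real.integral_rpow_mul_exp_neg_mul_Ioi hγ hθ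
  have hpos : 0 < (1 / θ) ^ γ * Real.Gamma γ := by
    have := Real.Gamma_pos_of_pos hγ
    positivity
  -- An undefined Bochner integral is 0, so the positive value in `h` forces integrability.
  have hInt : IntegrableOn (fun s : ℝ => s ^ (γ - 1) * Real.exp (-(θ * s))) (Ioi 0) := by
    by_contra hcon
    rw [integral_undef hcon] at h
    exact hpos.ne h
  rw [← ofReal_integral_eq_lintegral_ofReal hInt, h]
  · congr 1
    rw [one_div, Real.inv_rpow hθ.le, Real.rpow_neg hθ.le]
    ring
  · refine (ae_restrict_iff' measurableSet_Ioi).2 (ae_of_all _ fun s hs => ?_)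
    have : (0 : ℝ) < s := hs
    positivity

/-- Trading the exponential for a power with parameter β leaves the Gamma integral of s^{β-d/2}
e^{-θs}, which converges at 0 because β > d/2 - 1. Its value is a negative power of θ, the source of
all smallness later. -/
lemma potential_le {d : ℕ} {β : ℝ} (hβ : 0 < β) (hβd : (d : ℝ) / 2 - 1 < β) :
    ∃ C : ℝ, 0 < C ∧ ∀ θ : ℝ, 0 < θ → ∀ x : Sp d,
      potential θ x ≤ ENNReal.ofReal (C * θ ^ (-(β - d / 2 + 1))) * ‖x‖ₑ ^ (-(2 * β)) := by
  set γ := β - d / 2 + 1 with hγdef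
  have hγ : 0 < γ := by linarith
  have hΓ := Real.Gamma_pos_of_pos hγ
  set A : ℝ := (4 * Real.pi) ^ (-(d : ℝ) / 2) * (4 * β) ^ β with hA
  have hA0 : 0 < A := by positivity
  refine ⟨A * Real.Gamma γ, by positivity, fun θ hθ x => ?_⟩
  -- At the origin the right side is ∞, a negative power of 0 times a positive constant.
  rcases eq_or_ne x 0 with rfl | hx
  · have h1 : ‖(0 : Sp d)‖ₑ ^ (-(2 * β)) = ∞ := by
      rw [enorm_zero, ENNReal.zero_rpow_of_neg (by linarith)]
    rw [h1, ENNReal.mul_top]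
    · exact le_top
    · rw [Ne, ENNReal.ofReal_eq_zero, not_le]
      positivity
  have hx' : 0 < ‖x‖ := norm_pos_iff.2 hx
  have h1 : ‖x‖ₑ ^ (-(2 * β)) = ENNReal.ofReal (‖x‖ ^ (-(2 * β))) := by
    rw [← ofReal_norm, ENNReal.ofReal_rpow_of_pos hx']
  calc potential θ x
      ≤ ∫⁻ s in Ioi (0 : ℝ), ENNReal.ofReal (A * ‖x‖ ^ (-(2 * β))) *
          ENNReal.ofReal (s ^ (γ - 1) * Real.exp (-(θ * s))) := by
        refine setLIntegral_mono' measurableSet_Ioi fun s hs => ?_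
        have hs' : (0 : ℝ) < s := hs
        rw [← ENNReal.ofReal_mul (by positivity)]
        refine ENNReal.ofReal_le_ofReal ?_
        have := heatKernel_le_rpow hβ hs' hx
        have e : γ - 1 = β - d / 2 := by rw [hγdef]; ring
        rw [e, neg_mul]
        calc Real.exp (-(θ * s)) * heatKernel s x
            ≤ Real.exp (-(θ * s)) * (A * s ^ (β - d / 2) * ‖x‖ ^ (-(2 * β))) := by gcongr
          _ = _ := by ring
    _ = ENNReal.ofReal (A * ‖x‖ ^ (-(2 * β))) * ENNReal.ofReal (Real.Gamma γ * θ ^ (-γ)) := by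
        rw [lintegral_const_mul' _ _ ENNReal.ofReal_ne_top, lintegral_gamma hγ hθ]
    _ = _ := by
        rw [h1, ← ENNReal.ofReal_mul (by positivity), ← ENNReal.ofReal_mul (by positivity)]
        congr 1
        ring

lemma lintegral_heatKernel {d : ℕ} {t : ℝ} (ht : 0 < t) (x : Sp d) :
    ∫⁻ y, ENNReal.ofReal (heatKernel t (x - y)) = 1 := by
  have h1 : ∫⁻ y, ENNReal.ofReal (heatKernel t (x - y)) = ∫⁻ y, ENNReal.ofReal (heatKernel t y) :=
    lintegral_sub_left_eq_self (fun y => ENNReal.ofReal (heatKernel t y)) x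
  have h := GaussianFourier.integral_rexp_neg_mul_sq_norm (V := Sp d) (b := 1 / (4 * t))
    (by positivity)
  have hfin : Module.finrank ℝ (Sp d) = d := by simp
  rw [hfin] at h
  have hpos : 0 < (Real.pi / (1 / (4 * t))) ^ ((d : ℝ) / 2) := by positivity
  have hInt : Integrable (fun v : Sp d => Real.exp (-(1 / (4 * t)) * ‖v‖ ^ 2)) := by
    by_contra hcon
    rw [integral_undef hcon] at h
    exact hpos.ne h
  have e : ∀ y : Sp d, heatKernel t y
      = (4 * Real.pi * t) ^ (-(d : ℝ) / 2) * Real.exp (-(1 / (4 * t)) * ‖y‖ ^ 2) := fun y => by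
    unfold heatKernel
    congr 2
    ring
  rw [h1]
  simp_rw [e]
  rw [← ofReal_integral_eq_lintegral_ofReal (hInt.const_mul _)
    (ae_of_all _ fun y => by positivity), integral_const_mul, h,
    show Real.pi / (1 / (4 * t)) = 4 * Real.pi * t by field_simp,
    ← Real.rpow_add (by positivity)]
  simp [neg_div]

/-! ### Measurability of the Dirichlet heat kernel -/

section Measurability

variable {d : ℕ} {D : Set (Sp d)}

/-- The boundary stays at distance at least ρ from y₀, and there the radial derivative of the heat
kernel is bounded uniformly in time, so a small shift of an interior pole changes the boundary data
little. -/
lemma heatKernel_translate (hDo : IsOpen D) {y₀ : Sp d} (hy₀ : y₀ ∈ D) {η : ℝ} (hη : 0 < η) :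
    ∀ᶠ y in 𝓝 y₀, ∀ s > 0, ∀ z ∈ frontier D,
      heatKernel s (z - y₀) ≤ heatKernel s (z - y) + η := by
  obtain ⟨ρ, hρ, hball⟩ := Metric.isOpen_iff.1 hDo y₀ hy₀
  -- With this β the power t^{β-d/2} is t, which cancels the factor 1/s of the radial derivative.
  set β : ℝ := d / 2 + 1 with hβ
  have hβ0 : 0 < β := by positivity
  set A : ℝ := (4 * Real.pi) ^ (-(d : ℝ) / 2) * (4 * β) ^ β with hA
  have hA0 : 0 < A := by positivity
  set K : ℝ := A * ρ ^ (1 - 2 * β) with hK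
  have hK0 : 0 < K := by positivity
  filter_upwards [Metric.ball_mem_nhds y₀ (show 0 < min ρ (η / K) by positivity)]
    with y hy s hs z hz
  set δ := ‖y - y₀‖ with hδ
  have hδρ : δ < ρ := lt_of_lt_of_le (mem_ball_iff_norm.1 hy) (min_le_left _ _)
  have hδη : δ < η / K := lt_of_lt_of_le (mem_ball_iff_norm.1 hy) (min_le_right _ _)
  have hδ0 : 0 ≤ δ := norm_nonneg _
  set a := ‖z - y₀‖ with ha
  have haρ : ρ ≤ a := by
    by_contra! hlt
    have hzD : z ∈ D := hball (mem_ball_iff_norm.2 hlt)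
    rw [hDo.frontier_eq] at hz
    exact hz.2 hzD
  have ha0 : 0 < a := hρ.trans_le haρ
  have hba : ‖z - y‖ ≤ a + δ := by
    have : z - y = (z - y₀) - (y - y₀) := by abel
    rw [this]; exact norm_sub_le _ _
  set N := (4 * Real.pi * s) ^ (-(d : ℝ) / 2)
  have h1 : N * Real.exp (-(a + δ) ^ 2 / (4 * s)) ≤ heatKernel s (z - y) := by
    unfold heatKernel
    gcongr
  have h2 : Real.exp (-a ^ 2 / (4 * s)) - Real.exp (-(a + δ) ^ 2 / (4 * s))
      ≤ Real.exp (-a ^ 2 / (4 * s)) * (a * δ / s) := by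
    have e1 : -(a + δ) ^ 2 / (4 * s) = -a ^ 2 / (4 * s) + -((2 * a * δ + δ ^ 2) / (4 * s)) := by
      ring
    rw [e1, Real.exp_add]
    have h3 := Real.add_one_le_exp (-((2 * a * δ + δ ^ 2) / (4 * s)))
    have h4 : (2 * a * δ + δ ^ 2) / (4 * s) ≤ a * δ / s := by
      rw [div_le_div_iff₀ (by positivity) hs]
      nlinarith [mul_nonneg hδ0 hs.le, mul_nonneg (mul_nonneg hδ0 hs.le) (sub_nonneg.2 hδρ.le),
        mul_nonneg (mul_nonneg hδ0 hs.le) (sub_nonneg.2 haρ)]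
    nlinarith [Real.exp_pos (-a ^ 2 / (4 * s))]
  have h5 : heatKernel s (z - y₀) * (a / s) ≤ K := by
    have hne : z - y₀ ≠ 0 := norm_pos_iff.1 ha0
    have h6 := heatKernel_le_rpow hβ0 hs hne
    rw [← hA, ← ha, show β - (d : ℝ) / 2 = 1 by rw [hβ]; ring, Real.rpow_one] at h6
    calc heatKernel s (z - y₀) * (a / s) ≤ A * s * a ^ (-(2 * β)) * (a / s) := by gcongr
      _ = A * (a ^ (-(2 * β)) * a) := by field_simp
      _ = A * a ^ (1 - 2 * β) := by
          rw [← Real.rpow_add_one ha0.ne']; congr 2; ring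
      _ ≤ A * ρ ^ (1 - 2 * β) := by
          gcongr A * ?_
          exact Real.rpow_le_rpow_of_nonpos hρ haρ (by
            have : (0 : ℝ) ≤ d := Nat.cast_nonneg d
            rw [hβ]; linarith)
  have h7 : heatKernel s (z - y₀) = N * Real.exp (-a ^ 2 / (4 * s)) := rfl
  have hN : 0 < N := by positivity
  have h8 : K * δ ≤ η := by
    have := (lt_div_iff₀ hK0).1 hδη
    linarith
  have h9 : N * (Real.exp (-a ^ 2 / (4 * s)) - Real.exp (-(a + δ) ^ 2 / (4 * s)))
      ≤ heatKernel s (z - y₀) * (a / s) * δ := by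
    rw [h7]
    calc _ ≤ N * (Real.exp (-a ^ 2 / (4 * s)) * (a * δ / s)) := by gcongr
      _ = _ := by ring
  have h10 : heatKernel s (z - y₀) * (a / s) * δ ≤ K * δ := by gcongr
  nlinarith

/-- The corrector, as a function of `(t, x, y)`. -/
def corrector (D : Set (Sp d)) (z : ℝ × Sp d × Sp d) : ℝ :=
  sSup {r : ℝ | ∃ v : ℝ → Sp d → ℝ,
      IsHeatSubsolution D (fun s w => heatKernel s (w - z.2.2)) v ∧ r = v z.1 z.2.1}

/-- Lower semicontinuity, which gives measurability although the supremum is over an uncountable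
family. A competitor with value above r, lowered by η, is still a competitor for nearby poles by
`heatKernel_translate`, and it is continuous in (t, x). -/
lemma isOpen_lt_corrector (hDo : IsOpen D) (hDb : Bornology.IsBounded D) (r : ℝ) :
    IsOpen {z : ℝ × Sp d × Sp d | z ∈ Ioi (0 : ℝ) ×ˢ D ×ˢ D ∧ r < corrector D z} := by
  rw [isOpen_iff_mem_nhds]
  rintro ⟨t₀, x₀, y₀⟩ ⟨⟨ht₀, hx₀, hy₀⟩, hr⟩
  simp only at ht₀ hx₀ hy₀
  obtain ⟨_, ⟨v, hv, rfl⟩, hrv⟩ := exists_lt_of_lt_csSup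
    (s := {r : ℝ | ∃ v : ℝ → Sp d → ℝ,
      IsHeatSubsolution D (fun s w => heatKernel s (w - y₀)) v ∧ r = v t₀ x₀})
    ⟨0, _, isHeatSubsolution_zero y₀, rfl⟩ hr
  set η := (v t₀ x₀ - r) / 2 with hη
  have hη0 : 0 < η := by rw [hη]; linarith
  have hvc : ContinuousAt (Function.uncurry v) (t₀, x₀) :=
    (hv.contDiffOn.contDiffAt ((isOpen_Ioi.prod hDo).mem_nhds ⟨ht₀, hx₀⟩)).continuousAt
  have hvc' : ContinuousAt (fun z : ℝ × Sp d × Sp d => v z.1 z.2.1) (t₀, x₀, y₀) :=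
    ContinuousAt.comp (f := fun z : ℝ × Sp d × Sp d => (z.1, z.2.1)) (g := Function.uncurry v)
      hvc (by fun_prop)
  have e1 : ∀ᶠ z : ℝ × Sp d × Sp d in 𝓝 (t₀, x₀, y₀), r + η < v z.1 z.2.1 :=
    hvc'.eventually_const_lt (by simp only [hη]; linarith)
  have e2 : ∀ᶠ z : ℝ × Sp d × Sp d in 𝓝 (t₀, x₀, y₀), ∀ s > 0, ∀ w ∈ frontier D,
      heatKernel s (w - y₀) ≤ heatKernel s (w - z.2.2) + η := by
    have : Tendsto (fun z : ℝ × Sp d × Sp d => z.2.2) (𝓝 (t₀, x₀, y₀)) (𝓝 y₀) :=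
      (continuous_snd.comp continuous_snd).tendsto _
    exact this.eventually (heatKernel_translate hDo hy₀ hη0)
  have e3 : ∀ᶠ z : ℝ × Sp d × Sp d in 𝓝 (t₀, x₀, y₀), z ∈ Ioi (0 : ℝ) ×ˢ D ×ˢ D :=
    (isOpen_Ioi.prod (hDo.prod hDo)).mem_nhds ⟨ht₀, hx₀, hy₀⟩
  filter_upwards [e1, e2, e3] with z h1 h2 h3
  refine ⟨h3, ?_⟩
  have hv' : IsHeatSubsolution D (fun s w => heatKernel s (w - z.2.2)) (fun s w => v s w - η) :=
    { continuousOn := hv.continuousOn.sub continuousOn_const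
      contDiffOn := hv.contDiffOn.sub contDiffOn_const
      sub := fun t ht x hx => by
        have hC : ContDiffAt ℝ 2 (Function.uncurry v) (t, x) :=
          hv.contDiffOn.contDiffAt ((isOpen_Ioi.prod hDo).mem_nhds ⟨ht, hx⟩)
        have hCx : ContDiffAt ℝ 2 (v t) x := ContDiffAt.comp (f := fun w : Sp d => (t, w))
          (g := Function.uncurry v) x hC (by fun_prop)
        have h4 : Δ (fun w => v t w - η) x = Δ (v t) x - Δ (fun _ : Sp d => η) x :=
          hCx.laplacian_sub contDiffAt_const
        have h5 : Δ (fun _ : Sp d => η) x = 0 := by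
          rw [InnerProductSpace.laplacian_const]; rfl
        rw [h4, h5, deriv_sub_const, sub_zero]
        exact hv.sub t ht x hx
      initial := fun x hx => by linarith [hv.initial x hx]
      lateral := fun t ht x hx => by linarith [hv.lateral t ht x hx, h2 t ht x hx] }
  have : v z.1 z.2.1 - η ≤ corrector D z :=
    le_csSup (bddAbove_subsolutions hDo hDb z.2.2 h3.1 (subset_closure h3.2.1)) ⟨_, hv', rfl⟩
  linarith

lemma measurable_heatKernel : Measurable fun z : ℝ × Sp d => heatKernel z.1 z.2 := by
  unfold heatKernel
  fun_prop

/-- The Dirichlet kernel, extended by zero off `(0, ∞) × D × D`. -/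
def dirKer (D : Set (Sp d)) (t : ℝ) (x y : Sp d) : ℝ :=
  (Ioi (0 : ℝ) ×ˢ D ×ˢ D).indicator (fun z => dirichletKernel D z.1 z.2.1 z.2.2) (t, x, y)

lemma measurable_dirKer (hDo : IsOpen D) (hDb : Bornology.IsBounded D) :
    Measurable fun z : ℝ × Sp d × Sp d => dirKer D z.1 z.2.1 z.2.2 := by
  have hO : MeasurableSet (Ioi (0 : ℝ) ×ˢ D ×ˢ D) :=
    measurableSet_Ioi.prod (hDo.measurableSet.prod hDo.measurableSet)
  have h1 : Measurable ((Ioi (0 : ℝ) ×ˢ D ×ˢ D).indicator (corrector D)) := by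
    refine measurable_of_Ioi fun r => ?_
    have : (Ioi (0 : ℝ) ×ˢ D ×ˢ D).indicator (corrector D) ⁻¹' Ioi r
        = {z | z ∈ Ioi (0 : ℝ) ×ˢ D ×ˢ D ∧ r < corrector D z}
          ∪ ((Ioi (0 : ℝ) ×ˢ D ×ˢ D)ᶜ ∩ {_z | r < 0}) := by
      ext z
      by_cases hz : z ∈ Ioi (0 : ℝ) ×ˢ D ×ˢ D
      · rw [mem_preimage, indicator_of_mem hz]
        exact ⟨fun h => Or.inl ⟨hz, h⟩, fun h => h.elim (fun h => h.2) fun h => absurd hz h.1⟩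
      · rw [mem_preimage, indicator_of_notMem hz]
        exact ⟨fun h => Or.inr ⟨hz, h⟩, fun h => h.elim (fun h => absurd h.1 hz) fun h => h.2⟩
    rw [this]
    exact (isOpen_lt_corrector hDo hDb r).measurableSet.union
      (hO.compl.inter (MeasurableSet.const _))
  have h2 : Measurable ((Ioi (0 : ℝ) ×ˢ D ×ˢ D).indicator
      fun z : ℝ × Sp d × Sp d => heatKernel z.1 (z.2.1 - z.2.2)) := by
    refine Measurable.indicator ?_ hO
    have : Measurable fun z : ℝ × Sp d × Sp d => (z.1, z.2.1 - z.2.2) := by fun_prop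
    exact measurable_heatKernel.comp this
  have h3 : (fun z : ℝ × Sp d × Sp d => dirKer D z.1 z.2.1 z.2.2)
      = (Ioi (0 : ℝ) ×ˢ D ×ˢ D).indicator
          (fun z : ℝ × Sp d × Sp d => heatKernel z.1 (z.2.1 - z.2.2))
        - (Ioi (0 : ℝ) ×ˢ D ×ˢ D).indicator (corrector D) := by
    rw [← indicator_sub']
    rfl
  rw [h3]
  exact h2.sub h1

lemma dirKer_eq {t : ℝ} (ht : 0 < t) {x y : Sp d} (hx : x ∈ D) (hy : y ∈ D) :
    dirKer D t x y = dirichletKernel D t x y :=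
  indicator_of_mem (s := Ioi (0 : ℝ) ×ˢ D ×ˢ D) (a := (t, x, y)) ⟨ht, hx, hy⟩ _

lemma dirKer_nonneg (hDo : IsOpen D) (hDb : Bornology.IsBounded D) (t : ℝ) (x y : Sp d) :
    0 ≤ dirKer D t x y :=
  indicator_nonneg (fun _ hz => dirichletKernel_nonneg hDo hDb _ hz.1 (subset_closure hz.2.1)) _

lemma dirKer_le (hDo : IsOpen D) (hDb : Bornology.IsBounded D) {t : ℝ} (ht : 0 < t)
    (x y : Sp d) : dirKer D t x y ≤ heatKernel t (x - y) :=
  indicator_apply_le' (fun hz => dirichletKernel_le hDo hDb _ hz.1 (subset_closure hz.2.1))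
    (fun _ => (heatKernel_pos ht _).le)

end Measurability

/-! ### Kernels with finite values -/

/-- Cutting the parameter space by the integer part of the total mass leaves pieces on which the
kernel is uniformly bounded. No uniform bound on the random mass of the noise is available. -/
lemma isSFiniteKernel_of_forall_lt_top {α β : Type*} [MeasurableSpace α] [MeasurableSpace β]
    (κ : Kernel α β) (h : ∀ a, κ a univ < ∞) : IsSFiniteKernel κ := by
  classical
  have hm : Measurable fun a => κ a univ := κ.measurable_coe MeasurableSet.univ
  let s : ℕ → Set α := fun n => {a | ⌊(κ a univ).toReal⌋₊ = n}
  have hs : ∀ n, MeasurableSet (s n) := fun n =>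
    (Nat.measurable_floor.comp hm.ennreal_toReal) (measurableSet_singleton n)
  refine ⟨⟨fun n => Kernel.piecewise (hs n) κ 0, fun n => ?_, ?_⟩⟩
  · refine ⟨⟨(n : ℝ≥0∞) + 1, by simp, fun a => ?_⟩⟩
    rw [Kernel.piecewise_apply]
    split_ifs with ha
    · have h1 : (κ a univ).toReal < n + 1 := by
        have := Nat.lt_floor_add_one (κ a univ).toReal
        have ha' : ⌊(κ a univ).toReal⌋₊ = n := ha
        rwa [ha'] at this
      rw [← ENNReal.ofReal_toReal (h a).ne]
      refine (ENNReal.ofReal_le_ofReal h1.le).trans_eq ?_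
      rw [ENNReal.ofReal_add (by positivity) zero_le_one]
      simp
    · simp
  · ext a S hS
    rw [Kernel.sum_apply' _ _ hS, tsum_eq_single ⌊(κ a univ).toReal⌋₊]
    · rw [Kernel.piecewise_apply, if_pos]
      exact (rfl : ⌊(κ a univ).toReal⌋₊ = ⌊(κ a univ).toReal⌋₊)
    · intro n hn
      rw [Kernel.piecewise_apply, if_neg]
      · simp
      · exact fun h' : ⌊(κ a univ).toReal⌋₊ = n => hn h'.symm

/-! ### Measures whose nonzero values are at least one -/

/-- Every measurable set has measure `0` or at least `1`. -/
def ZeroOrGeOne {X : Type*} [MeasurableSpace X] (m : Measure X) : Prop :=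
  ∀ S, MeasurableSet S → m S = 0 ∨ 1 ≤ m S

/-- For such a measure, `ℓ^q ⊆ ℓ^1` quantitatively, for `0 < q ≤ 1`. -/
lemma ZeroOrGeOne.lintegral_rpow_le {X : Type*} [MeasurableSpace X] {m : Measure X}
    (h : ZeroOrGeOne m) {q : ℝ} (hq0 : 0 < q) (hq1 : q ≤ 1) {φ : X → ℝ≥0∞} (hφ : Measurable φ) :
    (∫⁻ z, φ z ∂m) ^ q ≤ ∫⁻ z, φ z ^ q ∂m := by
  set I := ∫⁻ z, φ z ^ q ∂m with hI
  rcases eq_or_ne I ∞ with hIt | hIt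
  · rw [hIt]; exact le_top
  have hφq : Measurable fun z => φ z ^ q := hφ.pow_const q
  -- If φ^q exceeded I on a non-null set, that set would have mass at least 1 and alone contribute
  -- more than I.
  have hbd : ∀ᵐ z ∂m, φ z ^ q ≤ I := by
    have hS : MeasurableSet {z | I < φ z ^ q} := measurableSet_lt measurable_const hφq
    rcases h _ hS with h0 | h1
    · rw [ae_iff]
      simpa only [not_le] using h0
    · exfalso
      have hlt : ∫⁻ z in {z | I < φ z ^ q}, I ∂m < ∫⁻ z in {z | I < φ z ^ q}, φ z ^ q ∂m := by
        refine setLIntegral_strict_mono hS ?_ hφq ?_ (ae_of_all _ fun z hz => hz)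
        · intro h0
          rw [h0] at h1
          simp at h1
        · have hle : ∫⁻ z in {z | I < φ z ^ q}, I ∂m ≤ I :=
            (setLIntegral_mono' hS fun z hz => (le_of_lt hz)).trans (setLIntegral_le_lintegral _ _)
          exact ne_top_of_le_ne_top hIt hle
      have h2 : I ≤ ∫⁻ z in {z | I < φ z ^ q}, I ∂m := by
        rw [setLIntegral_const]
        calc I = I * 1 := (mul_one I).symm
          _ ≤ _ := by gcongr
      exact absurd (h2.trans_lt hlt) (not_lt.2 (setLIntegral_le_lintegral _ _))
  -- Write φ = (φ^q)^{(1-q)/q} φ^q and bound the first factor by the essential bound `hbd`.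
  have hle : ∫⁻ z, φ z ∂m ≤ I ^ ((1 - q) / q) * I := by
    rw [hI, ← lintegral_const_mul _ hφq]
    refine lintegral_mono_ae ?_
    filter_upwards [hbd] with z hz
    have h1 : φ z = (φ z ^ q) ^ ((1 - q) / q) * φ z ^ q := by
      rw [← ENNReal.rpow_mul, ← ENNReal.rpow_add_of_nonneg _ _ (by
        have : 0 ≤ 1 - q := by linarith
        positivity) hq0.le]
      have : q * ((1 - q) / q) + q = 1 := by field_simp; ring
      rw [this, ENNReal.rpow_one]
    calc φ z = (φ z ^ q) ^ ((1 - q) / q) * φ z ^ q := h1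
      _ ≤ _ := by
        gcongr
  calc (∫⁻ z, φ z ∂m) ^ q ≤ (I ^ ((1 - q) / q) * I) ^ q := by gcongr
    _ = (I ^ (1 / q)) ^ q := by
        congr 1
        nth_rw 2 [← ENNReal.rpow_one I]
        rw [← ENNReal.rpow_add_of_nonneg _ _ (div_nonneg (by linarith) hq0.le) zero_le_one]
        congr 1
        field_simp
        ring
    _ = I := by rw [← ENNReal.rpow_mul]; field_simp; simp

/-- A finite measure with values in `ℕ` on a generating `π`-system takes values in `ℕ`. -/
lemma exists_nat_of_piSystem {X : Type*} [mX : MeasurableSpace X] {m : Measure X}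
    [IsFiniteMeasure m] {C : Set (Set X)} (hgen : mX = MeasurableSpace.generateFrom C)
    (hpi : IsPiSystem C) (huniv : ∃ n : ℕ, m univ = n) (hC : ∀ A ∈ C, ∃ n : ℕ, m A = n)
    {S : Set X} (hS : MeasurableSet S) : ∃ n : ℕ, m S = n := by
  induction S, hS using MeasurableSpace.induction_on_inter hgen hpi with
  | empty => exact ⟨0, by simp⟩
  | basic A hA => exact hC A hA
  | compl A hA ih =>
    obtain ⟨n, hn⟩ := ih
    obtain ⟨k, hk⟩ := huniv
    exact ⟨k - n, by rw [measure_compl hA (measure_ne_top m A), hn, hk]; norm_cast⟩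
  | iUnion f hd hf ih =>
    choose n hn using ih
    have hsum : ∑' i, (n i : ℝ≥0∞) ≠ ∞ := by
      simp_rw [← hn]
      rw [← measure_iUnion hd hf]
      exact measure_ne_top m _
    have hz : ∀ᶠ i in cofinite, n i = 0 := by
      have := ENNReal.tendsto_cofinite_zero_of_tsum_ne_top hsum
      filter_upwards [this.eventually_lt_const one_pos] with i hi
      have : n i < 1 := by exact_mod_cast hi
      omega
    have hfin : {i | n i ≠ 0}.Finite := hz
    refine ⟨∑ i ∈ hfin.toFinset, n i, ?_⟩
    rw [measure_iUnion hd hf]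
    simp_rw [hn]
    rw [tsum_eq_sum (s := hfin.toFinset) fun i hi => by simpa using hi]
    push_cast
    rfl

/-! ### Poisson random measures -/

lemma lintegral_cast_poissonMeasure (r : ℝ≥0) :
    ∫⁻ n : ℕ, (n : ℝ≥0∞) ∂(poissonMeasure r) = r := by
  rw [lintegral_countable']
  simp_rw [poissonMeasure_singleton]
  rw [tsum_eq_zero_add' ENNReal.summable]
  have h : ∀ n : ℕ, ((n + 1 : ℕ) : ℝ≥0∞)
      * ENNReal.ofReal (Real.exp (-r) * r ^ (n + 1) / ((n + 1).factorial : ℕ))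
      = r * ENNReal.ofReal (Real.exp (-r) * r ^ n / (n.factorial : ℕ)) := by
    intro n
    rw [← ENNReal.ofReal_natCast, ← ENNReal.ofReal_mul (by positivity), ← ENNReal.ofReal_coe_nnreal,
      ← ENNReal.ofReal_mul (by positivity)]
    congr 1
    rw [Nat.factorial_succ]
    push_cast
    field_simp
    ring
  simp_rw [h]
  rw [ENNReal.tsum_mul_left, ← ENNReal.ofReal_tsum_of_nonneg (fun n => by positivity)
    (hasSum_one_poissonMeasure r).summable, (hasSum_one_poissonMeasure r).tsum_eq]
  simp

namespace IsPoissonRandomMeasure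

variable {X Ω : Type*} [mX : MeasurableSpace X] [MeasurableSpace Ω] {Y : Ω → Measure X}
  {μ : Measure X} {P : Measure Ω}

lemma measurable_apply (hY : IsPoissonRandomMeasure Y μ P) {A : Set X} (hA : MeasurableSet A) :
    Measurable fun ω => Y ω A := (Measure.measurable_coe hA).comp hY.measurable

lemma ae_exists_nat (hY : IsPoissonRandomMeasure Y μ P) {A : Set X} (hA : MeasurableSet A)
    (hμ : μ A ≠ ∞) : ∀ᵐ ω ∂P, ∃ n : ℕ, Y ω A = n := by
  have hr : MeasurableSet (range (Nat.cast : ℕ → ℝ≥0∞)) := (countable_range _).measurableSet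
  have h1 : ∀ᵐ x ∂(P.map fun ω => Y ω A), x ∈ range (Nat.cast : ℕ → ℝ≥0∞) := by
    rw [hY.law A hA hμ]
    exact (ae_map_iff (p := fun x => x ∈ range (Nat.cast : ℕ → ℝ≥0∞))
      measurable_from_top.aemeasurable hr).2 (ae_of_all _ fun n => ⟨n, rfl⟩)
  filter_upwards [ae_of_ae_map (hY.measurable_apply hA).aemeasurable h1] with ω hω
  obtain ⟨n, hn⟩ := hω
  exact ⟨n, hn.symm⟩

/-- The probability is e^{-μ(A)}. Thinning rests on this being positive for sets of finite
intensity. -/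
lemma measure_apply_eq_zero_pos (hY : IsPoissonRandomMeasure Y μ P) {A : Set X}
    (hA : MeasurableSet A) (hμ : μ A ≠ ∞) : P {ω | Y ω A = 0} ≠ 0 := by
  have h1 : P {ω | Y ω A = 0} = (P.map fun ω => Y ω A) {0} := by
    rw [Measure.map_apply (hY.measurable_apply hA) (measurableSet_singleton _)]
    rfl
  rw [h1, hY.law A hA hμ, Measure.map_apply (by fun_prop) (measurableSet_singleton _)]
  have h2 : (fun n : ℕ => (n : ℝ≥0∞)) ⁻¹' {0} = {0} := by ext n; simp
  rw [h2, poissonMeasure_singleton]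
  rw [Ne, ENNReal.ofReal_eq_zero, not_le]
  simp [Real.exp_pos]

lemma lintegral_apply_of_ne_top (hY : IsPoissonRandomMeasure Y μ P) {A : Set X}
    (hA : MeasurableSet A) (hμ : μ A ≠ ∞) : ∫⁻ ω, Y ω A ∂P = μ A := by
  have h1 : ∫⁻ ω, Y ω A ∂P = ∫⁻ x, x ∂(P.map fun ω => Y ω A) :=
    (lintegral_map measurable_id (hY.measurable_apply hA)).symm
  rw [h1, hY.law A hA hμ, lintegral_map (by fun_prop) (by fun_prop), lintegral_cast_poissonMeasure,
    ENNReal.coe_toNNReal hμ]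

variable [SigmaFinite μ]

lemma lintegral_apply (hY : IsPoissonRandomMeasure Y μ P) {A : Set X} (hA : MeasurableSet A) :
    ∫⁻ ω, Y ω A ∂P = μ A := by
  have hS := measurableSet_spanningSets μ
  have h1 : ∀ m : Measure X, m A = ⨆ k, m (A ∩ spanningSets μ k) := fun m => by
    rw [← Monotone.measure_iUnion, ← inter_iUnion, iUnion_spanningSets, inter_univ]
    exact fun i j hij => inter_subset_inter_right _ (monotone_spanningSets μ hij)
  have h2 : ∀ ω, Y ω A = ⨆ k, Y ω (A ∩ spanningSets μ k) := fun ω => h1 (Y ω)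
  simp_rw [h2]
  rw [lintegral_iSup (fun k => hY.measurable_apply (hA.inter (hS k))), h1 μ]
  · congr 1 with k
    exact hY.lintegral_apply_of_ne_top (hA.inter (hS k))
      (ne_top_of_le_ne_top (measure_spanningSets_lt_top μ k).ne (measure_mono inter_subset_right))
  · exact fun i j hij ω => measure_mono (inter_subset_inter_right _ (monotone_spanningSets μ hij))

/-- The mean of a linear functional of a Poisson random measure. -/
lemma lintegral_lintegral (hY : IsPoissonRandomMeasure Y μ P) {φ : X → ℝ≥0∞}
    (hφ : Measurable φ) : ∫⁻ ω, ∫⁻ z, φ z ∂(Y ω) ∂P = ∫⁻ z, φ z ∂μ := by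
  have h : P.bind Y = μ := by
    ext A hA
    rw [Measure.bind_apply hA hY.measurable.aemeasurable, hY.lintegral_apply hA]
  rw [← h, Measure.lintegral_bind hY.measurable.aemeasurable hφ.aemeasurable]

lemma ae_lintegral_lt_top (hY : IsPoissonRandomMeasure Y μ P) {φ : X → ℝ≥0∞}
    (hφ : Measurable φ) (h : ∫⁻ z, φ z ∂μ ≠ ∞) : ∀ᵐ ω ∂P, ∫⁻ z, φ z ∂(Y ω) < ∞ := by
  refine ae_lt_top ?_ (by rwa [hY.lintegral_lintegral hφ])
  exact (Measure.measurable_lintegral hφ).comp hY.measurable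

lemma ae_apply_eq_zero (hY : IsPoissonRandomMeasure Y μ P) {A : Set X} (hA : MeasurableSet A)
    (h : μ A = 0) : ∀ᵐ ω ∂P, Y ω A = 0 := by
  have := hY.lintegral_apply hA
  rw [h, lintegral_eq_zero_iff (hY.measurable_apply hA)] at this
  exact this

lemma ae_apply_lt_top (hY : IsPoissonRandomMeasure Y μ P) {A : Set X} (hA : MeasurableSet A)
    (h : μ A ≠ ∞) : ∀ᵐ ω ∂P, Y ω A < ∞ :=
  ae_lt_top (hY.measurable_apply hA) (by rwa [hY.lintegral_apply hA])

/-- Counts are integers almost surely on a countable algebra generating the σ-algebra, cut by the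
spanning sets. Off this single null set `exists_nat_of_piSystem` extends integrality to all
measurable sets. -/
lemma ae_zeroOrGeOne [MeasurableSpace.CountablyGenerated X]
    (hY : IsPoissonRandomMeasure Y μ P) : ∀ᵐ ω ∂P, ZeroOrGeOne (Y ω) := by
  set C := generateSetAlgebra (MeasurableSpace.countableGeneratingSet X) with hC
  have hCc : C.Countable :=
    countable_generateSetAlgebra MeasurableSpace.countable_countableGeneratingSet
  have hCgen : mX = MeasurableSpace.generateFrom C := by
    rw [hC, generateFrom_generateSetAlgebra_eq, MeasurableSpace.generateFrom_countableGeneratingSet]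
  have hCm : ∀ A ∈ C, MeasurableSet A := fun A hA => by
    rw [hCgen]; exact MeasurableSpace.measurableSet_generateFrom hA
  have hS := measurableSet_spanningSets μ
  have hfin : ∀ A k, μ (A ∩ spanningSets μ k) ≠ ∞ := fun A k =>
    ne_top_of_le_ne_top (measure_spanningSets_lt_top μ k).ne (measure_mono inter_subset_right)
  have h1 : ∀ᵐ ω ∂P, ∀ k, ∃ n : ℕ, Y ω (univ ∩ spanningSets μ k) = n :=
    ae_all_iff.2 fun k => hY.ae_exists_nat (MeasurableSet.univ.inter (hS k)) (hfin _ _)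
  have h2 : ∀ᵐ ω ∂P, ∀ k, ∀ A ∈ C, ∃ n : ℕ, Y ω (A ∩ spanningSets μ k) = n :=
    ae_all_iff.2 fun k => (ae_ball_iff hCc).2 fun A hA =>
      hY.ae_exists_nat ((hCm A hA).inter (hS k)) (hfin _ _)
  filter_upwards [h1, h2] with ω h1 h2 S hSm
  rw [or_iff_not_imp_left]
  intro hne
  have : ∃ k, Y ω (S ∩ spanningSets μ k) ≠ 0 := by
    by_contra! hall
    refine hne ?_
    have : S = ⋃ k, S ∩ spanningSets μ k := by
      rw [← inter_iUnion, iUnion_spanningSets, inter_univ]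
    rw [this]
    exact measure_iUnion_null hall
  obtain ⟨k, hk⟩ := this
  have : IsFiniteMeasure ((Y ω).restrict (spanningSets μ k)) := ⟨by
    rw [Measure.restrict_apply MeasurableSet.univ]
    obtain ⟨n, hn⟩ := h1 k
    rw [hn]; simp⟩
  obtain ⟨n, hn⟩ := exists_nat_of_piSystem (m := (Y ω).restrict (spanningSets μ k)) hCgen
    (isSetAlgebra_generateSetAlgebra.isSetRing.isSetSemiring.isPiSystem)
    (by rw [Measure.restrict_apply MeasurableSet.univ]; exact h1 k)
    (fun A hA => by rw [Measure.restrict_apply (hCm A hA)]; exact h2 k A hA) hSm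
  rw [Measure.restrict_apply hSm] at hn
  rw [hn] at hk
  have h3 : 1 ≤ n := Nat.one_le_iff_ne_zero.2 (by exact_mod_cast hk)
  calc (1 : ℝ≥0∞) ≤ n := by exact_mod_cast h3
    _ = Y ω (S ∩ spanningSets μ k) := hn.symm
    _ ≤ Y ω S := measure_mono inter_subset_left

/-- Almost surely, `Y` agrees with an s-finite kernel. -/
lemma exists_sfinite_kernel (hY : IsPoissonRandomMeasure Y μ P) :
    ∃ κ : Kernel Ω X, IsSFiniteKernel κ ∧ ∀ᵐ ω ∂P, κ ω = Y ω := by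
  classical
  set B : ℕ → Set X := disjointed (spanningSets μ) with hB
  have hBm : ∀ k, MeasurableSet (B k) := fun k =>
    MeasurableSet.disjointed (measurableSet_spanningSets μ) k
  have hBfin : ∀ k, μ (B k) ≠ ∞ := fun k =>
    ne_top_of_le_ne_top (measure_spanningSets_lt_top μ k).ne
      (measure_mono (disjointed_subset _ k))
  let Yk : Kernel Ω X := ⟨Y, hY.measurable⟩
  let good : ℕ → Set Ω := fun k => {ω | Y ω (B k) < ∞}
  have hgood : ∀ k, MeasurableSet (good k) := fun k =>
    measurableSet_lt (hY.measurable_apply (hBm k)) measurable_const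
  let κ : ℕ → Kernel Ω X := fun k => Kernel.piecewise (hgood k) (Yk.restrict (hBm k)) 0
  have hκ : ∀ k, IsSFiniteKernel (κ k) := fun k => by
    refine isSFiniteKernel_of_forall_lt_top _ fun ω => ?_
    rw [Kernel.piecewise_apply]
    split_ifs with h
    · rw [Kernel.restrict_apply, Measure.restrict_apply MeasurableSet.univ, univ_inter]
      exact h
    · simp
  refine ⟨Kernel.sum κ, inferInstance, ?_⟩
  filter_upwards [ae_all_iff.2 fun k => hY.ae_apply_lt_top (hBm k) (hBfin k)] with ω hω
  rw [Kernel.sum_apply]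
  have h1 : ∀ k, κ k ω = (Y ω).restrict (B k) := fun k => by
    simp only [κ]
    rw [Kernel.piecewise_apply, if_pos (show ω ∈ good k from hω k), Kernel.restrict_apply]
    rfl
  simp_rw [h1]
  rw [← Measure.restrict_iUnion (disjoint_disjointed _) hBm, iUnion_disjointed,
    iUnion_spanningSets, Measure.restrict_univ]

/-- The second moment measure agrees with the product of the means off the diagonal. -/
lemma ae_lintegral_prod_lt_top (hY : IsPoissonRandomMeasure Y μ P)
    {ι : Type*} [Countable ι] {U V : ι → Set X} (hU : ∀ i, MeasurableSet (U i))
    (hV : ∀ i, MeasurableSet (V i)) (hd : ∀ i, Disjoint (U i) (V i))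
    {Φ : X × X → ℝ≥0∞} (hΦ : Measurable Φ)
    (hfin : ∫⁻ w, Φ w ∂(μ.prod μ) ≠ ∞) :
    ∀ᵐ ω ∂P, ∫⁻ z, ∫⁻ z', (⋃ i, U i ×ˢ V i).indicator Φ (z, z') ∂(Y ω) ∂(Y ω) < ∞ := by
  obtain ⟨κ, hκ, hκY⟩ := hY.exists_sfinite_kernel
  set O := ⋃ i, U i ×ˢ V i with hO
  have hOm : MeasurableSet O := MeasurableSet.iUnion fun i => (hU i).prod (hV i)
  set ν : Measure (X × X) := P.bind (κ ×ₖ κ) with hν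
  -- On a rectangle U × V with U and V disjoint, independence factorizes the mean of the product
  -- measure. Countably many such rectangles cover O.
  have hνr : ν.restrict O = (μ.prod μ).restrict O := by
    rw [hO, Measure.restrict_iUnion_congr]
    intro i
    rw [← Measure.prod_restrict]
    symm
    refine Measure.prod_eq fun s t hs ht => ?_
    rw [Measure.restrict_apply (hs.prod ht), prod_inter_prod, hν,
      Measure.bind_apply ((hs.inter (hU i)).prod (ht.inter (hV i))) (κ ×ₖ κ).aemeasurable,
      Measure.restrict_apply hs, Measure.restrict_apply ht]
    have h1 : ∀ᵐ ω ∂P, (κ ×ₖ κ) ω ((s ∩ U i) ×ˢ (t ∩ V i)) = Y ω (s ∩ U i) * Y ω (t ∩ V i) := by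
      filter_upwards [hκY] with ω hω
      rw [Kernel.prod_apply, Measure.prod_prod, hω]
    rw [lintegral_congr_ae h1]
    have hind := hY.indep 2 ![s ∩ U i, t ∩ V i] (by
        intro j; fin_cases j
        · exact hs.inter (hU i)
        · exact ht.inter (hV i)) (by
        have hdis : Disjoint (s ∩ U i) (t ∩ V i) :=
          (hd i).mono inter_subset_right inter_subset_right
        intro j k hjk
        fin_cases j <;> fin_cases k
        · exact absurd rfl hjk
        · exact hdis
        · exact hdis.symm
        · exact absurd rfl hjk)
    have hind2 := hind.indepFun (i := 0) (j := 1) (by decide)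
    have := lintegral_mul_eq_lintegral_mul_lintegral_of_indepFun
      (hY.measurable_apply (hs.inter (hU i))) (hY.measurable_apply (ht.inter (hV i))) hind2
    rw [← hY.lintegral_apply (hs.inter (hU i)), ← hY.lintegral_apply (ht.inter (hV i))]
    exact this
  have h2 : ∫⁻ ω, ∫⁻ w, O.indicator Φ w ∂((κ ×ₖ κ) ω) ∂P ≠ ∞ := by
    rw [← Measure.lintegral_bind (κ ×ₖ κ).aemeasurable (hΦ.indicator hOm).aemeasurable, ← hν,
      lintegral_indicator hOm, hνr]
    exact ne_top_of_le_ne_top hfin (setLIntegral_le_lintegral _ _)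
  have h3 : Measurable fun ω => ∫⁻ w, O.indicator Φ w ∂((κ ×ₖ κ) ω) :=
    (Measure.measurable_lintegral (hΦ.indicator hOm)).comp (κ ×ₖ κ).measurable
  filter_upwards [ae_lt_top h3 h2, hκY] with ω hω hω'
  rw [Kernel.lintegral_prod _ _ _ (hΦ.indicator hOm), hω'] at hω
  exact hω

end IsPoissonRandomMeasure

/-! ### Thinning -/

namespace IsPoissonRandomMeasure

variable {X Ω : Type*} [mX : MeasurableSpace X] [MeasurableSpace Ω] {Y : Ω → Measure X}
  {μ : Measure X} {P : Measure Ω}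

/-- The counts on finitely many sets outside `R` are independent of the count of `R`. -/
lemma indepFun_finite (hY : IsPoissonRandomMeasure Y μ P) {R : Set X} (hR : MeasurableSet R)
    {ι : Type*} [Fintype ι] (A : ι → Set X) (hA : ∀ i, MeasurableSet (A i)) :
    IndepFun (fun ω => Y ω R) (fun ω (i : ι) => Y ω (A i ∩ Rᶜ)) P := by
  classical
  -- The sets A i may overlap while independence is assumed only for disjoint sets, so Rᶜ is split
  -- into the atoms of the algebra they generate; each count is a sum of cell counts.
  let cell : (ι → Bool) → Set X := fun b => Rᶜ ∩ ⋂ i, if b i then A i else (A i)ᶜ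
  have hcell : ∀ b, MeasurableSet (cell b) := fun b =>
    hR.compl.inter (MeasurableSet.iInter fun i => by
      split_ifs
      · exact hA i
      · exact (hA i).compl)
  have hdisj : Pairwise fun b b' => Disjoint (cell b) (cell b') := by
    intro b b' hbb
    obtain ⟨i, hi⟩ := Function.ne_iff.1 hbb
    rw [Set.disjoint_left]
    intro x hx hx'
    have h1 := mem_iInter.1 hx.2 i
    have h2 := mem_iInter.1 hx'.2 i
    cases hb : b i <;> cases hb' : b' i <;> simp_all
  let B : Option (ι → Bool) → Set X := fun o => o.elim R cell
  have hB : ∀ o, MeasurableSet (B o) := by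
    rintro (_ | b)
    · exact hR
    · exact hcell b
  have hBd : Pairwise fun o o' => Disjoint (B o) (B o') := by
    have hRc : ∀ b, Disjoint R (cell b) := fun b =>
      Set.disjoint_left.2 fun x hx hx' => hx'.1 hx
    rintro (_ | b) (_ | b') hne
    · exact absurd rfl hne
    · exact hRc b'
    · exact (hRc b).symm
    · exact hdisj fun h => hne (by rw [h])
  let e := Fintype.equivFin (Option (ι → Bool))
  have hind := hY.indep _ (fun j => B (e.symm j)) (fun j => hB _)
    (fun j k hjk => hBd fun h => hjk (e.symm.injective h))
  have hfs := hind.indepFun_finset {e none} (Finset.univ \ {e none}) Finset.disjoint_sdiff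
    (fun j => hY.measurable_apply (hB _))
  have hmem : ∀ b : ι → Bool, e (some b) ∈ Finset.univ \ {e none} := fun b => by simp
  have hφ : Measurable fun g : ({e none} : Finset _) → ℝ≥0∞ =>
      g ⟨e none, Finset.mem_singleton_self _⟩ := measurable_pi_apply _
  have hψ : Measurable fun (g : (Finset.univ \ {e none} : Finset _) → ℝ≥0∞) (i : ι) =>
      ∑ b : ι → Bool, if b i then g ⟨e (some b), hmem b⟩ else 0 := by
    refine measurable_pi_lambda _ fun i => Finset.measurable_sum _ fun b _ => ?_
    split_ifs
    · exact measurable_pi_apply _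
    · exact measurable_const
  have hcomp := hfs.comp hφ hψ
  convert! hcomp using 1
  · funext ω
    simp [B]
  · funext ω i
    have hun : A i ∩ Rᶜ = ⋃ b ∈ (Finset.univ.filter fun b : ι → Bool => b i = true), cell b := by
      ext x
      simp only [mem_iUnion, Finset.mem_filter, Finset.mem_univ, true_and, exists_prop]
      constructor
      · rintro ⟨hx, hxR⟩
        refine ⟨fun j => decide (x ∈ A j), by simpa using hx, hxR, mem_iInter.2 fun j => ?_⟩
        by_cases hj : x ∈ A j <;> simp [hj]
      · rintro ⟨b, hb, hx⟩
        have := mem_iInter.1 hx.2 i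
        rw [hb] at this
        exact ⟨by simpa using this, hx.1⟩
    rw [hun, measure_biUnion_finset (fun b _ b' _ h => hdisj h) (fun b _ => hcell b),
      Finset.sum_filter]
    simp [B]

/-- If `Y` almost surely has a (measurable) property, then so does `Y` with the points in a set of
finite intensity removed. -/
theorem ae_restrict_compl [IsProbabilityMeasure P] (hY : IsPoissonRandomMeasure Y μ P) {R : Set X}
    (hR : MeasurableSet R) (hμ : μ R ≠ ∞) {Q : Set (Measure X)} (hQ : MeasurableSet Q)
    (h : ∀ᵐ ω ∂P, Y ω ∈ Q) : ∀ᵐ ω ∂P, (Y ω).restrict Rᶜ ∈ Q := by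
  let T := {A : Set X // MeasurableSet A}
  -- The thinned measure is viewed as a process indexed by all measurable sets, for which
  -- independence of finite families suffices.
  have hproc : IndepFun (fun ω (_ : Unit) => Y ω R) (fun ω (A : T) => Y ω (A.1 ∩ Rᶜ)) P := by
    refine IndepFun.process_indepFun_process (fun _ => hY.measurable_apply hR)
      (fun A => hY.measurable_apply (A.2.inter hR.compl)) fun I J => ?_
    have h1 := hY.indepFun_finite hR (fun A : J => A.1.1) (fun A => A.1.2)
    exact h1.comp (φ := fun r (_ : I) => r) (ψ := id) (by fun_prop) measurable_id
  have hE1 : MeasurableSet[MeasurableSpace.comap (fun ω (_ : Unit) => Y ω R) inferInstance]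
      {ω | Y ω R = 0} :=
    ⟨{g | g () = 0}, (measurable_pi_apply ()) (measurableSet_singleton 0), rfl⟩
  have hE2 : MeasurableSet[MeasurableSpace.comap (fun ω (A : T) => Y ω (A.1 ∩ Rᶜ)) inferInstance]
      {ω | (Y ω).restrict Rᶜ ∈ Qᶜ} := by
    have hm : @Measurable Ω (Measure X)
        (MeasurableSpace.comap (fun ω (A : T) => Y ω (A.1 ∩ Rᶜ)) inferInstance) _
        (fun ω => (Y ω).restrict Rᶜ) := by
      refine @Measure.measurable_of_measurable_coe _ _ _
        (MeasurableSpace.comap (fun ω (A : T) => Y ω (A.1 ∩ Rᶜ)) inferInstance) _ fun A hA => ?_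
      have he : (fun ω => (Y ω).restrict Rᶜ A)
          = (fun g : T → ℝ≥0∞ => g ⟨A, hA⟩) ∘ (fun ω (A : T) => Y ω (A.1 ∩ Rᶜ)) := by
        funext ω
        simp [Measure.restrict_apply hA]
      rw [he]
      exact (measurable_pi_apply _).comp (comap_measurable _)
    exact hm hQ.compl
  have hprod := (IndepFun_iff _ _ _).1 hproc _ _ hE1 hE2
  -- Where R carries no point the thinned measure is Y itself, so failure of Q there is null. By
  -- independence this null event factorizes, and P(Y(R) = 0) > 0.
  have hnull : P ({ω | Y ω R = 0} ∩ {ω | (Y ω).restrict Rᶜ ∈ Qᶜ}) = 0 := by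
    refine measure_mono_null ?_ h
    rintro ω ⟨h0, hω⟩ hin
    refine hω ?_
    have : (Y ω).restrict Rᶜ = Y ω := by
      rw [Measure.restrict_eq_self_of_ae_mem]
      exact measure_eq_zero_iff_ae_notMem.1 h0
    rwa [this]
  rw [hnull] at hprod
  rcases mul_eq_zero.1 hprod.symm with h0 | h0
  · exact absurd h0 (hY.measure_apply_eq_zero_pos hR hμ)
  · exact h0

end IsPoissonRandomMeasure

/-! ### The stable intensity -/

/-- The Lévy measure `c y^{-(p+1)} dy` on `(0, ∞)`. -/
def levyMeasure (p c : ℝ) : Measure ℝ :=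
  ((volume : Measure ℝ).restrict (Ioi 0)).withDensity (fun y => ENNReal.ofReal (c * y ^ (-(p + 1))))

instance (p c : ℝ) : SigmaFinite (levyMeasure p c) := by
  unfold levyMeasure
  exact SigmaFinite.withDensity fun y => (c * y ^ (-(p + 1))).toNNReal

lemma stableIntensity_eq {d : ℕ} (D : Set (Sp d)) (p c : ℝ) :
    stableIntensity D p c = ((volume : Measure (Sp d)).restrict D).prod (levyMeasure p c) := rfl

instance {d : ℕ} (D : Set (Sp d)) (p c : ℝ) : SigmaFinite (stableIntensity D p c) := by
  rw [stableIntensity_eq]; infer_instance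

lemma levyMeasure_Iic_zero (p c : ℝ) : levyMeasure p c (Iic 0) = 0 := by
  unfold levyMeasure
  rw [withDensity_apply _ measurableSet_Iic, Measure.restrict_restrict measurableSet_Iic,
    show Iic (0 : ℝ) ∩ Ioi 0 = ∅ by ext y; simp]
  simp

lemma levyMeasure_Ioi_ne_top {p c r : ℝ} (hp : 0 < p) (hr : 0 < r) :
    levyMeasure p c (Ioi r) ≠ ∞ := by
  unfold levyMeasure
  rw [withDensity_apply _ measurableSet_Ioi, Measure.restrict_restrict measurableSet_Ioi,
    inter_eq_left.2 (Ioi_subset_Ioi hr.le)]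
  have h : IntegrableOn (fun y : ℝ => c * y ^ (-(p + 1))) (Ioi r) :=
    (integrableOn_Ioi_rpow_of_lt (by linarith) hr).const_mul c
  exact h.lintegral_lt_top.ne

/-- With the density inserted, the integrand is c y^{q-p-1}, integrable at 0 because q > p. -/
lemma lintegral_levyMeasure_rpow_ne_top {p c q R : ℝ} (hc : 0 < c) (hq : p < q) (hR : 0 < R) :
    ∫⁻ y in Iic R, ENNReal.ofReal y ^ q ∂(levyMeasure p c) ≠ ∞ := by
  unfold levyMeasure
  rw [restrict_withDensity measurableSet_Iic, Measure.restrict_restrict measurableSet_Iic,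
    lintegral_withDensity_eq_lintegral_mul₀ (by fun_prop) (by fun_prop)]
  have h1 : Iic R ∩ Ioi 0 = Ioc 0 R := by ext y; simp [and_comm]
  rw [h1]
  have h2 : IntegrableOn (fun y : ℝ => c * y ^ (q - p - 1)) (Ioc 0 R) := by
    refine Integrable.const_mul ?_ c
    have := intervalIntegral.intervalIntegrable_rpow' (a := 0) (b := R) (r := q - p - 1)
      (by linarith)
    exact (intervalIntegrable_iff_integrableOn_Ioc_of_le hR.le).1 this
  refine ne_of_lt (lt_of_le_of_lt ?_ h2.lintegral_lt_top)
  refine setLIntegral_mono' measurableSet_Ioc fun y hy => ?_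
  rw [Pi.mul_apply, ENNReal.ofReal_rpow_of_pos hy.1, ← ENNReal.ofReal_mul (by
    have := hy.1; positivity)]
  refine ENNReal.ofReal_le_ofReal (le_of_eq ?_)
  rw [mul_assoc, ← Real.rpow_add hy.1]
  congr 2
  ring

/-- In polar coordinates the integrand is r^{d-1-s}. A ball about x whose radius exceeds the
diameter contains D, and its translate to the origin does not depend on x. -/
lemma setLIntegral_norm_rpow_le {d : ℕ} (hd : 1 ≤ d) {D : Set (Sp d)}
    (hDb : Bornology.IsBounded D) {s : ℝ} (hs : s < d) :
    ∃ K : ℝ≥0∞, K ≠ ∞ ∧ ∀ x ∈ D, ∫⁻ y in D, ‖x - y‖ₑ ^ (-s) ≤ K := by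
  have : NeZero d := ⟨by omega⟩
  have : Nontrivial (Sp d) := by
    have : Nonempty (Fin d) := ⟨0⟩
    infer_instance
  obtain ⟨ρ, hρ⟩ := Metric.isBounded_iff.1 hDb
  set r := max ρ 0 + 1 with hr
  have hr0 : 0 < r := by positivity
  have hInt : IntegrableOn (fun x : Sp d => ‖x‖ ^ (-s)) (Metric.ball 0 r) := by
    rw [integrableOn_fun_norm_addHaar volume (f := fun y : ℝ => y ^ (-s))]
    have h1 : IntegrableOn (fun y : ℝ => y ^ ((d : ℝ) - 1 - s)) (Ioo 0 r) :=
      (intervalIntegral.integrableOn_Ioo_rpow_iff hr0).2 (by linarith)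
    refine h1.congr_fun (fun y hy => ?_) measurableSet_Ioo
    simp only [finrank_euclideanSpace, Fintype.card_fin, smul_eq_mul]
    rw [← Real.rpow_natCast, ← Real.rpow_add hy.1, Nat.cast_sub hd]
    congr 1
    push_cast
    ring
  have hInt' : ∫⁻ z in Metric.ball (0 : Sp d) r, ‖z‖ₑ ^ (-s) ≠ ∞ := by
    refine ne_of_lt (lt_of_eq_of_lt ?_ hInt.lintegral_lt_top)
    refine lintegral_congr_ae (ae_restrict_of_ae ?_)
    have h0 : ∀ᵐ z : Sp d, z ≠ 0 := by
      rw [ae_iff]; simp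
    filter_upwards [h0] with z hz
    rw [← ofReal_norm, ENNReal.ofReal_rpow_of_pos (norm_pos_iff.2 hz)]
  refine ⟨_, hInt', fun x hx => ?_⟩
  calc ∫⁻ y in D, ‖x - y‖ₑ ^ (-s)
      ≤ ∫⁻ y in Metric.ball x r, ‖x - y‖ₑ ^ (-s) := by
        refine lintegral_mono_set fun y hy => ?_
        rw [Metric.mem_ball]
        have := hρ hy hx
        have h2 := le_max_left ρ 0
        linarith
    _ = ∫⁻ y, (Metric.ball (0 : Sp d) r).indicator (fun z => ‖z‖ₑ ^ (-s)) (x - y) := by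
        rw [← lintegral_indicator measurableSet_ball]
        congr 1 with y
        simp only [indicator, Metric.mem_ball, dist_comm y x, dist_eq_norm, sub_zero]
    _ = ∫⁻ z, (Metric.ball (0 : Sp d) r).indicator (fun z => ‖z‖ₑ ^ (-s)) z :=
        lintegral_sub_left_eq_self _ x
    _ = _ := lintegral_indicator measurableSet_ball _

/-- The exponents: `β` is admissible for the resolvent kernel, and `‖x‖^{-4βq}` is integrable. -/
lemma exists_exponents {d : ℕ} (hd : 1 ≤ d) {p : ℝ} (hp0 : 0 < p) (hp1 : p < 1)
    (hdp : d ≤ 4 ∨ (5 ≤ d ∧ p < 1 / 2 + 1 / ((d : ℝ) - 2))) :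
    ∃ β q : ℝ, 0 < β ∧ (d : ℝ) / 2 - 1 < β ∧ p < q ∧ q ≤ 1 ∧ 4 * β * q < d := by
  have hd0 : (0 : ℝ) < d := by exact_mod_cast hd
  -- The last condition is d/(4r) > d/2 - 1 without denominators. For d ≥ 5 it reads r < d/(2d-4) =
  -- 1/2 + 1/(d-2).
  obtain ⟨r, hpr, hr1, hrd⟩ : ∃ r, p < r ∧ r < 1 ∧ (2 * d - 4) * r < d := by
    rcases hdp with h | ⟨h5, h⟩
    · have h4 : (d : ℝ) ≤ 4 := by exact_mod_cast h
      refine ⟨(p + 1) / 2, by linarith, by linarith, ?_⟩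
      nlinarith
    · have h5' : (5 : ℝ) ≤ d := by exact_mod_cast h5
      obtain ⟨r, h1, h2⟩ := exists_between (lt_min hp1 h)
      refine ⟨r, h1, h2.trans_le (min_le_left _ _), ?_⟩
      have h3 := h2.trans_le (min_le_right _ _)
      have h6 : (0 : ℝ) < d - 2 := by linarith
      have h7 : (1 / 2 + 1 / ((d : ℝ) - 2)) * (2 * d - 4) = d := by field_simp; ring
      nlinarith
  have hr0 : 0 < r := hp0.trans hpr
  -- With β = d/(4r) one gets 4βq = dq/r, and q is taken halfway between p and r.
  refine ⟨d / (4 * r), (p + r) / 2, by positivity, ?_, by linarith, by linarith, ?_⟩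
  · rw [lt_div_iff₀ (by positivity)]
    linarith
  · rw [show 4 * ((d : ℝ) / (4 * r)) * ((p + r) / 2) = d * ((p + r) / (2 * r)) by field_simp]
    have : (p + r) / (2 * r) < 1 := by rw [div_lt_one (by positivity)]; linarith
    nlinarith

/-! ### Almost sure properties of the noise -/

lemma lintegral_noise {d : ℕ} {Ω : Type*} {Y : Ω → Measure (Sp d × ℝ)} {ω : Ω}
    {φ : Sp d → ℝ≥0∞} (hφ : Measurable φ) :
    ∫⁻ x, φ x ∂(noise Y ω) = ∫⁻ z, ENNReal.ofReal z.2 * φ z.1 ∂(Y ω) := by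
  unfold noise
  rw [lintegral_map hφ measurable_fst, lintegral_withDensity_eq_lintegral_mul _ (by fun_prop)
    (by fun_prop)]
  rfl

section Noise

variable {d : ℕ} {D : Set (Sp d)} {p c : ℝ} {Ω : Type*} [MeasurableSpace Ω] {P : Measure Ω}
  {Y : Ω → Measure (Sp d × ℝ)}

lemma stableIntensity_Ioi_ne_top (hDb : Bornology.IsBounded D) (hp : 0 < p) {r : ℝ}
    (hr : 0 < r) : stableIntensity D p c (univ ×ˢ Ioi r) ≠ ∞ := by
  rw [stableIntensity_eq, Measure.prod_prod, Measure.restrict_apply_univ]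
  exact ENNReal.mul_ne_top hDb.measure_lt_top.ne (levyMeasure_Ioi_ne_top hp hr)

lemma ae_apply_compl_eq_zero (hDo : IsOpen D)
    (hY : IsPoissonRandomMeasure Y (stableIntensity D p c) P) :
    ∀ᵐ ω ∂P, Y ω (Dᶜ ×ˢ univ) = 0 := by
  refine hY.ae_apply_eq_zero (hDo.measurableSet.compl.prod MeasurableSet.univ) ?_
  rw [stableIntensity_eq, Measure.prod_prod, Measure.restrict_apply hDo.measurableSet.compl]
  simp

lemma ae_apply_Iic_eq_zero (hY : IsPoissonRandomMeasure Y (stableIntensity D p c) P) :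
    ∀ᵐ ω ∂P, Y ω (univ ×ˢ Iic 0) = 0 := by
  refine hY.ae_apply_eq_zero (MeasurableSet.univ.prod measurableSet_Iic) ?_
  rw [stableIntensity_eq, Measure.prod_prod, levyMeasure_Iic_zero, mul_zero]

lemma ae_noise_compl_eq_zero (hDo : IsOpen D)
    (hY : IsPoissonRandomMeasure Y (stableIntensity D p c) P) :
    ∀ᵐ ω ∂P, noise Y ω Dᶜ = 0 := by
  filter_upwards [ae_apply_compl_eq_zero hDo hY] with ω hω
  unfold noise
  rw [Measure.map_apply measurable_fst hDo.measurableSet.compl]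
  refine withDensity_absolutelyContinuous _ _ ?_
  rwa [← Set.prod_univ]

lemma ae_noise_singleton_eq_zero (hd : 1 ≤ d)
    (hY : IsPoissonRandomMeasure Y (stableIntensity D p c) P) (x : Sp d) :
    ∀ᵐ ω ∂P, noise Y ω {x} = 0 := by
  have : NeZero d := ⟨by omega⟩
  have : Nontrivial (Sp d) := by
    have : Nonempty (Fin d) := ⟨0⟩
    infer_instance
  have h0 : stableIntensity D p c ({x} ×ˢ univ) = 0 := by
    rw [stableIntensity_eq, Measure.prod_prod]
    simp
  filter_upwards [hY.ae_apply_eq_zero ((measurableSet_singleton x).prod MeasurableSet.univ) h0]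
    with ω hω
  unfold noise
  rw [Measure.map_apply measurable_fst (measurableSet_singleton x)]
  refine withDensity_absolutelyContinuous _ _ ?_
  rwa [← Set.prod_univ]

/-- The jumps are almost surely bounded. -/
lemma ae_exists_bound (hDb : Bornology.IsBounded D) (hp : 0 < p)
    (hY : IsPoissonRandomMeasure Y (stableIntensity D p c) P) :
    ∀ᵐ ω ∂P, ∃ R : ℕ, 0 < R ∧ Y ω (univ ×ˢ Ioi (R : ℝ)) = 0 := by
  have hm : ∀ r : ℝ, MeasurableSet (univ ×ˢ Ioi r : Set (Sp d × ℝ)) := fun r =>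
    MeasurableSet.univ.prod measurableSet_Ioi
  filter_upwards [hY.ae_zeroOrGeOne,
    hY.ae_apply_lt_top (hm 1) (stableIntensity_Ioi_ne_top hDb hp one_pos)] with ω h1 h2
  have hlim : Tendsto (fun n : ℕ => Y ω (univ ×ˢ Ioi ((n + 1 : ℕ) : ℝ))) atTop (𝓝 0) := by
    have h3 := tendsto_measure_iInter_atTop (μ := Y ω)
      (s := fun n : ℕ => (univ ×ˢ Ioi ((n + 1 : ℕ) : ℝ) : Set (Sp d × ℝ)))
      (fun n => (hm _).nullMeasurableSet)
      (fun i j hij => prod_mono subset_rfl (Ioi_subset_Ioi (by exact_mod_cast by omega)))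
      ⟨0, by simpa using h2.ne⟩
    have h4 : ⋂ n : ℕ, (univ ×ˢ Ioi ((n + 1 : ℕ) : ℝ) : Set (Sp d × ℝ)) = ∅ := by
      refine eq_empty_of_forall_notMem fun z hz => ?_
      obtain ⟨n, hn⟩ := exists_nat_gt z.2
      have := (mem_iInter.1 hz n).2
      simp only [mem_Ioi] at this
      push_cast at this
      linarith
    rwa [h4, measure_empty] at h3
  obtain ⟨n, hn⟩ := (hlim.eventually_lt_const one_pos).exists
  exact ⟨n + 1, by omega, (h1 _ (hm _)).resolve_right (not_le.2 hn)⟩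

lemma restrict_eq_self_of_bound {m : Measure (Sp d × ℝ)} {R : ℝ}
    (h : m (univ ×ˢ Ioi R) = 0) : m.restrict (univ ×ˢ Iic R) = m := by
  refine Measure.restrict_eq_self_of_ae_mem ?_
  rw [ae_iff]
  convert! h using 2
  ext z
  simp

/-- Integrals with respect to the noise are almost surely finite as soon as the `q`-th power is
integrable, for some `p < q ≤ 1`. -/
lemma ae_lintegral_noise_lt_top (hDb : Bornology.IsBounded D) (hp : 0 < p) (hc : 0 < c)
    (hY : IsPoissonRandomMeasure Y (stableIntensity D p c) P) {q : ℝ} (hpq : p < q) (hq1 : q ≤ 1)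
    {φ : Sp d → ℝ≥0∞} (hφ : Measurable φ) (hfin : ∫⁻ x in D, φ x ^ q ≠ ∞) :
    ∀ᵐ ω ∂P, ∫⁻ x, φ x ∂(noise Y ω) < ∞ := by
  have hq0 : 0 < q := hp.trans hpq
  have hS : ∀ R : ℝ, MeasurableSet (univ ×ˢ Iic R : Set (Sp d × ℝ)) := fun R =>
    MeasurableSet.univ.prod measurableSet_Iic
  have hm : Measurable fun z : Sp d × ℝ => ENNReal.ofReal z.2 * φ z.1 := by fun_prop
  -- Since q > p, the power y^q is not integrable at infinity for the Lévy measure. The jumps are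
  -- truncated at every integer R, and some R exceeds all jumps of the given realisation.
  have h1 : ∀ᵐ ω ∂P, ∀ R : ℕ, 0 < R →
      ∫⁻ z, (univ ×ˢ Iic (R : ℝ)).indicator (fun z => (ENNReal.ofReal z.2 * φ z.1) ^ q) z ∂(Y ω)
        < ∞ := by
    refine ae_all_iff.2 fun R => ?_
    rcases Nat.eq_zero_or_pos R with rfl | hR
    · simp
    have hR' : (0 : ℝ) < R := by exact_mod_cast hR
    refine (hY.ae_lintegral_lt_top ((hm.pow_const q).indicator (hS R)) ?_).mono fun ω h _ => h
    rw [lintegral_indicator (hS R), stableIntensity_eq, ← Measure.prod_restrict,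
      lintegral_prod _ (hm.pow_const q).aemeasurable]
    simp_rw [ENNReal.mul_rpow_of_nonneg _ _ hq0.le]
    have : ∀ x : Sp d, ∫⁻ y in Iic (R : ℝ), ENNReal.ofReal y ^ q * φ x ^ q ∂(levyMeasure p c)
        = (∫⁻ y in Iic (R : ℝ), ENNReal.ofReal y ^ q ∂(levyMeasure p c)) * φ x ^ q := fun x =>
      lintegral_mul_const _ (by fun_prop)
    simp_rw [this]
    rw [lintegral_const_mul _ (hφ.pow_const q), Measure.restrict_univ]
    exact ENNReal.mul_ne_top (lintegral_levyMeasure_rpow_ne_top hc hpq hR') hfin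
  filter_upwards [h1, hY.ae_zeroOrGeOne, ae_exists_bound hDb hp hY] with ω h1 h2 ⟨R, hR0, hR⟩
  rw [lintegral_noise hφ]
  have h3 := h1 R hR0
  rw [lintegral_indicator (hS R), restrict_eq_self_of_bound hR] at h3
  have h4 := (h2.lintegral_rpow_le hq0 hq1 hm).trans_lt h3
  exact (ENNReal.rpow_lt_top_iff_of_pos hq0).1 h4

/-- Distinct points have disjoint basic neighbourhoods, and a countable basis gives countably many
pairs. This is the shape that `ae_lintegral_prod_lt_top` requires. -/
lemma exists_offDiag_cover (d : ℕ) : ∃ (ι : Type) (_ : Countable ι)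
    (U V : ι → Set (Sp d × ℝ)), (∀ i, MeasurableSet (U i)) ∧ (∀ i, MeasurableSet (V i)) ∧
      (∀ i, Disjoint (U i) (V i)) ∧
      (⋃ i, U i ×ˢ V i) = {w : (Sp d × ℝ) × (Sp d × ℝ) | w.1.1 ≠ w.2.1} := by
  let B := TopologicalSpace.countableBasis (Sp d)
  have hBb : TopologicalSpace.IsTopologicalBasis B := TopologicalSpace.isBasis_countableBasis _
  have hBc : Countable B := (TopologicalSpace.countable_countableBasis (Sp d)).to_subtype
  refine ⟨{uv : B × B // Disjoint uv.1.1 uv.2.1}, inferInstance,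
    fun i => Prod.fst ⁻¹' i.1.1.1, fun i => Prod.fst ⁻¹' i.1.2.1, fun i => ?_, fun i => ?_,
    fun i => i.2.preimage _, ?_⟩
  · exact measurable_fst (hBb.isOpen i.1.1.2).measurableSet
  · exact measurable_fst (hBb.isOpen i.1.2.2).measurableSet
  · ext ⟨z, z'⟩
    simp only [mem_iUnion, mem_prod, mem_preimage, mem_ofPred_eq]
    constructor
    · rintro ⟨i, hz, hz'⟩ heq
      exact Set.disjoint_left.1 i.2 hz (heq ▸ hz')
    · intro hne
      obtain ⟨U, V, hU, hV, hzU, hzV, hUV⟩ := t2_separation hne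
      obtain ⟨u, hu, hzu, huU⟩ := hBb.exists_subset_of_mem_open hzU hU
      obtain ⟨v, hv, hzv, hvV⟩ := hBb.exists_subset_of_mem_open hzV hV
      exact ⟨⟨(⟨u, hu⟩, ⟨v, hv⟩), hUV.mono huU hvV⟩, hzu, hzv⟩

/-- Off-diagonal double integrals with respect to the noise are almost surely finite as soon as the
`q`-th power is integrable, for some `p < q ≤ 1`. -/
lemma ae_lintegral_lintegral_noise_lt_top (hDb : Bornology.IsBounded D) (hp : 0 < p) (hc : 0 < c)
    (hY : IsPoissonRandomMeasure Y (stableIntensity D p c) P) {q : ℝ} (hpq : p < q) (hq1 : q ≤ 1)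
    {a : Sp d × Sp d → ℝ≥0∞} (ha : Measurable a)
    (hfin : ∫⁻ x in D, ∫⁻ y in D, a (x, y) ^ q ≠ ∞) :
    ∀ᵐ ω ∂P, ∫⁻ x, ∫⁻ y in {x}ᶜ, a (x, y) ∂(noise Y ω) ∂(noise Y ω) < ∞ := by
  have hq0 : 0 < q := hp.trans hpq
  obtain ⟨ι, _, U, V, hU, hV, hdisj, hcov⟩ := exists_offDiag_cover d
  set O := {w : (Sp d × ℝ) × (Sp d × ℝ) | w.1.1 ≠ w.2.1} with hO
  have hOm : MeasurableSet O := by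
    rw [← hcov]; exact MeasurableSet.iUnion fun i => (hU i).prod (hV i)
  have hS : ∀ R : ℝ, MeasurableSet (univ ×ˢ Iic R : Set (Sp d × ℝ)) := fun R =>
    MeasurableSet.univ.prod measurableSet_Iic
  set Ψ : (Sp d × ℝ) × (Sp d × ℝ) → ℝ≥0∞ := fun w =>
    ENNReal.ofReal w.1.2 * (ENNReal.ofReal w.2.2 * a (w.1.1, w.2.1)) with hΨ
  have hΨm : Measurable Ψ := by
    have : Measurable fun w : (Sp d × ℝ) × (Sp d × ℝ) => a (w.1.1, w.2.1) :=
      ha.comp (by fun_prop)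
    fun_prop
  have hOΨ : Measurable (O.indicator Ψ) := hΨm.indicator hOm
  have hSS : ∀ R : ℝ, MeasurableSet ((univ ×ˢ Iic R) ×ˢ (univ ×ˢ Iic R) :
      Set ((Sp d × ℝ) × (Sp d × ℝ))) := fun R => (hS R).prod (hS R)
  have h1 : ∀ᵐ ω ∂P, ∀ R : ℕ, 0 < R → ∫⁻ z, ∫⁻ z', O.indicator
      (((univ ×ˢ Iic (R : ℝ)) ×ˢ (univ ×ˢ Iic (R : ℝ))).indicator fun w => Ψ w ^ q) (z, z')
        ∂(Y ω) ∂(Y ω) < ∞ := by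
    refine ae_all_iff.2 fun R => ?_
    rcases Nat.eq_zero_or_pos R with rfl | hR
    · simp
    have hR' : (0 : ℝ) < R := by exact_mod_cast hR
    rw [← hcov]
    refine (hY.ae_lintegral_prod_lt_top hU hV hdisj
      ((hΨm.pow_const q).indicator (hSS R)) ?_).mono fun ω h _ => h
    rw [lintegral_indicator (hSS R), ← Measure.prod_restrict,
      lintegral_prod _ (hΨm.pow_const q).aemeasurable, stableIntensity_eq,
      ← Measure.prod_restrict, Measure.restrict_univ]
    set M := ∫⁻ y in Iic (R : ℝ), ENNReal.ofReal y ^ q ∂(levyMeasure p c) with hM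
    have hMfin : M ≠ ∞ := lintegral_levyMeasure_rpow_ne_top hc hpq hR'
    have haq : Measurable fun w => a w ^ q := ha.pow_const q
    have hI : Measurable fun x => ∫⁻ y in D, a (x, y) ^ q := haq.lintegral_prod_right'
    have e1 : ∀ z : Sp d × ℝ, ∫⁻ z', Ψ (z, z') ^ q
        ∂((volume.restrict D).prod ((levyMeasure p c).restrict (Iic (R : ℝ))))
        = ENNReal.ofReal z.2 ^ q * (M * ∫⁻ y in D, a (z.1, y) ^ q) := by
      intro z
      have haz : Measurable fun y : Sp d => a (z.1, y) ^ q := haq.comp (by fun_prop)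
      simp only [hΨ]
      simp_rw [ENNReal.mul_rpow_of_nonneg _ _ hq0.le]
      rw [lintegral_const_mul _ (by fun_prop), lintegral_prod _ (by fun_prop)]
      have : ∀ y : Sp d, ∫⁻ r in Iic (R : ℝ), ENNReal.ofReal r ^ q * a (z.1, y) ^ q
          ∂(levyMeasure p c) = M * a (z.1, y) ^ q := fun y => lintegral_mul_const _ (by fun_prop)
      simp_rw [this]
      rw [lintegral_const_mul _ haz]
    simp_rw [e1]
    rw [lintegral_prod _ (by fun_prop)]
    have e2 : ∀ x : Sp d, ∫⁻ r in Iic (R : ℝ), ENNReal.ofReal r ^ q *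
        (M * ∫⁻ y in D, a (x, y) ^ q) ∂(levyMeasure p c)
        = M * (M * ∫⁻ y in D, a (x, y) ^ q) := fun x => lintegral_mul_const _ (by fun_prop)
    simp_rw [e2]
    rw [lintegral_const_mul _ (by fun_prop), lintegral_const_mul _ hI]
    exact ENNReal.mul_ne_top hMfin (ENNReal.mul_ne_top hMfin hfin)
  obtain ⟨κ, hκ, hκY⟩ := hY.exists_sfinite_kernel
  filter_upwards [h1, hY.ae_zeroOrGeOne, ae_exists_bound hDb hp hY, hκY]
    with ω h1 h2 ⟨R, hR0, hR⟩ h5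
  have hsf : SFinite (Y ω) := h5 ▸ inferInstance
  have hres := restrict_eq_self_of_bound hR
  have hmem : ∀ᵐ z ∂(Y ω), z ∈ (univ ×ˢ Iic (R : ℝ) : Set (Sp d × ℝ)) := by
    rw [← hres]; exact ae_restrict_mem (hS R)
  have h3 : ∫⁻ z, ∫⁻ z', O.indicator (fun w => Ψ w ^ q) (z, z') ∂(Y ω) ∂(Y ω) < ∞ := by
    refine lt_of_eq_of_lt (lintegral_congr_ae ?_) (h1 R hR0)
    filter_upwards [hmem] with z hz
    refine lintegral_congr_ae ?_
    filter_upwards [hmem] with z' hz'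
    have hzz : (z, z') ∈ (univ ×ˢ Iic (R : ℝ)) ×ˢ (univ ×ˢ Iic (R : ℝ)) := ⟨hz, hz'⟩
    by_cases hw : (z, z') ∈ O
    · rw [indicator_of_mem hw, indicator_of_mem hw, indicator_of_mem hzz]
    · rw [indicator_of_notMem hw, indicator_of_notMem hw]
  have h4 : ∫⁻ z, ∫⁻ z', O.indicator Ψ (z, z') ∂(Y ω) ∂(Y ω) < ∞ := by
    -- The q-th power is moved inside the outer integral and then inside the inner one, both times
    -- because Y gives mass 0 or at least 1.
    refine (ENNReal.rpow_lt_top_iff_of_pos hq0).1 (lt_of_le_of_lt ?_ h3)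
    refine (h2.lintegral_rpow_le hq0 hq1 hOΨ.lintegral_prod_right').trans ?_
    refine lintegral_mono fun z => ?_
    refine (h2.lintegral_rpow_le hq0 hq1 (hOΨ.comp (by fun_prop))).trans_eq ?_
    refine lintegral_congr fun z' => ?_
    by_cases hw : (z, z') ∈ O
    · simp only [Function.comp, indicator_of_mem hw]
    · simp only [Function.comp, indicator_of_notMem hw, ENNReal.zero_rpow_of_pos hq0]
  have hin : ∀ x : Sp d, ∫⁻ y in {x}ᶜ, a (x, y) ∂(noise Y ω)
      = ∫⁻ z', ENNReal.ofReal z'.2 * ({x}ᶜ : Set (Sp d)).indicator (fun y => a (x, y)) z'.1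
        ∂(Y ω) := fun x => by
    rw [← lintegral_indicator (measurableSet_singleton x).compl,
      lintegral_noise ((show Measurable fun y => a (x, y) from
        ha.comp (by fun_prop)).indicator (measurableSet_singleton x).compl)]
  have hsf' : SFinite (noise Y ω) := by unfold noise; infer_instance
  have hmeas : Measurable fun x => ∫⁻ y in {x}ᶜ, a (x, y) ∂(noise Y ω) := by
    have : ∀ x : Sp d, ∫⁻ y in {x}ᶜ, a (x, y) ∂(noise Y ω) = ∫⁻ y,
        {w : Sp d × Sp d | w.1 = w.2}ᶜ.indicator a (x, y) ∂(noise Y ω) := fun x => by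
      rw [← lintegral_indicator (measurableSet_singleton x).compl]
      refine lintegral_congr fun y => ?_
      simp only [indicator, mem_compl_iff, mem_singleton_iff, mem_ofPred_eq, eq_comm]
    simp_rw [this]
    exact (ha.indicator (measurableSet_eq_fun measurable_fst
      measurable_snd).compl).lintegral_prod_right'
  rw [lintegral_noise hmeas]
  refine lt_of_eq_of_lt (lintegral_congr fun z => ?_) h4
  rw [hin, ← lintegral_const_mul' _ _ ENNReal.ofReal_ne_top]
  refine lintegral_congr fun z' => ?_
  by_cases hw : (z, z') ∈ O
  · have h6 : z'.1 ∈ ({z.1}ᶜ : Set (Sp d)) := fun h => hw (mem_singleton_iff.1 h).symm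
    rw [indicator_of_mem hw, indicator_of_mem h6]
  · have h6 : z'.1 ∉ ({z.1}ᶜ : Set (Sp d)) := fun h => hw fun h' => h h'.symm
    rw [indicator_of_notMem hw, indicator_of_notMem h6, mul_zero, mul_zero]

end Noise

/-! ### Tuples without adjacent repetitions -/

section Tuples

variable {d : ℕ}

lemma snoc_mem_noAdjacent {n : ℕ} (ξ : Fin n → Sp d) (x : Sp d) :
    (Fin.snoc ξ x : Fin (n + 1) → Sp d) ∈ noAdjacent (n + 1) ↔
      ξ ∈ noAdjacent n ∧ ∀ i : Fin n, (i : ℕ) + 1 = n → ξ i ≠ x := by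
  constructor
  · intro h
    refine ⟨fun i j hij => ?_, fun i hi => ?_⟩
    · have := h i.castSucc j.castSucc (by simpa using hij)
      simpa using this
    · have := h i.castSucc (Fin.last n) (by simp [hi])
      simpa using this
  · rintro ⟨h1, h2⟩ i j hij
    have hi : (i : ℕ) < n := by have := j.2; omega
    obtain ⟨i, rfl⟩ : ∃ i' : Fin n, i = i'.castSucc := ⟨⟨i, hi⟩, rfl⟩
    rcases Fin.eq_castSucc_or_eq_last j with ⟨j, rfl⟩ | rfl
    · simpa using h1 i j (by simpa using hij)
    · simpa using h2 i (by simpa using hij.symm)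

lemma mem_noAdjacentTo {n : ℕ} {ξ : Fin n → Sp d} {x : Sp d} :
    ξ ∈ noAdjacentTo x n ↔ ξ ∈ noAdjacent n ∧ ∀ i : Fin n, (i : ℕ) + 1 = n → ξ i ≠ x :=
  snoc_mem_noAdjacent ξ x

lemma noAdjacentTo_zero (x : Sp d) : noAdjacentTo x 0 = univ :=
  eq_univ_of_forall fun _ => mem_noAdjacentTo.2 ⟨fun i => i.elim0, fun i => i.elim0⟩

/-- This recursion makes the ⋆-integral iterate: removing the last entry y replaces the reference
point x by y, which is why the equation is needed at atoms with tuples relative to the atom. -/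
lemma snoc_mem_noAdjacentTo {n : ℕ} {η : Fin n → Sp d} {x y : Sp d} :
    (Fin.snoc η y : Fin (n + 1) → Sp d) ∈ noAdjacentTo x (n + 1) ↔
      y ≠ x ∧ η ∈ noAdjacentTo y n := by
  rw [mem_noAdjacentTo]
  constructor
  · rintro ⟨h1, h2⟩
    exact ⟨by simpa using h2 (Fin.last n) (by simp), h1⟩
  · rintro ⟨h1, h2⟩
    refine ⟨h2, fun i hi => ?_⟩
    have : i = Fin.last n := Fin.ext (by simpa using hi)
    subst this
    simpa using h1

lemma measurableSet_noAdjacent (n : ℕ) : MeasurableSet (noAdjacent (d := d) n) := by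
  have : noAdjacent (d := d) n = ⋂ i : Fin n, ⋂ j : Fin n, ⋂ _ : (j : ℕ) = i + 1,
      {ξ : Fin n → Sp d | ξ i = ξ j}ᶜ := by
    ext ξ; simp [noAdjacent]
  rw [this]
  refine MeasurableSet.iInter fun i => MeasurableSet.iInter fun j =>
    MeasurableSet.iInter fun _ => ?_
  exact (measurableSet_eq_fun (measurable_pi_apply i) (measurable_pi_apply j)).compl

/-- Pairs `(x, ξ)` such that `(ξ, x)` has no adjacent repetitions. -/
def adjFree (d n : ℕ) : Set (Sp d × (Fin n → Sp d)) := {w | w.2 ∈ noAdjacentTo w.1 n}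

lemma measurableSet_adjFree (n : ℕ) : MeasurableSet (adjFree d n) := by
  have : adjFree d n = Prod.snd ⁻¹' (noAdjacent (d := d) n) ∩
      ⋂ i : Fin n, ⋂ _ : (i : ℕ) + 1 = n, {w : Sp d × (Fin n → Sp d) | w.2 i = w.1}ᶜ := by
    ext w
    simp only [adjFree, mem_ofPred_eq, mem_noAdjacentTo, mem_inter_iff, mem_preimage, mem_iInter,
      mem_compl_iff, ne_eq]
  rw [this]
  refine (measurable_snd (measurableSet_noAdjacent n)).inter ?_
  refine MeasurableSet.iInter fun i => MeasurableSet.iInter fun _ => ?_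
  exact (measurableSet_eq_fun (f := fun w : Sp d × (Fin n → Sp d) => w.2 i) (by fun_prop)
    measurable_fst).compl

lemma measurableSet_noAdjacentTo (x : Sp d) (n : ℕ) : MeasurableSet (noAdjacentTo x n) :=
  (measurable_prodMk_left : Measurable fun ξ : Fin n → Sp d => (x, ξ)) (measurableSet_adjFree n)

/-- Appending a last entry. -/
def snocMap (d n : ℕ) (w : Sp d × (Fin n → Sp d)) : Fin (n + 1) → Sp d := Fin.snoc w.2 w.1

lemma snocMap_eq (n : ℕ) : snocMap d n =
    (MeasurableEquiv.piFinSuccAbove (fun _ : Fin (n + 1) => Sp d) (Fin.last n)).symm := by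
  funext w
  exact (Fin.insertNth_last' w.1 w.2).symm

lemma measurable_snocMap (n : ℕ) : Measurable (snocMap d n) := by
  rw [snocMap_eq]; exact MeasurableEquiv.measurable _

lemma measurableEmbedding_snocMap (n : ℕ) : MeasurableEmbedding (snocMap d n) := by
  rw [snocMap_eq]; exact MeasurableEquiv.measurableEmbedding _

lemma measurePreserving_snocMap (L : Measure (Sp d)) [SigmaFinite L] (n : ℕ) :
    MeasurePreserving (snocMap d n) (L.prod (Measure.pi fun _ : Fin n => L))
      (Measure.pi fun _ : Fin (n + 1) => L) := by
  rw [snocMap_eq]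
  exact (measurePreserving_piFinSuccAbove (fun _ : Fin (n + 1) => L) (Fin.last n)).symm

lemma snocMap_preimage_noAdjacentTo (x : Sp d) (n : ℕ) :
    snocMap d n ⁻¹' noAdjacentTo x (n + 1) = {x}ᶜ ×ˢ univ ∩ adjFree d n := by
  ext w
  simp [snocMap, snoc_mem_noAdjacentTo, adjFree]

/-- Integration over `(n+1)`-tuples: first over the initial `n`-tuple, then over the last entry. -/
lemma multLInt_succ (L : Measure (Sp d)) [IsFiniteMeasure L] {n : ℕ} (x : Sp d)
    {F : (Fin (n + 1) → Sp d) → ℝ≥0∞} (hF : Measurable F) :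
    multLInt L (noAdjacentTo x (n + 1)) F
      = ∫⁻ y in {x}ᶜ, multLInt L (noAdjacentTo y n) (fun η => F (Fin.snoc η y)) ∂L := by
  unfold multLInt
  rw [← (measurePreserving_snocMap L n).setLIntegral_comp_preimage
    (measurableSet_noAdjacentTo x (n + 1)) hF, snocMap_preimage_noAdjacentTo]
  have hm : Measurable fun w => F (snocMap d n w) := hF.comp (measurable_snocMap n)
  have hmeas : MeasurableSet ({x}ᶜ ×ˢ univ ∩ adjFree d n : Set (Sp d × (Fin n → Sp d))) :=
    ((measurableSet_singleton x).compl.prod MeasurableSet.univ).inter (measurableSet_adjFree n)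
  rw [← lintegral_indicator hmeas, lintegral_prod _ (hm.indicator hmeas).aemeasurable,
    ← lintegral_indicator (measurableSet_singleton x).compl]
  refine lintegral_congr fun y => ?_
  by_cases hy : y ∈ ({x}ᶜ : Set (Sp d))
  · rw [indicator_of_mem hy, ← lintegral_indicator (measurableSet_noAdjacentTo y n)]
    refine lintegral_congr fun η => ?_
    by_cases hη : η ∈ noAdjacentTo y n
    · have hm : (y, η) ∈ ({x}ᶜ ×ˢ univ ∩ adjFree d n : Set (Sp d × (Fin n → Sp d))) :=
        ⟨⟨hy, trivial⟩, hη⟩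
      rw [indicator_of_mem hη, indicator_of_mem hm]
      rfl
    · rw [indicator_of_notMem hη, indicator_of_notMem fun h => hη h.2]
  · rw [indicator_of_notMem hy]
    rw [← lintegral_zero (μ := Measure.pi fun _ : Fin n => L)]
    exact lintegral_congr fun η => indicator_of_notMem (fun h => hy h.1.1) _

end Tuples

/-! ### Product kernels -/

section PiKernel

variable {A : Type*} {E : Type} [MeasurableSpace A] [MeasurableSpace E]

/-- Induction on n over all parameter spaces at once: the last coordinate is peeled off and absorbed
into the parameter. -/
lemma measurable_lintegral_pi {n : ℕ} : ∀ {A : Type*} [MeasurableSpace A] (κ : Kernel A E)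
    [∀ a, IsFiniteMeasure (κ a)] {F : A × (Fin n → E) → ℝ≥0∞}, Measurable F →
    Measurable fun a => ∫⁻ ξ, F (a, ξ) ∂(Measure.pi fun _ : Fin n => κ a) := by
  induction n with
  | zero =>
    intro A _ κ _ F hF
    have : (fun a => ∫⁻ ξ, F (a, ξ) ∂(Measure.dirac fun i : Fin 0 => isEmptyElim i))
        = fun a => F (a, fun i : Fin 0 => isEmptyElim i) := by
      funext a
      exact lintegral_dirac' _ (hF.comp measurable_prodMk_left)
    have hd : ∀ a, (Measure.pi fun _ : Fin 0 => κ a)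
        = Measure.dirac fun i : Fin 0 => isEmptyElim i := fun a => Measure.pi_of_empty _ _
    simp_rw [hd]
    rw [this]
    exact hF.comp (by fun_prop)
  | succ n ih =>
    intro A _ κ _ F hF
    have hsf : IsSFiniteKernel κ := isSFiniteKernel_of_forall_lt_top κ fun a => measure_lt_top _ _
    have h1 : ∀ a, ∫⁻ ξ, F (a, ξ) ∂(Measure.pi fun _ : Fin (n + 1) => κ a)
        = ∫⁻ y, ∫⁻ η, F (a, (MeasurableEquiv.piFinSuccAbove (fun _ : Fin (n + 1) => E)
          (Fin.last n)).symm (y, η)) ∂(Measure.pi fun _ : Fin n => κ a) ∂(κ a) := fun a => by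
      have hFa : Measurable fun ξ => F (a, ξ) := hF.comp measurable_prodMk_left
      rw [← ((measurePreserving_piFinSuccAbove (fun _ : Fin (n + 1) => κ a)
        (Fin.last n)).symm).lintegral_comp hFa]
      exact lintegral_prod _ (hFa.comp (MeasurableEquiv.measurable _)).aemeasurable
    simp_rw [h1]
    let κ' : Kernel (A × E) E := κ.comap Prod.fst measurable_fst
    have : ∀ w, IsFiniteMeasure (κ' w) := fun w => by
      simp only [κ', Kernel.comap_apply]; infer_instance
    have hmm : Measurable fun w : (A × E) × (Fin n → E) =>
        (w.1.1, (MeasurableEquiv.piFinSuccAbove (fun _ : Fin (n + 1) => E)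
          (Fin.last n)).symm (w.1.2, w.2)) :=
      (measurable_fst.comp measurable_fst).prodMk ((MeasurableEquiv.measurable _).comp
        ((measurable_snd.comp measurable_fst).prodMk measurable_snd))
    have h2 := ih κ' (F := fun w : (A × E) × (Fin n → E) =>
      F (w.1.1, (MeasurableEquiv.piFinSuccAbove (fun _ : Fin (n + 1) => E)
          (Fin.last n)).symm (w.1.2, w.2))) (hF.comp hmm)
    exact Measurable.lintegral_kernel_prod_right' (κ := κ) h2

/-- The product kernel `a ↦ κ(a)^{⊗ n}`. -/
def piKernel (κ : Kernel A E) [∀ a, IsFiniteMeasure (κ a)] (n : ℕ) : Kernel A (Fin n → E) where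
  toFun a := Measure.pi fun _ : Fin n => κ a
  measurable' := by
    refine Measure.measurable_of_measurable_coe _ fun S hS => ?_
    have h := measurable_lintegral_pi κ (n := n)
      (F := fun w : A × (Fin n → E) => S.indicator 1 w.2)
      ((measurable_one.indicator hS).comp measurable_snd)
    simpa only [lintegral_indicator_one hS] using h

lemma piKernel_apply (κ : Kernel A E) [∀ a, IsFiniteMeasure (κ a)] (n : ℕ) (a : A) :
    piKernel κ n a = Measure.pi fun _ : Fin n => κ a := rfl

instance (κ : Kernel A E) [∀ a, IsFiniteMeasure (κ a)] (n : ℕ) :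
    IsSFiniteKernel (piKernel κ n) :=
  isSFiniteKernel_of_forall_lt_top _ fun a => by
    rw [piKernel_apply]; exact measure_lt_top _ _

end PiKernel

/-! ### Multiple integrals depending measurably on the noise and the reference point -/

section MeasurableExpansion

variable {A : Type*} [MeasurableSpace A] {d : ℕ}

lemma measurable_multLInt (κ : Kernel A (Sp d)) [∀ a, IsFiniteMeasure (κ a)] {n : ℕ}
    {g : A → Sp d} (hg : Measurable g) {F : A × (Fin n → Sp d) → ℝ≥0∞} (hF : Measurable F) :
    Measurable fun a => multLInt (κ a) (noAdjacentTo (g a) n) (fun ξ => F (a, ξ)) := by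
  have hS : MeasurableSet {w : A × (Fin n → Sp d) | (g w.1, w.2) ∈ adjFree d n} :=
    (show Measurable fun w : A × (Fin n → Sp d) => (g w.1, w.2) by fun_prop)
      (measurableSet_adjFree n)
  have h := measurable_lintegral_pi κ (hF.indicator hS)
  convert! h using 2 with a
  unfold multLInt
  rw [← lintegral_indicator (measurableSet_noAdjacentTo _ n)]
  rfl

lemma measurable_multInt (κ : Kernel A (Sp d)) [∀ a, IsFiniteMeasure (κ a)] {n : ℕ}
    {g : A → Sp d} (hg : Measurable g) {F : A × (Fin n → Sp d) → ℝ} (hF : Measurable F) :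
    Measurable fun a => multInt (κ a) (noAdjacentTo (g a) n) (fun ξ => F (a, ξ)) := by
  have hS : MeasurableSet {w : A × (Fin n → Sp d) | (g w.1, w.2) ∈ adjFree d n} :=
    (show Measurable fun w : A × (Fin n → Sp d) => (g w.1, w.2) by fun_prop)
      (measurableSet_adjFree n)
  have h := ((hF.indicator hS).stronglyMeasurable.integral_kernel_prod_right'
    (κ := piKernel κ n)).measurable
  convert! h using 2 with a
  unfold multInt
  rw [← integral_indicator (measurableSet_noAdjacentTo _ n), piKernel_apply]
  rfl

end MeasurableExpansion

/-! ### Fubini for the `⋆`-integral -/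

section Star

variable {d : ℕ}

lemma measurePreserving_rearrange {X Y Z : Type*} [MeasurableSpace X] [MeasurableSpace Y]
    [MeasurableSpace Z] (μ : Measure X) (ν : Measure Y) (τ : Measure Z) [SFinite μ] [SFinite ν]
    [SFinite τ] : MeasurePreserving (fun w : (X × Y) × Z => ((w.1.1, w.2), w.1.2))
      ((μ.prod ν).prod τ) ((μ.prod τ).prod ν) :=
  (measurePreserving_prodAssoc μ τ ν).symm.comp
    (((MeasurePreserving.id μ).prod Measure.measurePreserving_swap).comp
      (measurePreserving_prodAssoc μ ν τ))

/-- The integrand `k s y η`, restricted to tuples without adjacent repetitions. -/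
def starIntegrand {n : ℕ} (k : ℝ → Sp d → (Fin n → Sp d) → ℝ) :
    (Sp d × (Fin n → Sp d)) × ℝ → ℝ :=
  (adjFree d n ×ˢ univ).indicator fun w => k w.2 w.1.1 w.1.2

lemma measurable_starIntegrand {n : ℕ} {k : ℝ → Sp d → (Fin n → Sp d) → ℝ}
    (hk : Measurable fun z : ℝ × Sp d × (Fin n → Sp d) => k z.1 z.2.1 z.2.2) :
    Measurable (starIntegrand k) := by
  refine Measurable.indicator ?_ ((measurableSet_adjFree n).prod MeasurableSet.univ)
  exact hk.comp (by fun_prop : Measurable fun w : (Sp d × (Fin n → Sp d)) × ℝ =>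
    (w.2, w.1.1, w.1.2))

lemma prod_restrict_compl (L : Measure (Sp d)) [IsFiniteMeasure L] (x : Sp d) (t : ℝ) :
    (L.prod (volume : Measure ℝ)).restrict ({x}ᶜ ×ˢ Ioc 0 t)
      = (L.restrict {x}ᶜ).prod (volume.restrict (Ioc 0 t)) :=
  (Measure.prod_restrict _ _).symm

variable (L : Measure (Sp d))

lemma multLInt_eq_lintegral_indicator {n : ℕ} (y : Sp d) (F : (Fin n → Sp d) → ℝ≥0∞) :
    multLInt L (noAdjacentTo y n) F
      = ∫⁻ η, (adjFree d n).indicator (fun w => F w.2) (y, η) ∂(Measure.pi fun _ => L) := by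
  unfold multLInt
  rw [← lintegral_indicator (measurableSet_noAdjacentTo y n)]
  rfl

lemma multInt_eq_integral_indicator {n : ℕ} (y : Sp d) (F : (Fin n → Sp d) → ℝ) :
    multInt L (noAdjacentTo y n) F
      = ∫ η, (adjFree d n).indicator (fun w => F w.2) (y, η) ∂(Measure.pi fun _ => L) := by
  unfold multInt
  rw [← integral_indicator (measurableSet_noAdjacentTo y n)]
  rfl

lemma multLInt_enorm_eq {n : ℕ} (k : ℝ → Sp d → (Fin n → Sp d) → ℝ) (s : ℝ) (y : Sp d) :
    multLInt L (noAdjacentTo y n) (fun η => ‖k s y η‖ₑ)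
      = ∫⁻ η, ‖starIntegrand k ((y, η), s)‖ₑ ∂(Measure.pi fun _ => L) := by
  rw [multLInt_eq_lintegral_indicator]
  refine lintegral_congr fun η => ?_
  by_cases h : (y, η) ∈ adjFree d n
  · rw [starIntegrand, indicator_of_mem h, indicator_of_mem (show ((y, η), s) ∈
      adjFree d n ×ˢ (univ : Set ℝ) from ⟨h, trivial⟩)]
  · rw [starIntegrand, indicator_of_notMem h, indicator_of_notMem (show ((y, η), s) ∉
      adjFree d n ×ˢ (univ : Set ℝ) from fun h' => h h'.1), enorm_zero]

lemma multInt_eq_starIntegrand {n : ℕ} (k : ℝ → Sp d → (Fin n → Sp d) → ℝ) (s : ℝ) (y : Sp d) :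
    multInt L (noAdjacentTo y n) (k s y)
      = ∫ η, starIntegrand k ((y, η), s) ∂(Measure.pi fun _ => L) := by
  rw [multInt_eq_integral_indicator]
  refine integral_congr_ae (ae_of_all _ fun η => ?_)
  by_cases h : (y, η) ∈ adjFree d n
  · simp only [starIntegrand, indicator_of_mem h, indicator_of_mem (show ((y, η), s) ∈
      adjFree d n ×ˢ (univ : Set ℝ) from ⟨h, trivial⟩)]
  · simp only [starIntegrand, indicator_of_notMem h, indicator_of_notMem (show ((y, η), s) ∉
      adjFree d n ×ˢ (univ : Set ℝ) from fun h' => h h'.1)]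

variable [IsFiniteMeasure L]

/-- Tonelli: an (n+1)-tuple relative to x is a last point y ≠ x together with an n-tuple relative to
y. The time integral is moved outside the n-fold integral. -/
lemma multLInt_star {n : ℕ} {k : ℝ → Sp d → (Fin n → Sp d) → ℝ}
    (hk : Measurable fun z : ℝ × Sp d × (Fin n → Sp d) => k z.1 z.2.1 z.2.2) (x : Sp d) (t : ℝ) :
    multLInt L (noAdjacentTo x (n + 1))
        (fun ξ => ∫⁻ s in Ioc 0 t, ‖k s (ξ (Fin.last n)) (Fin.init ξ)‖ₑ)
      = ∫⁻ w in {x}ᶜ ×ˢ Ioc 0 t, multLInt L (noAdjacentTo w.1 n) (fun η => ‖k w.2 w.1 η‖ₑ)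
          ∂(L.prod volume) := by
  have hF := (measurable_starIntegrand hk).enorm
  have hinit : Measurable fun ξ : Fin (n + 1) → Sp d => (Fin.init ξ : Fin n → Sp d) :=
    measurable_pi_lambda _ fun i => measurable_pi_apply _
  have hm : Measurable fun ξ : Fin (n + 1) → Sp d =>
      ∫⁻ s in Ioc 0 t, ‖k s (ξ (Fin.last n)) (Fin.init ξ)‖ₑ := by
    have : Measurable fun w : (Fin (n + 1) → Sp d) × ℝ =>
        ‖k w.2 (w.1 (Fin.last n)) (Fin.init w.1)‖ₑ :=
      (hk.comp (show Measurable fun w : (Fin (n + 1) → Sp d) × ℝ =>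
        (w.2, w.1 (Fin.last n), (Fin.init w.1 : Fin n → Sp d)) from
          measurable_snd.prodMk ((by fun_prop : Measurable fun w : (Fin (n + 1) → Sp d) × ℝ =>
            w.1 (Fin.last n)).prodMk (hinit.comp measurable_fst)))).enorm
    exact this.lintegral_prod_right'
  rw [multLInt_succ L x hm, prod_restrict_compl]
  simp_rw [multLInt_enorm_eq, Fin.snoc_last, Fin.init_snoc]
  have hG : Measurable fun w : (Sp d × ℝ) × (Fin n → Sp d) =>
      ‖starIntegrand k ((w.1.1, w.2), w.1.2)‖ₑ := hF.comp (by fun_prop)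
  rw [lintegral_prod _ hG.lintegral_prod_right'.aemeasurable]
  refine lintegral_congr fun y => ?_
  have hGy : Measurable (Function.uncurry fun (s : ℝ) (η : Fin n → Sp d) =>
      ‖starIntegrand k ((y, η), s)‖ₑ) := hF.comp (by fun_prop :
    Measurable fun w : ℝ × (Fin n → Sp d) => ((y, w.2), w.1))
  rw [lintegral_lintegral_swap hGy.aemeasurable, multLInt_eq_lintegral_indicator]
  refine lintegral_congr fun η => ?_
  by_cases h : (y, η) ∈ adjFree d n
  · rw [indicator_of_mem h]
    refine lintegral_congr fun s => ?_
    rw [starIntegrand, indicator_of_mem (show ((y, η), s) ∈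
      adjFree d n ×ˢ (univ : Set ℝ) from ⟨h, trivial⟩)]
  · rw [indicator_of_notMem h, ← lintegral_zero (μ := volume.restrict (Ioc 0 t))]
    refine lintegral_congr fun s => ?_
    rw [starIntegrand, indicator_of_notMem (show ((y, η), s) ∉
      adjFree d n ×ˢ (univ : Set ℝ) from fun h' => h h'.1), enorm_zero]

/-- Signed counterpart of `multLInt_star`, whose right side, assumed finite, is the integrability
that Fubini needs. -/
lemma multInt_star {n : ℕ} {k : ℝ → Sp d → (Fin n → Sp d) → ℝ}
    (hk : Measurable fun z : ℝ × Sp d × (Fin n → Sp d) => k z.1 z.2.1 z.2.2) (x : Sp d) (t : ℝ)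
    (hfin : ∫⁻ w in {x}ᶜ ×ˢ Ioc 0 t, multLInt L (noAdjacentTo w.1 n) (fun η => ‖k w.2 w.1 η‖ₑ)
          ∂(L.prod volume) ≠ ∞) :
    multInt L (noAdjacentTo x (n + 1))
        (fun ξ => ∫ s in Ioc 0 t, k s (ξ (Fin.last n)) (Fin.init ξ))
      = ∫ w in {x}ᶜ ×ˢ Ioc 0 t, multInt L (noAdjacentTo w.1 n) (k w.2 w.1) ∂(L.prod volume) := by
  set π : Measure (Fin n → Sp d) := Measure.pi fun _ => L
  set M := L.restrict {x}ᶜ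
  set τ := (volume : Measure ℝ).restrict (Ioc 0 t)
  have hFm := measurable_starIntegrand hk
  have hmp := measurePreserving_rearrange M τ π
  have hG : Measurable fun w : (Sp d × ℝ) × (Fin n → Sp d) =>
      starIntegrand k ((w.1.1, w.2), w.1.2) := hFm.comp (by fun_prop)
  have hGint : Integrable (fun w : (Sp d × ℝ) × (Fin n → Sp d) =>
      starIntegrand k ((w.1.1, w.2), w.1.2)) ((M.prod τ).prod π) := by
    refine ⟨hG.aestronglyMeasurable, ?_⟩
    rw [hasFiniteIntegral_iff_enorm, lintegral_prod _ hG.enorm.aemeasurable]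
    rw [prod_restrict_compl] at hfin
    simp_rw [multLInt_enorm_eq] at hfin
    exact hfin.lt_top
  have hFint : Integrable (starIntegrand k) ((M.prod π).prod τ) :=
    (hmp.integrable_comp hFm.aestronglyMeasurable).1 hGint
  rw [prod_restrict_compl]
  simp_rw [multInt_eq_starIntegrand]
  have e1 : ∫ w, ∫ η, starIntegrand k ((w.1, η), w.2) ∂π ∂(M.prod τ)
      = ∫ w, ∫ s, starIntegrand k (w, s) ∂τ ∂(M.prod π) := by
    rw [← integral_prod _ hFint, ← integral_prod (fun w : (Sp d × ℝ) × (Fin n → Sp d) =>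
      starIntegrand k ((w.1.1, w.2), w.1.2)) hGint]
    have := integral_map hmp.aemeasurable (f := starIntegrand k)
      (hFm.aestronglyMeasurable)
    rw [hmp.map_eq] at this
    exact this.symm
  rw [e1]
  unfold multInt
  rw [← (measurePreserving_snocMap L n).setIntegral_preimage_emb (measurableEmbedding_snocMap n)
    (fun ξ => ∫ s in Ioc 0 t, k s (ξ (Fin.last n)) (Fin.init ξ)),
    snocMap_preimage_noAdjacentTo]
  have e2 : (L.prod π).restrict ({x}ᶜ ×ˢ univ ∩ adjFree d n)
      = (M.prod π).restrict (adjFree d n) := by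
    rw [inter_comm, ← Measure.restrict_restrict (measurableSet_adjFree n), ← Measure.prod_restrict,
      Measure.restrict_univ]
  rw [e2]
  refine (integral_indicator (μ := M.prod π) (f := fun w : Sp d × (Fin n → Sp d) =>
    ∫ s in Ioc 0 t, k s (snocMap d n w (Fin.last n)) (Fin.init (snocMap d n w)))
    (measurableSet_adjFree n)).symm.trans ?_
  refine integral_congr_ae (ae_of_all _ fun w => ?_)
  by_cases h : w ∈ adjFree d n
  · simp only [indicator_of_mem h, snocMap, Fin.snoc_last, Fin.init_snoc]
    refine integral_congr_ae (ae_of_all _ fun s => ?_)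
    simp only [starIntegrand, indicator_of_mem (show (w, s) ∈
      adjFree d n ×ˢ (univ : Set ℝ) from ⟨h, trivial⟩)]
  · simp only [indicator_of_notMem h]
    symm
    refine integral_eq_zero_of_ae (ae_of_all _ fun s => ?_)
    simp only [starIntegrand, indicator_of_notMem (show (w, s) ∉
      adjFree d n ×ˢ (univ : Set ℝ) from fun h' => h h'.1)]
    rfl

end Star

/-! ### Fields given by kernels -/

section Fields

variable {d : ℕ}

/-- A sequence of kernels `fₙ(t, x; x₁, …, xₙ)`. -/
abbrev Kernels (d : ℕ) : Type := (n : ℕ) → ℝ → Sp d → (Fin n → Sp d) → ℝ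

/-- All the kernels are measurable. -/
def Kernels.IsMeas (f : Kernels d) : Prop :=
  ∀ n, Measurable (fun z : ℝ × Sp d × (Fin n → Sp d) => f n z.1 z.2.1 z.2.2)

/-- The sum of the absolute multiple integrals at `(t, x)`. -/
def absSum (L : Measure (Sp d)) (f : Kernels d) (t : ℝ) (x : Sp d) : ℝ≥0∞ :=
  ∑' n, multLInt L (noAdjacentTo x n) (fun ξ => ‖f n t x ξ‖ₑ)

/-- The value at `(t, x)` of the field with kernels `f`. -/
def valSum (L : Measure (Sp d)) (f : Kernels d) (t : ℝ) (x : Sp d) : ℝ :=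
  ∑' n, multInt L (noAdjacentTo x n) (f n t x)

/-- The absolute `⋆`-integral of the field with kernels `f`. -/
def absStar (D : Set (Sp d)) (L : Measure (Sp d)) (f : Kernels d) (t : ℝ) (x : Sp d) : ℝ≥0∞ :=
  ∫⁻ w in {x}ᶜ ×ˢ Ioc 0 t, ‖dirKer D (t - w.2) x w.1‖ₑ * absSum L f w.2 w.1 ∂(L.prod volume)

/-- The `⋆`-integral of the field with kernels `f`. -/
def starSum (D : Set (Sp d)) (L : Measure (Sp d)) (f : Kernels d) (t : ℝ) (x : Sp d) : ℝ :=
  ∫ w in {x}ᶜ ×ˢ Ioc 0 t, dirKer D (t - w.2) x w.1 * valSum L f w.2 w.1 ∂(L.prod volume)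

/-- The kernels of the `⋆`-integral, up to the shift of the order. -/
def stepKernel (D : Set (Sp d)) (f : Kernels d) (n : ℕ) (t : ℝ) (x : Sp d)
    (ξ : Fin (n + 1) → Sp d) : ℝ :=
  ∫ s in Ioc 0 t, dirKer D (t - s) x (ξ (Fin.last n)) * f n s (ξ (Fin.last n)) (Fin.init ξ)

lemma measurable_multLInt_field (L : Measure (Sp d)) [IsFiniteMeasure L] {f : Kernels d}
    (hf : f.IsMeas) (n : ℕ) :
    Measurable fun w : Sp d × ℝ => multLInt L (noAdjacentTo w.1 n) (fun ξ => ‖f n w.2 w.1 ξ‖ₑ) := by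
  have h := measurable_multLInt (Kernel.const (Sp d × ℝ) L) (n := n) (g := Prod.fst) measurable_fst
    (F := fun w : (Sp d × ℝ) × (Fin n → Sp d) => ‖f n w.1.2 w.1.1 w.2‖ₑ)
    ((hf n).comp (by fun_prop : Measurable fun w : (Sp d × ℝ) × (Fin n → Sp d) =>
      (w.1.2, w.1.1, w.2))).enorm
  simpa using h

lemma measurable_multInt_field (L : Measure (Sp d)) [IsFiniteMeasure L] {f : Kernels d}
    (hf : f.IsMeas) (n : ℕ) :
    Measurable fun w : Sp d × ℝ => multInt L (noAdjacentTo w.1 n) (f n w.2 w.1) := by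
  have h := measurable_multInt (Kernel.const (Sp d × ℝ) L) (n := n) (g := Prod.fst) measurable_fst
    (F := fun w : (Sp d × ℝ) × (Fin n → Sp d) => f n w.1.2 w.1.1 w.2)
    ((hf n).comp (by fun_prop : Measurable fun w : (Sp d × ℝ) × (Fin n → Sp d) =>
      (w.1.2, w.1.1, w.2)))
  simpa using h

lemma measurable_absSum (L : Measure (Sp d)) [IsFiniteMeasure L] {f : Kernels d}
    (hf : f.IsMeas) : Measurable fun w : Sp d × ℝ => absSum L f w.2 w.1 :=
  Measurable.tsum fun n => measurable_multLInt_field L hf n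

lemma measurable_valSum (L : Measure (Sp d)) [IsFiniteMeasure L] {f : Kernels d}
    (hf : f.IsMeas) : Measurable fun w : Sp d × ℝ => valSum L f w.2 w.1 :=
  Measurable.tsum fun n => measurable_multInt_field L hf n

lemma enorm_multInt_le (L : Measure (Sp d)) {n : ℕ} (A : Set (Fin n → Sp d))
    (F : (Fin n → Sp d) → ℝ) : ‖multInt L A F‖ₑ ≤ multLInt L A (fun ξ => ‖F ξ‖ₑ) :=
  enorm_integral_le_lintegral_enorm _

lemma enorm_valSum_le (L : Measure (Sp d)) (f : Kernels d) (t : ℝ) (x : Sp d) :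
    ‖valSum L f t x‖ₑ ≤ absSum L f t x := by
  exact enorm_tsum_le_tsum_enorm.trans (ENNReal.tsum_le_tsum fun n => enorm_multInt_le L _ _)

end Fields

/-! ### The `⋆`-integral in terms of the field -/

section StarSum

variable {d : ℕ} {D : Set (Sp d)}

/-- The kernels of the field `(s, y) ↦ G(t - s, x, y) u(s, y)`. -/
def propagate (D : Set (Sp d)) (t : ℝ) (x : Sp d) (f : Kernels d) : Kernels d :=
  fun n s y η => dirKer D (t - s) x y * f n s y η

lemma isMeas_propagate (hDo : IsOpen D) (hDb : Bornology.IsBounded D) (t : ℝ) (x : Sp d)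
    {f : Kernels d} (hf : f.IsMeas) : (propagate D t x f).IsMeas := fun n => by
  refine Measurable.mul ?_ (hf n)
  exact (measurable_dirKer hDo hDb).comp (by fun_prop :
    Measurable fun z : ℝ × Sp d × (Fin n → Sp d) => (t - z.1, x, z.2.1))

lemma multLInt_propagate (L : Measure (Sp d)) (f : Kernels d) (t : ℝ) (x : Sp d) (n : ℕ)
    (s : ℝ) (y : Sp d) (A : Set (Fin n → Sp d)) :
    multLInt L A (fun η => ‖propagate D t x f n s y η‖ₑ)
      = ‖dirKer D (t - s) x y‖ₑ * multLInt L A (fun η => ‖f n s y η‖ₑ) := by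
  unfold multLInt propagate
  simp_rw [enorm_mul]
  exact lintegral_const_mul' _ _ enorm_ne_top

lemma multInt_propagate (L : Measure (Sp d)) (f : Kernels d) (t : ℝ) (x : Sp d) (n : ℕ)
    (s : ℝ) (y : Sp d) (A : Set (Fin n → Sp d)) :
    multInt L A (propagate D t x f n s y)
      = dirKer D (t - s) x y * multInt L A (f n s y) :=
  integral_const_mul _ _

lemma absStar_eq_lintegral_absSum (L : Measure (Sp d)) (f : Kernels d) (t : ℝ) (x : Sp d) :
    absStar D L f t x
      = ∫⁻ w in {x}ᶜ ×ˢ Ioc 0 t, absSum L (propagate D t x f) w.2 w.1 ∂(L.prod volume) := by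
  unfold absStar absSum
  simp_rw [multLInt_propagate, ENNReal.tsum_mul_left]

variable (L : Measure (Sp d)) [IsFiniteMeasure L]

lemma tsum_multLInt_propagate (hDo : IsOpen D) (hDb : Bornology.IsBounded D) {f : Kernels d}
    (hf : f.IsMeas) (t : ℝ) (x : Sp d) :
    ∑' n, multLInt L (noAdjacentTo x (n + 1)) (fun ξ => ∫⁻ s in Ioc 0 t,
        ‖propagate D t x f n s (ξ (Fin.last n)) (Fin.init ξ)‖ₑ) = absStar D L f t x := by
  have hg := isMeas_propagate hDo hDb t x hf
  rw [absStar_eq_lintegral_absSum]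
  unfold absSum
  rw [lintegral_tsum fun n => (measurable_multLInt_field L hg n).aemeasurable]
  exact tsum_congr fun n => multLInt_star L (hg n) x t

/-- Summing the orders under the integral replaces the kernels by the value of the field, so two
families of kernels with the same field have the same ⋆-integral. -/
lemma tsum_multInt_stepKernel (hDo : IsOpen D) (hDb : Bornology.IsBounded D) {f : Kernels d}
    (hf : f.IsMeas) {t : ℝ} {x : Sp d} (hfin : absStar D L f t x ≠ ∞) :
    ∑' n, multInt L (noAdjacentTo x (n + 1)) (stepKernel D f n t x) = starSum D L f t x := by
  have hg := isMeas_propagate hDo hDb t x hf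
  have hsum : ∑' n, ∫⁻ w in {x}ᶜ ×ˢ Ioc 0 t, multLInt L (noAdjacentTo w.1 n)
      (fun η => ‖propagate D t x f n w.2 w.1 η‖ₑ) ∂(L.prod volume) ≠ ∞ := by
    rw [← lintegral_tsum fun n => (measurable_multLInt_field L hg n).aemeasurable]
    rwa [absStar_eq_lintegral_absSum] at hfin
  have h1 : ∀ n, multInt L (noAdjacentTo x (n + 1)) (stepKernel D f n t x)
      = ∫ w in {x}ᶜ ×ˢ Ioc 0 t, multInt L (noAdjacentTo w.1 n) (propagate D t x f n w.2 w.1)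
          ∂(L.prod volume) := fun n =>
    multInt_star L (hg n) x t (ENNReal.ne_top_of_tsum_ne_top hsum n)
  simp_rw [h1]
  rw [← integral_tsum fun n => (measurable_multInt_field L hg n).aestronglyMeasurable]
  · unfold starSum valSum
    simp_rw [multInt_propagate, tsum_mul_left]
  · refine ne_top_of_le_ne_top hsum (ENNReal.tsum_le_tsum fun n => lintegral_mono fun w => ?_)
    exact enorm_multInt_le L _ _

end StarSum

/-! ### The notion of solution in terms of the field -/

section SolvesAt

variable {d : ℕ} {D : Set (Sp d)} {L : Measure (Sp d)} [IsFiniteMeasure L]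

lemma ae_pi_last_mem (hL : L Dᶜ = 0) (n : ℕ) (A : Set (Fin (n + 1) → Sp d)) :
    ∀ᵐ ξ ∂((Measure.pi fun _ : Fin (n + 1) => L).restrict A), ξ (Fin.last n) ∈ D :=
  ae_restrict_of_ae ((Measure.tendsto_eval_ae_ae (μ := fun _ : Fin (n + 1) => L)
    (i := Fin.last n)).eventually (show ∀ᵐ y ∂L, y ∈ D from hL))

lemma ae_Ioc_lt (t : ℝ) : ∀ᵐ s ∂(volume.restrict (Ioc 0 t)), s < t := by
  rw [← Measure.restrict_congr_set Ioo_ae_eq_Ioc]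
  exact (ae_restrict_mem measurableSet_Ioo).mono fun s hs => hs.2

/-- Passing to the kernel extended by zero changes only null sets: L does not charge the complement
of D, and s < t for almost every s ≤ t. -/
lemma hasStarIntegral_iff (hDo : IsOpen D) (hDb : Bornology.IsBounded D) (hL : L Dᶜ = 0)
    {f : Kernels d} (hf : f.IsMeas) {t : ℝ} {x : Sp d} (hx : x ∈ D) {v : ℝ} :
    HasStarIntegral L (noAdjacentTo x) t
        (fun n s y ξ => dirichletKernel D (t - s) x y * f n s y ξ) v
      ↔ absStar D L f t x ≠ ∞ ∧ v = starSum D L f t x := by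
  have h1 : ∀ n, multLInt L (noAdjacentTo x (n + 1)) (fun ξ => ∫⁻ s in Ioc 0 t,
        ‖dirichletKernel D (t - s) x (ξ (Fin.last n)) * f n s (ξ (Fin.last n)) (Fin.init ξ)‖ₑ)
      = multLInt L (noAdjacentTo x (n + 1)) (fun ξ => ∫⁻ s in Ioc 0 t,
        ‖propagate D t x f n s (ξ (Fin.last n)) (Fin.init ξ)‖ₑ) := fun n => by
    refine lintegral_congr_ae ?_
    filter_upwards [ae_pi_last_mem hL n (noAdjacentTo x (n + 1))] with ξ hξ
    refine lintegral_congr_ae ?_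
    filter_upwards [ae_Ioc_lt t] with s hs
    rw [propagate, dirKer_eq (sub_pos.2 hs) hx hξ]
  have h2 : ∀ n, multInt L (noAdjacentTo x (n + 1)) (fun ξ => ∫ s in Ioc 0 t,
        dirichletKernel D (t - s) x (ξ (Fin.last n)) * f n s (ξ (Fin.last n)) (Fin.init ξ))
      = multInt L (noAdjacentTo x (n + 1)) (stepKernel D f n t x) := fun n => by
    refine integral_congr_ae ?_
    filter_upwards [ae_pi_last_mem hL n (noAdjacentTo x (n + 1))] with ξ hξ
    refine integral_congr_ae ?_
    filter_upwards [ae_Ioc_lt t] with s hs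
    rw [dirKer_eq (sub_pos.2 hs) hx hξ]
  unfold HasStarIntegral
  simp_rw [h1, h2, tsum_multLInt_propagate L hDo hDb hf]
  refine and_congr_right fun h => ?_
  rw [tsum_multInt_stepKernel L hDo hDb hf h]

/-- The form of the equation used from here on, a linear integral equation for the field with
absolute convergence as a side condition. -/
lemma solvesAt_iff (hDo : IsOpen D) (hDb : Bornology.IsBounded D) (hL : L Dᶜ = 0)
    {f : Kernels d} (hf : f.IsMeas) {u₀ : Sp d → ℝ} {t : ℝ} (ht : 0 < t) {x : Sp d} (hx : x ∈ D)
    {v : ℝ} :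
    SolvesAt D u₀ L (noAdjacentTo x) f t x v ↔
      (absSum L f t x ≠ ∞ ∧ v = valSum L f t x) ∧ absStar D L f t x ≠ ∞ ∧
        v = (∫ y in D, dirKer D t x y * u₀ y) + starSum D L f t x := by
  have h : ∫ y in D, dirichletKernel D t x y * u₀ y = ∫ y in D, dirKer D t x y * u₀ y :=
    setIntegral_congr_fun hDo.measurableSet fun y hy => by
      simp only [dirKer_eq ht hx hy]
  unfold SolvesAt
  rw [hasStarIntegral_iff hDo hDb hL hf hx, h, sub_eq_iff_eq_add']
  rfl

/-- If L does not charge x, almost no tuple has an entry equal to x, so the extra constraint at the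
last entry is void. -/
lemma restrict_noAdjacent {x : Sp d} (hx : L {x} = 0) (n : ℕ) :
    (Measure.pi fun _ : Fin n => L).restrict (noAdjacent n)
      = (Measure.pi fun _ : Fin n => L).restrict (noAdjacentTo x n) := by
  refine Measure.restrict_congr_set ?_
  have h : ∀ᵐ ξ ∂(Measure.pi fun _ : Fin n => L), ∀ i, ξ i ≠ x := by
    rw [ae_all_iff]
    exact fun i => (Measure.tendsto_eval_ae_ae (μ := fun _ : Fin n => L) (i := i)).eventually
      (show ∀ᵐ y ∂L, y ≠ x from by simpa [ae_iff] using hx)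
  filter_upwards [h] with ξ hξ
  exact propext ⟨fun hh => mem_noAdjacentTo.2 ⟨hh, fun i _ => hξ i⟩,
    fun hh => (mem_noAdjacentTo.1 hh).1⟩

lemma solvesAt_noAdjacent_iff {x : Sp d} (hx : L {x} = 0) {u₀ : Sp d → ℝ} {f : Kernels d} {t : ℝ}
    {v : ℝ} : SolvesAt D u₀ L noAdjacent f t x v ↔ SolvesAt D u₀ L (noAdjacentTo x) f t x v := by
  unfold SolvesAt HasExpansion HasStarIntegral multInt multLInt
  simp_rw [restrict_noAdjacent hx]

end SolvesAt

/-! ### The noise as a finite kernel -/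

section NoiseKernel

variable {d : ℕ}

/-- The projected measure `∑ y_i δ_{x_i}`. -/
def proj (m : Measure (Sp d × ℝ)) : Measure (Sp d) :=
  (m.withDensity fun z => ENNReal.ofReal z.2).map Prod.fst

lemma measurable_proj : Measurable (proj (d := d)) := by
  refine Measure.measurable_of_measurable_coe _ fun A hA => ?_
  have : (fun m : Measure (Sp d × ℝ) => proj m A) = fun m =>
      ∫⁻ z, (Prod.fst ⁻¹' A).indicator (fun z => ENNReal.ofReal z.2) z ∂m := by
    funext m
    rw [proj, Measure.map_apply measurable_fst hA, withDensity_apply _ (measurable_fst hA),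
      lintegral_indicator (measurable_fst hA)]
  rw [this]
  exact Measure.measurable_lintegral ((by fun_prop :
    Measurable fun z : Sp d × ℝ => ENNReal.ofReal z.2).indicator (measurable_fst hA))

open Classical in
/-- The projected measure, replaced by `0` where it is infinite. -/
def projKer (d : ℕ) : Kernel (Measure (Sp d × ℝ)) (Sp d) where
  toFun m := if proj m univ < ∞ then proj m else 0
  measurable' := Measurable.ite
    (measurableSet_lt ((Measure.measurable_coe MeasurableSet.univ).comp measurable_proj)
      measurable_const) measurable_proj measurable_const

lemma projKer_eq {m : Measure (Sp d × ℝ)} (h : proj m univ < ∞) : projKer d m = proj m :=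
  if_pos h

instance (m : Measure (Sp d × ℝ)) : IsFiniteMeasure (projKer d m) := by
  by_cases h : proj m univ < ∞
  · rw [projKer_eq h]; exact ⟨h⟩
  · rw [show projKer d m = 0 from if_neg h]; infer_instance

instance : IsSFiniteKernel (projKer d) :=
  isSFiniteKernel_of_forall_lt_top _ fun _ => measure_lt_top _ _

end NoiseKernel

/-! ### The resolvent operator on `L²(L)` -/

section Resolvent

variable {d : ℕ}

lemma measurable_potential (θ : ℝ) : Measurable (potential (d := d) θ) := by
  unfold potential
  refine Measurable.lintegral_prod_right' (f := fun w : Sp d × ℝ =>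
    ENNReal.ofReal (Real.exp (-θ * w.2) * heatKernel w.2 w.1)) ?_
  refine ENNReal.measurable_ofReal.comp (Measurable.mul (by fun_prop) ?_)
  exact measurable_heatKernel.comp measurable_swap

variable (L : Measure (Sp d)) (θ : ℝ)

/-- `Φ ↦ ∫_{y ≠ x} g_θ(x - y) Φ(y) L(dy)`, where `g_θ` is the resolvent kernel. -/
def potOp (Φ : Sp d → ℝ≥0∞) (x : Sp d) : ℝ≥0∞ := ∫⁻ y in {x}ᶜ, potential θ (x - y) * Φ y ∂L

/-- `∫_{y ≠ x} g_θ(x - y)² L(dy)`. -/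
def potSq (x : Sp d) : ℝ≥0∞ := ∫⁻ y in {x}ᶜ, potential θ (x - y) ^ (2 : ℝ) ∂L

/-- The `L²(L)` norm. -/
def l2Norm (Φ : Sp d → ℝ≥0∞) : ℝ≥0∞ := (∫⁻ y, Φ y ^ (2 : ℝ) ∂L) ^ (1 / 2 : ℝ)

/-- The square of the Hilbert–Schmidt norm of `potOp`. -/
def hsSq : ℝ≥0∞ := ∫⁻ x, potSq L θ x ∂L

lemma measurable_setLIntegral_compl_singleton [SFinite L] {F : Sp d × Sp d → ℝ≥0∞}
    (hF : Measurable F) : Measurable fun x => ∫⁻ y in {x}ᶜ, F (x, y) ∂L := by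
  have hS : MeasurableSet ({w : Sp d × Sp d | w.2 = w.1}ᶜ) :=
    (measurableSet_eq_fun measurable_snd measurable_fst).compl
  have h := (hF.indicator hS).lintegral_prod_right' (ν := L)
  convert! h using 2 with x
  rw [← lintegral_indicator (measurableSet_singleton x).compl]
  rfl

lemma measurable_potential_sub :
    Measurable fun w : Sp d × Sp d => potential θ (w.1 - w.2) :=
  (measurable_potential θ).comp (by fun_prop)

variable {L θ}

lemma measurable_potOp [SFinite L] {Φ : Sp d → ℝ≥0∞} (hΦ : Measurable Φ) :
    Measurable (potOp L θ Φ) :=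
  measurable_setLIntegral_compl_singleton L
    ((measurable_potential_sub θ).mul (hΦ.comp measurable_snd))

lemma measurable_potSq [SFinite L] : Measurable (potSq L θ) :=
  measurable_setLIntegral_compl_singleton L ((measurable_potential_sub θ).pow_const 2)

/-- Cauchy–Schwarz in L²(L). The bound is pointwise, so it also applies at points that L does not
charge. -/
lemma potOp_le {Φ : Sp d → ℝ≥0∞} (hΦ : Measurable Φ) (x : Sp d) :
    potOp L θ Φ x ≤ potSq L θ x ^ (1 / 2 : ℝ) * l2Norm L Φ := by
  have h := ENNReal.lintegral_mul_le_Lp_mul_Lq (L.restrict {x}ᶜ) Real.HolderConjugate.two_two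
    (f := fun y => potential θ (x - y)) (g := Φ)
    ((measurable_potential θ).comp (by fun_prop)).aemeasurable hΦ.aemeasurable
  refine h.trans ?_
  unfold potSq l2Norm
  gcongr
  exact Measure.restrict_le_self

/-- The Hilbert–Schmidt norm dominates the operator norm. -/
lemma l2Norm_potOp_le [SFinite L] {Φ : Sp d → ℝ≥0∞} (hΦ : Measurable Φ) :
    l2Norm L (potOp L θ Φ) ≤ hsSq L θ ^ (1 / 2 : ℝ) * l2Norm L Φ := by
  have h : ∀ x, potOp L θ Φ x ^ (2 : ℝ) ≤ potSq L θ x * l2Norm L Φ ^ (2 : ℝ) := fun x => by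
    refine (ENNReal.rpow_le_rpow (potOp_le hΦ x) zero_le_two).trans_eq ?_
    rw [ENNReal.mul_rpow_of_nonneg _ _ zero_le_two, ← ENNReal.rpow_mul]
    norm_num
  calc l2Norm L (potOp L θ Φ)
      ≤ (∫⁻ x, potSq L θ x * l2Norm L Φ ^ (2 : ℝ) ∂L) ^ (1 / 2 : ℝ) :=
        ENNReal.rpow_le_rpow (lintegral_mono h) (by norm_num)
    _ = (hsSq L θ * l2Norm L Φ ^ (2 : ℝ)) ^ (1 / 2 : ℝ) := by
        rw [lintegral_mul_const _ measurable_potSq, hsSq]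
    _ = hsSq L θ ^ (1 / 2 : ℝ) * l2Norm L Φ := by
        rw [ENNReal.mul_rpow_of_nonneg _ _ (by norm_num), ← ENNReal.rpow_mul]
        norm_num

/-- A θ that makes the full noise contractive does so for every thinning of it. -/
lemma hsSq_mono {L' : Measure (Sp d)} (h : L' ≤ L) : hsSq L' θ ≤ hsSq L θ :=
  lintegral_mono' h fun _ => lintegral_mono' (Measure.restrict_mono subset_rfl h) le_rfl

/-- A contraction admits no nonzero subinvariant function of finite norm. Without `hfin` the
inequality could read ∞ ≤ ∞; securing it is the main difficulty of uniqueness. -/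
lemma eq_zero_of_le_potOp [SFinite L] (hs : hsSq L θ < 1) {H : Sp d → ℝ≥0∞} (hH : Measurable H)
    (hfin : l2Norm L H ≠ ∞) (hle : ∀ᵐ x ∂L, H x ≤ potOp L θ H x) : ∀ᵐ x ∂L, H x = 0 := by
  have h1 : l2Norm L H ≤ hsSq L θ ^ (1 / 2 : ℝ) * l2Norm L H := by
    refine le_trans ?_ (l2Norm_potOp_le hH)
    refine ENNReal.rpow_le_rpow (lintegral_mono_ae ?_) (by norm_num)
    filter_upwards [hle] with x hx
    exact ENNReal.rpow_le_rpow hx zero_le_two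
  have h2 : hsSq L θ ^ (1 / 2 : ℝ) < 1 := ENNReal.rpow_lt_one hs (by norm_num)
  have h3 : l2Norm L H = 0 := by
    by_contra h0
    refine absurd h1 (not_le.2 ?_)
    calc hsSq L θ ^ (1 / 2 : ℝ) * l2Norm L H < 1 * l2Norm L H := by
          exact (ENNReal.mul_lt_mul_iff_left h0 hfin).2 h2
      _ = l2Norm L H := one_mul _
  rw [l2Norm, ENNReal.rpow_eq_zero_iff_of_pos (by norm_num),
    lintegral_eq_zero_iff (hH.pow_const 2)] at h3
  filter_upwards [h3] with x hx
  simpa using hx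

/-- The iterates of `potOp`, applied to the constant `1`. -/
def potIter (L : Measure (Sp d)) (θ : ℝ) : ℕ → Sp d → ℝ≥0∞
  | 0 => fun _ => 1
  | n + 1 => potOp L θ (potIter L θ n)

lemma measurable_potIter [SFinite L] (n : ℕ) : Measurable (potIter L θ n) := by
  induction n with
  | zero => exact measurable_const
  | succ n ih => exact measurable_potOp ih

lemma l2Norm_potIter_le [SFinite L] (n : ℕ) :
    l2Norm L (potIter L θ n) ≤ (hsSq L θ ^ (1 / 2 : ℝ)) ^ n * L univ ^ (1 / 2 : ℝ) := by
  induction n with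
  | zero => simp [l2Norm, potIter]
  | succ n ih =>
    refine (l2Norm_potOp_le (measurable_potIter n)).trans ?_
    rw [pow_succ', mul_assoc]
    gcongr

/-- The sum of all iterates. -/
def potSum (L : Measure (Sp d)) (θ : ℝ) (x : Sp d) : ℝ≥0∞ := ∑' n, potIter L θ n x

lemma measurable_potSum [SFinite L] : Measurable (potSum L θ) :=
  Measurable.tsum fun n => measurable_potIter n

/-- The operator shifts the Neumann series by one term. -/
lemma potOp_potSum_le [SFinite L] (x : Sp d) : potOp L θ (potSum L θ) x ≤ potSum L θ x := by
  have h : potOp L θ (potSum L θ) x = ∑' n, potIter L θ (n + 1) x := by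
    unfold potOp potSum
    simp_rw [← ENNReal.tsum_mul_left]
    have hm : Measurable fun y => potential θ (x - y) :=
      (measurable_potential θ).comp (by fun_prop)
    rw [lintegral_tsum]
    · rfl
    · exact fun n => (hm.mul (measurable_potIter n)).aemeasurable
  rw [h, potSum, tsum_eq_zero_add' (f := fun n => potIter L θ n x) ENNReal.summable]
  exact le_add_self

/-- The norms of the iterates are dominated by a geometric series. One last application of the
pointwise bound `potOp_le` converts this to finiteness at x. -/
lemma potSum_ne_top [IsFiniteMeasure L] (hs : hsSq L θ < 1) {x : Sp d} (hx : potSq L θ x ≠ ∞) :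
    potSum L θ x ≠ ∞ := by
  have h2 : hsSq L θ ^ (1 / 2 : ℝ) < 1 := ENNReal.rpow_lt_one hs (by norm_num)
  rw [potSum, tsum_eq_zero_add' ENNReal.summable]
  refine ENNReal.add_ne_top.2 ⟨ENNReal.one_ne_top, ?_⟩
  refine ne_top_of_le_ne_top (b := potSq L θ x ^ (1 / 2 : ℝ) *
    ((1 - hsSq L θ ^ (1 / 2 : ℝ))⁻¹ * L univ ^ (1 / 2 : ℝ))) ?_ ?_
  · refine ENNReal.mul_ne_top (ENNReal.rpow_ne_top_of_nonneg (by norm_num) hx)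
      (ENNReal.mul_ne_top ?_ (ENNReal.rpow_ne_top_of_nonneg (by norm_num) (measure_ne_top _ _)))
    exact ENNReal.inv_ne_top.2 (tsub_pos_of_lt h2).ne'
  · rw [← ENNReal.tsum_geometric, ← ENNReal.tsum_mul_right, ← ENNReal.tsum_mul_left]
    refine ENNReal.tsum_le_tsum fun n => (potOp_le (measurable_potIter n) x).trans ?_
    gcongr
    exact l2Norm_potIter_le n

/-- `∫_{y ≠ x} |x - y|^{-4β} L(dy)`. -/
def energyAt (β : ℝ) (L : Measure (Sp d)) (x : Sp d) : ℝ≥0∞ :=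
  ∫⁻ y in {x}ᶜ, ‖x - y‖ₑ ^ (-(4 * β)) ∂L

lemma potSq_le {β : ℝ} (hβ : 0 < β) (hβd : (d : ℝ) / 2 - 1 < β) :
    ∃ C : ℝ, 0 < C ∧ ∀ θ > 0, ∀ (L : Measure (Sp d)) (x : Sp d), potSq L θ x ≤
      ENNReal.ofReal (C * θ ^ (-(β - d / 2 + 1))) ^ (2 : ℝ) * energyAt β L x := by
  obtain ⟨C, hC, h⟩ := potential_le hβ hβd
  refine ⟨C, hC, fun θ hθ L x => ?_⟩
  unfold potSq energyAt
  rw [← lintegral_const_mul _ (by fun_prop)]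
  refine lintegral_mono fun y => (ENNReal.rpow_le_rpow (h θ hθ (x - y)) zero_le_two).trans_eq ?_
  rw [ENNReal.mul_rpow_of_nonneg _ _ zero_le_two, ← ENNReal.rpow_mul]
  congr 2
  ring

lemma potSq_ne_top {β : ℝ} (hβ : 0 < β) (hβd : (d : ℝ) / 2 - 1 < β) (hθ : 0 < θ) {x : Sp d}
    (hx : energyAt β L x ≠ ∞) : potSq L θ x ≠ ∞ := by
  obtain ⟨C, -, h⟩ := potSq_le hβ hβd
  exact ne_top_of_le_ne_top (ENNReal.mul_ne_top
    (ENNReal.rpow_ne_top_of_nonneg zero_le_two ENNReal.ofReal_ne_top) hx) (h θ hθ L x)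

/-- The squared norm is at most a constant times θ^{-2γ} times the energy, with γ = β - d/2 + 1 > 0.
-/
lemma exists_hsSq_lt_one {β : ℝ} (hβ : 0 < β) (hβd : (d : ℝ) / 2 - 1 < β)
    (hE : ∫⁻ x, energyAt β L x ∂L ≠ ∞) : ∃ θ > 0, hsSq L θ < 1 := by
  obtain ⟨C, -, h⟩ := potSq_le hβ hβd
  have hlim : Tendsto (fun θ : ℝ => ENNReal.ofReal (C * θ ^ (-(β - d / 2 + 1))) ^ (2 : ℝ)
      * ∫⁻ x, energyAt β L x ∂L) atTop (𝓝 0) := by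
    have h1 : Tendsto (fun θ : ℝ => C * θ ^ (-(β - d / 2 + 1))) atTop (𝓝 0) := by
      simpa using (tendsto_rpow_neg_atTop (by linarith : 0 < β - d / 2 + 1)).const_mul C
    have h2 := ((ENNReal.continuous_rpow_const (y := 2)).tendsto _).comp
      (ENNReal.tendsto_ofReal h1)
    have h3 := ENNReal.Tendsto.mul_const (b := ∫⁻ x, energyAt β L x ∂L) h2 (Or.inr hE)
    simpa using h3
  obtain ⟨θ, hθ, hθ0⟩ := ((hlim.eventually_lt_const one_pos).and (eventually_gt_atTop 0)).exists
  refine ⟨θ, hθ0, lt_of_le_of_lt ?_ hθ⟩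
  unfold hsSq
  rw [← lintegral_const_mul' _ _ (ENNReal.rpow_ne_top_of_nonneg zero_le_two ENNReal.ofReal_ne_top)]
  exact lintegral_mono fun x => h θ hθ0 L x

end Resolvent

/-! ### The solution -/

section Existence

variable {d : ℕ} {D : Set (Sp d)} {u₀ : Sp d → ℝ}

/-- The solution of the heat equation without noise. -/
def freeTerm (D : Set (Sp d)) (u₀ : Sp d → ℝ) (t : ℝ) (x : Sp d) : ℝ :=
  ∫ y in D, dirKer D t x y * u₀ y

lemma measurable_freeTerm (hDo : IsOpen D) (hDb : Bornology.IsBounded D) (hu : Measurable u₀) :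
    Measurable fun w : ℝ × Sp d => freeTerm D u₀ w.1 w.2 := by
  have h : Measurable fun w : (ℝ × Sp d) × Sp d => dirKer D w.1.1 w.1.2 w.2 * u₀ w.2 :=
    ((measurable_dirKer hDo hDb).comp (by fun_prop : Measurable fun w : (ℝ × Sp d) × Sp d =>
      (w.1.1, w.1.2, w.2))).mul (hu.comp measurable_snd)
  exact (h.stronglyMeasurable.integral_prod_right' (ν := volume.restrict D)).measurable

lemma dirKer_of_nonpos {t : ℝ} (ht : t ≤ 0) (x y : Sp d) : dirKer D t x y = 0 :=
  indicator_of_notMem (fun h => absurd h.1 (not_lt.2 ht)) _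

lemma enorm_dirKer_le (hDo : IsOpen D) (hDb : Bornology.IsBounded D) {t : ℝ} (ht : 0 < t)
    (x y : Sp d) : ‖dirKer D t x y‖ₑ ≤ ENNReal.ofReal (heatKernel t (x - y)) := by
  rw [Real.enorm_of_nonneg (dirKer_nonneg hDo hDb _ _ _)]
  exact ENNReal.ofReal_le_ofReal (dirKer_le hDo hDb ht x y)

lemma enorm_freeTerm_le (hDo : IsOpen D) (hDb : Bornology.IsBounded D) {C : ℝ}
    (hC : ∀ x ∈ D, |u₀ x| ≤ C) (t : ℝ) (x : Sp d) :
    ‖freeTerm D u₀ t x‖ₑ ≤ ENNReal.ofReal C := by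
  rcases le_or_gt t 0 with ht | ht
  · simp [freeTerm, dirKer_of_nonpos ht]
  refine (enorm_integral_le_lintegral_enorm _).trans ?_
  calc ∫⁻ y in D, ‖dirKer D t x y * u₀ y‖ₑ
      ≤ ∫⁻ y in D, ENNReal.ofReal (heatKernel t (x - y)) * ENNReal.ofReal C := by
        refine setLIntegral_mono' hDo.measurableSet fun y hy => ?_
        rw [enorm_mul]
        refine mul_le_mul' (enorm_dirKer_le hDo hDb ht x y) ?_
        rw [Real.enorm_eq_ofReal_abs]
        exact ENNReal.ofReal_le_ofReal (hC y hy)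
    _ ≤ ∫⁻ y, ENNReal.ofReal (heatKernel t (x - y)) * ENNReal.ofReal C :=
        setLIntegral_le_lintegral _ _
    _ = ENNReal.ofReal C := by
        rw [lintegral_mul_const' _ _ ENNReal.ofReal_ne_top, lintegral_heatKernel ht, one_mul]

/-- The kernels of the solution, obtained by iterating the integral equation. -/
def solKer (D : Set (Sp d)) (u₀ : Sp d → ℝ) : Kernels d
  | 0 => fun t x _ => freeTerm D u₀ t x
  | n + 1 => fun t x ξ =>
      ∫ s in Ioc 0 t, dirKer D (t - s) x (ξ (Fin.last n)) *
        solKer D u₀ n s (ξ (Fin.last n)) (Fin.init ξ)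

lemma measurable_stepKernel (hDo : IsOpen D) (hDb : Bornology.IsBounded D) {f : Kernels d} {n : ℕ}
    (hf : Measurable fun z : ℝ × Sp d × (Fin n → Sp d) => f n z.1 z.2.1 z.2.2) :
    Measurable fun z : ℝ × Sp d × (Fin (n + 1) → Sp d) => stepKernel D f n z.1 z.2.1 z.2.2 := by
  have hinit : Measurable fun ξ : Fin (n + 1) → Sp d => (Fin.init ξ : Fin n → Sp d) :=
    measurable_pi_lambda _ fun i => measurable_pi_apply _
  have h1 : Measurable fun w : (ℝ × Sp d × (Fin (n + 1) → Sp d)) × ℝ =>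
      dirKer D (w.1.1 - w.2) w.1.2.1 (w.1.2.2 (Fin.last n)) :=
    (measurable_dirKer hDo hDb).comp (by fun_prop :
      Measurable fun w : (ℝ × Sp d × (Fin (n + 1) → Sp d)) × ℝ =>
        (w.1.1 - w.2, w.1.2.1, w.1.2.2 (Fin.last n)))
  have h2 : Measurable fun w : (ℝ × Sp d × (Fin (n + 1) → Sp d)) × ℝ =>
      f n w.2 (w.1.2.2 (Fin.last n)) (Fin.init w.1.2.2) :=
    hf.comp (g := fun z : ℝ × Sp d × (Fin n → Sp d) => f n z.1 z.2.1 z.2.2)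
      (f := fun w : (ℝ × Sp d × (Fin (n + 1) → Sp d)) × ℝ =>
        (w.2, w.1.2.2 (Fin.last n), (Fin.init w.1.2.2 : Fin n → Sp d)))
      (measurable_snd.prodMk ((by fun_prop : Measurable fun w :
        (ℝ × Sp d × (Fin (n + 1) → Sp d)) × ℝ => w.1.2.2 (Fin.last n)).prodMk
          (hinit.comp (by fun_prop : Measurable fun w :
            (ℝ × Sp d × (Fin (n + 1) → Sp d)) × ℝ => w.1.2.2))))
  have hS : MeasurableSet {w : (ℝ × Sp d × (Fin (n + 1) → Sp d)) × ℝ | w.2 ∈ Ioc 0 w.1.1} :=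
    (measurableSet_lt measurable_const measurable_snd).inter
      (measurableSet_le measurable_snd (by fun_prop))
  have h := (((h1.mul h2).indicator hS).stronglyMeasurable.integral_prod_right'
    (ν := (volume : Measure ℝ))).measurable
  convert! h using 2 with z
  unfold stepKernel
  rw [← integral_indicator measurableSet_Ioc]
  rfl

lemma isMeas_solKer (hDo : IsOpen D) (hDb : Bornology.IsBounded D) (hu : Measurable u₀) :
    (solKer D u₀).IsMeas := fun n => by
  induction n with
  | zero =>
    exact (measurable_freeTerm hDo hDb hu).comp (by fun_prop :
      Measurable fun z : ℝ × Sp d × (Fin 0 → Sp d) => (z.1, z.2.1))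
  | succ n ih => exact measurable_stepKernel hDo hDb ih

/-- Write e^{θs} = e^{θt} e^{-θ(t-s)}, bound G by the free kernel, and extend t - s to all positive
times. -/
lemma lintegral_dirKer_exp_le (hDo : IsOpen D) (hDb : Bornology.IsBounded D) (θ t : ℝ)
    (x y : Sp d) :
    ∫⁻ s in Ioc 0 t, ‖dirKer D (t - s) x y‖ₑ * ENNReal.ofReal (Real.exp (θ * s))
      ≤ ENNReal.ofReal (Real.exp (θ * t)) * potential θ (x - y) := by
  set g : ℝ → ℝ≥0∞ := (Ioi (0 : ℝ)).indicator fun r =>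
    ENNReal.ofReal (Real.exp (-θ * r) * heatKernel r (x - y))
  have h1 : ∀ s, ‖dirKer D (t - s) x y‖ₑ * ENNReal.ofReal (Real.exp (θ * s))
      ≤ ENNReal.ofReal (Real.exp (θ * t)) * g (t - s) := fun s => by
    rcases le_or_gt (t - s) 0 with hs | hs
    · simp [dirKer_of_nonpos hs]
    · have : g (t - s) = ENNReal.ofReal (Real.exp (-θ * (t - s)) * heatKernel (t - s) (x - y)) :=
        indicator_of_mem (s := Ioi (0 : ℝ)) hs _
      rw [this, ← ENNReal.ofReal_mul (Real.exp_pos _).le, ← mul_assoc, ← Real.exp_add,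
        show θ * t + -θ * (t - s) = θ * s by ring, ENNReal.ofReal_mul (Real.exp_pos _).le, mul_comm]
      gcongr
      exact enorm_dirKer_le hDo hDb hs x y
  calc _ ≤ ∫⁻ s in Ioc 0 t, ENNReal.ofReal (Real.exp (θ * t)) * g (t - s) := lintegral_mono h1
    _ ≤ ∫⁻ s, ENNReal.ofReal (Real.exp (θ * t)) * g (t - s) := setLIntegral_le_lintegral _ _
    _ = ENNReal.ofReal (Real.exp (θ * t)) * ∫⁻ s, g (t - s) :=
        lintegral_const_mul' _ _ ENNReal.ofReal_ne_top
    _ = ENNReal.ofReal (Real.exp (θ * t)) * potential θ (x - y) := by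
        rw [lintegral_sub_left_eq_self g t, lintegral_indicator measurableSet_Ioi]
        rfl

variable {L : Measure (Sp d)} {θ : ℝ}

lemma multLInt_zero (x : Sp d) (F : (Fin 0 → Sp d) → ℝ≥0∞) :
    multLInt L (noAdjacentTo x 0) F = F default := by
  unfold multLInt
  rw [noAdjacentTo_zero, Measure.restrict_univ, Measure.pi_of_empty _ default, lintegral_dirac]

lemma multInt_zero (x : Sp d) (F : (Fin 0 → Sp d) → ℝ) :
    multInt L (noAdjacentTo x 0) F = F default := by
  unfold multInt
  rw [noAdjacentTo_zero, Measure.restrict_univ, Measure.pi_of_empty _ default, integral_dirac]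

lemma summable_multInt {f : Kernels d} {t : ℝ} {x : Sp d} (h : absSum L f t x ≠ ∞) :
    Summable fun n => multInt L (noAdjacentTo x n) (f n t x) := by
  refine Summable.of_norm (tsum_enorm_ne_top_iff_summable_norm.1 ?_)
  exact ne_top_of_le_ne_top h (ENNReal.tsum_le_tsum fun n => enorm_multInt_le L _ _)

variable [IsFiniteMeasure L]

/-- The estimate behind existence: the ⋆-integral preserves growth e^{θt} in time and acts on the
spatial profile by `potOp`. -/
lemma lintegral_dirKer_exp_mul_le (hDo : IsOpen D) (hDb : Bornology.IsBounded D)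
    {Φ : Sp d → ℝ≥0∞} (hΦ : Measurable Φ) (t : ℝ) (x : Sp d) (K : ℝ≥0∞) :
    ∫⁻ w in {x}ᶜ ×ˢ Ioc 0 t, ‖dirKer D (t - w.2) x w.1‖ₑ *
        (K * ENNReal.ofReal (Real.exp (θ * w.2)) * Φ w.1) ∂(L.prod volume)
      ≤ K * ENNReal.ofReal (Real.exp (θ * t)) * potOp L θ Φ x := by
  have hker : Measurable fun w : Sp d × ℝ => ‖dirKer D (t - w.2) x w.1‖ₑ :=
    ((measurable_dirKer hDo hDb).comp (by fun_prop :
      Measurable fun w : Sp d × ℝ => (t - w.2, x, w.1))).enorm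
  have hexp : Measurable fun w : Sp d × ℝ => ENNReal.ofReal (Real.exp (θ * w.2)) := by fun_prop
  have hpot : Measurable fun y => potential θ (x - y) * Φ y :=
    ((measurable_potential θ).comp (by fun_prop)).mul hΦ
  have hInt : Measurable fun w : Sp d × ℝ => ‖dirKer D (t - w.2) x w.1‖ₑ *
      (K * ENNReal.ofReal (Real.exp (θ * w.2)) * Φ w.1) :=
    hker.mul ((hexp.const_mul K).mul (hΦ.comp measurable_fst))
  rw [prod_restrict_compl, lintegral_prod _ hInt.aemeasurable]
  unfold potOp
  rw [← lintegral_const_mul _ hpot]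
  refine lintegral_mono fun y => ?_
  have hk : Measurable fun s : ℝ => ‖dirKer D (t - s) x y‖ₑ * ENNReal.ofReal (Real.exp (θ * s)) :=
    ((measurable_dirKer hDo hDb).comp (by fun_prop :
      Measurable fun s : ℝ => (t - s, x, y))).enorm.mul (by fun_prop)
  dsimp only
  calc ∫⁻ s in Ioc 0 t, ‖dirKer D (t - s) x y‖ₑ * (K * ENNReal.ofReal (Real.exp (θ * s)) * Φ y)
      = ∫⁻ s in Ioc 0 t, (K * Φ y) *
          (‖dirKer D (t - s) x y‖ₑ * ENNReal.ofReal (Real.exp (θ * s))) := by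
        refine lintegral_congr fun s => ?_
        rw [mul_right_comm K, mul_left_comm]
    _ = (K * Φ y) * ∫⁻ s in Ioc 0 t,
          ‖dirKer D (t - s) x y‖ₑ * ENNReal.ofReal (Real.exp (θ * s)) :=
        lintegral_const_mul _ hk
    _ ≤ (K * Φ y) * (ENNReal.ofReal (Real.exp (θ * t)) * potential θ (x - y)) := by
        gcongr
        exact lintegral_dirKer_exp_le hDo hDb θ t x y
    _ = K * ENNReal.ofReal (Real.exp (θ * t)) * (potential θ (x - y) * Φ y) := by
        rw [mul_mul_mul_comm, mul_comm (Φ y)]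

/-- Each Picard step costs one application of `potOp`; the start is the bound |`freeTerm`| ≤ C, from
the unit mass of the heat kernel. -/
lemma multLInt_solKer_le (hDo : IsOpen D) (hDb : Bornology.IsBounded D) (hu : Measurable u₀)
    {C : ℝ} (hC : ∀ x ∈ D, |u₀ x| ≤ C) (hθ : 0 < θ) (n : ℕ) {t : ℝ} (ht : 0 ≤ t) (x : Sp d) :
    multLInt L (noAdjacentTo x n) (fun ξ => ‖solKer D u₀ n t x ξ‖ₑ)
      ≤ ENNReal.ofReal C * ENNReal.ofReal (Real.exp (θ * t)) * potIter L θ n x := by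
  induction n generalizing t x with
  | zero =>
    rw [multLInt_zero]
    refine (enorm_freeTerm_le hDo hDb hC t x).trans ?_
    simp only [potIter, mul_one]
    refine le_mul_of_one_le_right' ?_
    rw [ENNReal.one_le_ofReal]
    exact Real.one_le_exp (by positivity)
  | succ n ih =>
    have hg := isMeas_propagate hDo hDb t x (isMeas_solKer hDo hDb hu (u₀ := u₀))
    calc multLInt L (noAdjacentTo x (n + 1)) (fun ξ => ‖solKer D u₀ (n + 1) t x ξ‖ₑ)
        ≤ multLInt L (noAdjacentTo x (n + 1)) (fun ξ => ∫⁻ s in Ioc 0 t,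
            ‖propagate D t x (solKer D u₀) n s (ξ (Fin.last n)) (Fin.init ξ)‖ₑ) :=
          lintegral_mono fun ξ => enorm_integral_le_lintegral_enorm _
      _ = ∫⁻ w in {x}ᶜ ×ˢ Ioc 0 t, ‖dirKer D (t - w.2) x w.1‖ₑ *
            multLInt L (noAdjacentTo w.1 n) (fun η => ‖solKer D u₀ n w.2 w.1 η‖ₑ)
            ∂(L.prod volume) := by
          rw [multLInt_star L (hg n)]
          simp_rw [multLInt_propagate]
      _ ≤ ∫⁻ w in {x}ᶜ ×ˢ Ioc 0 t, ‖dirKer D (t - w.2) x w.1‖ₑ *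
            (ENNReal.ofReal C * ENNReal.ofReal (Real.exp (θ * w.2)) * potIter L θ n w.1)
            ∂(L.prod volume) := by
          refine setLIntegral_mono' ((measurableSet_singleton x).compl.prod measurableSet_Ioc)
            fun w hw => ?_
          gcongr
          exact ih hw.2.1.le w.1
      _ ≤ _ := lintegral_dirKer_exp_mul_le hDo hDb (measurable_potIter n) t x _

lemma absSum_solKer_le (hDo : IsOpen D) (hDb : Bornology.IsBounded D) (hu : Measurable u₀)
    {C : ℝ} (hC : ∀ x ∈ D, |u₀ x| ≤ C) (hθ : 0 < θ) {t : ℝ} (ht : 0 ≤ t) (x : Sp d) :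
    absSum L (solKer D u₀) t x
      ≤ ENNReal.ofReal C * ENNReal.ofReal (Real.exp (θ * t)) * potSum L θ x := by
  unfold absSum potSum
  rw [← ENNReal.tsum_mul_left]
  exact ENNReal.tsum_le_tsum fun n => multLInt_solKer_le hDo hDb hu hC hθ n ht x

lemma absStar_solKer_le (hDo : IsOpen D) (hDb : Bornology.IsBounded D) (hu : Measurable u₀)
    {C : ℝ} (hC : ∀ x ∈ D, |u₀ x| ≤ C) (hθ : 0 < θ) (t : ℝ) (x : Sp d) :
    absStar D L (solKer D u₀) t x
      ≤ ENNReal.ofReal C * ENNReal.ofReal (Real.exp (θ * t)) * potSum L θ x := by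
  calc absStar D L (solKer D u₀) t x
      ≤ ∫⁻ w in {x}ᶜ ×ˢ Ioc 0 t, ‖dirKer D (t - w.2) x w.1‖ₑ *
          (ENNReal.ofReal C * ENNReal.ofReal (Real.exp (θ * w.2)) * potSum L θ w.1)
          ∂(L.prod volume) := by
        refine setLIntegral_mono' ((measurableSet_singleton x).compl.prod measurableSet_Ioc)
          fun w hw => ?_
        gcongr
        exact absSum_solKer_le hDo hDb hu hC hθ hw.2.1.le w.1
    _ ≤ ENNReal.ofReal C * ENNReal.ofReal (Real.exp (θ * t)) * potOp L θ (potSum L θ) x :=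
        lintegral_dirKer_exp_mul_le hDo hDb measurable_potSum t x _
    _ ≤ _ := by
        gcongr
        exact potOp_potSum_le x

/-- The kernel of order n + 1 is by construction the step kernel of order n, so splitting off order
0 yields the integral equation. -/
lemma valSum_solKer (hDo : IsOpen D) (hDb : Bornology.IsBounded D) (hu : Measurable u₀)
    {t : ℝ} {x : Sp d} (h : absSum L (solKer D u₀) t x ≠ ∞)
    (h' : absStar D L (solKer D u₀) t x ≠ ∞) :
    valSum L (solKer D u₀) t x = freeTerm D u₀ t x + starSum D L (solKer D u₀) t x := by
  unfold valSum
  rw [(summable_multInt h).tsum_eq_zero_add, multInt_zero,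
    ← tsum_multInt_stepKernel L hDo hDb (isMeas_solKer hDo hDb hu) h']
  rfl

lemma solvesAt_solKer (hDo : IsOpen D) (hDb : Bornology.IsBounded D) (hu : Measurable u₀)
    {C : ℝ} (hC : ∀ x ∈ D, |u₀ x| ≤ C) (hL : L Dᶜ = 0) (hθ : 0 < θ) {t : ℝ} (ht : 0 < t)
    {x : Sp d} (hx : x ∈ D) (hfin : potSum L θ x ≠ ∞) :
    SolvesAt D u₀ L (noAdjacentTo x) (solKer D u₀) t x (valSum L (solKer D u₀) t x) := by
  have htop : ENNReal.ofReal C * ENNReal.ofReal (Real.exp (θ * t)) * potSum L θ x ≠ ∞ :=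
    ENNReal.mul_ne_top (ENNReal.mul_ne_top ENNReal.ofReal_ne_top ENNReal.ofReal_ne_top) hfin
  have h1 := ne_top_of_le_ne_top htop (absSum_solKer_le hDo hDb hu hC hθ ht.le x)
  have h2 := ne_top_of_le_ne_top htop (absStar_solKer_le hDo hDb hu hC hθ t x)
  exact (solvesAt_iff hDo hDb hL (isMeas_solKer hDo hDb hu) ht hx).2
    ⟨⟨h1, rfl⟩, h2, valSum_solKer hDo hDb hu h1 h2⟩

end Existence

/-! ### Joint measurability of fields -/

section JointMeasurability

variable {d : ℕ} {D : Set (Sp d)} {A : Type*} [MeasurableSpace A] (κ : Kernel A (Sp d))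
  [∀ a, IsFiniteMeasure (κ a)] {τ : A → ℝ} {g : A → Sp d} {f : Kernels d}

instance {B : Type*} [MeasurableSpace B] {φ : B → A} (hφ : Measurable φ) (b : B) :
    IsFiniteMeasure (κ.comap φ hφ b) := by
  rw [Kernel.comap_apply]; infer_instance

lemma measurable_kernel_absSum (hf : f.IsMeas) (hτ : Measurable τ) (hg : Measurable g) :
    Measurable fun a => absSum (κ a) f (τ a) (g a) :=
  Measurable.tsum fun n => measurable_multLInt κ hg
    (F := fun w : A × (Fin n → Sp d) => ‖f n (τ w.1) (g w.1) w.2‖ₑ)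
    ((hf n).comp (by fun_prop : Measurable fun w : A × (Fin n → Sp d) =>
      (τ w.1, g w.1, w.2))).enorm

lemma measurable_kernel_valSum (hf : f.IsMeas) (hτ : Measurable τ) (hg : Measurable g) :
    Measurable fun a => valSum (κ a) f (τ a) (g a) :=
  Measurable.tsum fun n => measurable_multInt κ hg
    (F := fun w : A × (Fin n → Sp d) => f n (τ w.1) (g w.1) w.2)
    ((hf n).comp (by fun_prop : Measurable fun w : A × (Fin n → Sp d) =>
      (τ w.1, g w.1, w.2)))

lemma measurableSet_past (hτ : Measurable τ) (hg : Measurable g) :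
    MeasurableSet {w : A × (Sp d × ℝ) | w.2 ∈ {g w.1}ᶜ ×ˢ Ioc 0 (τ w.1)} := by
  have h1 : MeasurableSet ({w : A × (Sp d × ℝ) | w.2.1 = g w.1}ᶜ) :=
    (measurableSet_eq_fun (by fun_prop) (by fun_prop)).compl
  have h2 : MeasurableSet {w : A × (Sp d × ℝ) | 0 < w.2.2} :=
    measurableSet_lt measurable_const (by fun_prop)
  have h3 : MeasurableSet {w : A × (Sp d × ℝ) | w.2.2 ≤ τ w.1} :=
    measurableSet_le (by fun_prop) (by fun_prop)
  exact h1.inter (h2.inter h3)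

lemma measurable_dirKer_past (hDo : IsOpen D) (hDb : Bornology.IsBounded D) (hτ : Measurable τ)
    (hg : Measurable g) :
    Measurable fun w : A × (Sp d × ℝ) => dirKer D (τ w.1 - w.2.2) (g w.1) w.2.1 :=
  (measurable_dirKer hDo hDb).comp (by fun_prop : Measurable fun w : A × (Sp d × ℝ) =>
    (τ w.1 - w.2.2, g w.1, w.2.1))

instance : IsSFiniteKernel (κ ×ₖ Kernel.const A (volume : Measure ℝ)) := by
  have : IsSFiniteKernel κ := isSFiniteKernel_of_forall_lt_top κ fun a => measure_lt_top _ _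
  infer_instance

lemma measurable_kernel_absStar (hDo : IsOpen D) (hDb : Bornology.IsBounded D) (hf : f.IsMeas)
    (hτ : Measurable τ) (hg : Measurable g) :
    Measurable fun a => absStar D (κ a) f (τ a) (g a) := by
  have : IsSFiniteKernel κ := isSFiniteKernel_of_forall_lt_top κ fun a => measure_lt_top _ _
  have h1 := measurable_kernel_absSum (κ.comap (Prod.fst : A × (Sp d × ℝ) → A) measurable_fst)
    hf (τ := fun w => w.2.2) (g := fun w => w.2.1) (by fun_prop) (by fun_prop)
  have h2 := ((measurable_dirKer_past hDo hDb hτ hg).enorm.mul h1).indicator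
    (measurableSet_past hτ hg)
  have h3 := h2.lintegral_kernel_prod_right' (κ := κ ×ₖ Kernel.const A (volume : Measure ℝ))
  convert! h3 using 2 with a
  rw [Kernel.prod_apply, Kernel.const_apply, absStar,
    ← lintegral_indicator ((measurableSet_singleton _).compl.prod measurableSet_Ioc)]
  rfl

lemma measurable_kernel_starSum (hDo : IsOpen D) (hDb : Bornology.IsBounded D) (hf : f.IsMeas)
    (hτ : Measurable τ) (hg : Measurable g) :
    Measurable fun a => starSum D (κ a) f (τ a) (g a) := by
  have : IsSFiniteKernel κ := isSFiniteKernel_of_forall_lt_top κ fun a => measure_lt_top _ _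
  have h1 := measurable_kernel_valSum (κ.comap (Prod.fst : A × (Sp d × ℝ) → A) measurable_fst)
    hf (τ := fun w => w.2.2) (g := fun w => w.2.1) (by fun_prop) (by fun_prop)
  have h2 := ((measurable_dirKer_past hDo hDb hτ hg).mul h1).indicator
    (measurableSet_past hτ hg)
  have h3 := (h2.stronglyMeasurable.integral_kernel_prod_right'
    (κ := κ ×ₖ Kernel.const A (volume : Measure ℝ))).measurable
  convert! h3 using 2 with a
  rw [Kernel.prod_apply, Kernel.const_apply, starSum,
    ← integral_indicator ((measurableSet_singleton _).compl.prod measurableSet_Ioc)]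
  rfl

end JointMeasurability

/-! ### Almost sure properties of the noise -/

section Noise

variable {d : ℕ} {D : Set (Sp d)} {p c : ℝ} {Ω : Type*} [MeasurableSpace Ω] {P : Measure Ω}
  {Y : Ω → Measure (Sp d × ℝ)}

lemma ae_noise_univ_lt_top (hDb : Bornology.IsBounded D) (hp : 0 < p) (hp1 : p < 1) (hc : 0 < c)
    (hY : IsPoissonRandomMeasure Y (stableIntensity D p c) P) :
    ∀ᵐ ω ∂P, noise Y ω univ < ∞ := by
  have h := ae_lintegral_noise_lt_top hDb hp hc hY hp1 le_rfl (φ := fun _ => 1) measurable_const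
    (by simpa using hDb.measure_lt_top.ne)
  filter_upwards [h] with ω hω
  simpa using hω

lemma ae_energyAt_lt_top (hd : 1 ≤ d) (hDb : Bornology.IsBounded D) (hp : 0 < p) (hc : 0 < c)
    (hY : IsPoissonRandomMeasure Y (stableIntensity D p c) P) {β q : ℝ} (hpq : p < q) (hq1 : q ≤ 1)
    (hβq : 4 * β * q < d) {x : Sp d} (hx : x ∈ D) :
    ∀ᵐ ω ∂P, energyAt β (noise Y ω) x < ∞ := by
  obtain ⟨K, hK, h⟩ := setLIntegral_norm_rpow_le hd hDb hβq
  have h1 := ae_lintegral_noise_lt_top hDb hp hc hY hpq hq1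
    (φ := fun y => ‖x - y‖ₑ ^ (-(4 * β))) (by fun_prop) (by
      simp_rw [← ENNReal.rpow_mul, neg_mul]
      exact ne_top_of_le_ne_top hK (h x hx))
  filter_upwards [h1] with ω hω
  exact (setLIntegral_le_lintegral _ _).trans_lt hω

lemma ae_lintegral_energyAt_lt_top (hd : 1 ≤ d) (hDo : IsOpen D) (hDb : Bornology.IsBounded D)
    (hp : 0 < p) (hc : 0 < c)
    (hY : IsPoissonRandomMeasure Y (stableIntensity D p c) P) {β q : ℝ} (hpq : p < q) (hq1 : q ≤ 1)
    (hβq : 4 * β * q < d) :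
    ∀ᵐ ω ∂P, ∫⁻ x, energyAt β (noise Y ω) x ∂(noise Y ω) < ∞ := by
  obtain ⟨K, hK, h⟩ := setLIntegral_norm_rpow_le hd hDb hβq
  refine ae_lintegral_lintegral_noise_lt_top hDb hp hc hY hpq hq1
    (a := fun w => ‖w.1 - w.2‖ₑ ^ (-(4 * β))) (by fun_prop) ?_
  simp_rw [← ENNReal.rpow_mul, neg_mul]
  refine ne_top_of_le_ne_top (ENNReal.mul_ne_top hK (hDb.measure_lt_top (μ := volume)).ne)
    ((setLIntegral_mono' hDo.measurableSet h).trans_eq ?_)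
  rw [setLIntegral_const]

end Noise

/-! ### Existence -/

section Solution

variable {d : ℕ} {D : Set (Sp d)} {u₀ : Sp d → ℝ} {p c : ℝ} {Ω : Type*} [MeasurableSpace Ω]
  {P : Measure Ω} {Y : Ω → Measure (Sp d × ℝ)}

/-- The solution. -/
def sol (D : Set (Sp d)) (u₀ : Sp d → ℝ) (Y : Ω → Measure (Sp d × ℝ)) (t : ℝ) (x : Sp d)
    (ω : Ω) : ℝ := valSum (projKer d (Y ω)) (solKer D u₀) t x

lemma measurable_sol (hDo : IsOpen D) (hDb : Bornology.IsBounded D) (hu : Measurable u₀)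
    (hY : Measurable Y) :
    Measurable fun z : ℝ × Sp d × Ω => sol D u₀ Y z.1 z.2.1 z.2.2 := by
  have hm : Measurable fun z : ℝ × Sp d × Ω => Y z.2.2 := hY.comp (by fun_prop)
  exact measurable_kernel_valSum ((projKer d).comap (fun z : ℝ × Sp d × Ω => Y z.2.2) hm)
    (isMeas_solKer hDo hDb hu) (τ := fun z => z.1) (g := fun z => z.2.1) (by fun_prop)
    (by fun_prop)

lemma isSolution_sol (hd : 1 ≤ d) (hp0 : 0 < p) (hp1 : p < 1)
    (hdp : d ≤ 4 ∨ (5 ≤ d ∧ p < 1 / 2 + 1 / ((d : ℝ) - 2))) (hDo : IsOpen D)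
    (hDb : Bornology.IsBounded D) (hu : Measurable u₀) (hub : ∃ C : ℝ, ∀ x ∈ D, |u₀ x| ≤ C)
    (hc : 0 < c) (hY : IsPoissonRandomMeasure Y (stableIntensity D p c) P) (T : ℝ) :
    IsSolution D u₀ (noise Y) P T (sol D u₀ Y) := by
  obtain ⟨C, hC⟩ := hub
  obtain ⟨β, q, hβ, hβd, hpq, hq1, hβq⟩ := exists_exponents hd hp0 hp1 hdp
  have hfin := ae_noise_univ_lt_top hDb hp0 hp1 hc hY
  have hcompl := ae_noise_compl_eq_zero hDo hY
  have henergy := ae_lintegral_energyAt_lt_top hd hDo hDb hp0 hc hY hpq hq1 hβq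
  refine ⟨measurable_sol hDo hDb hu hY.measurable, solKer D u₀, isMeas_solKer hDo hDb hu,
    fun t ht => ⟨fun x hx => ?_, ?_⟩⟩
  · filter_upwards [hfin, hcompl, henergy, ae_noise_singleton_eq_zero hd hY x,
      ae_energyAt_lt_top hd hDb hp0 hc hY hpq hq1 hβq hx] with ω h1 h2 h3 h4 h5
    have : IsFiniteMeasure (noise Y ω) := ⟨h1⟩
    -- θ depends on ω, which is harmless as it enters the estimates but not the kernels.
    obtain ⟨θ, hθ, hs⟩ := exists_hsSq_lt_one hβ hβd h3.ne
    rw [solvesAt_noAdjacent_iff h4, sol, projKer_eq h1]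
    exact solvesAt_solKer hDo hDb hu hC h2 hθ ht.1 hx
      (potSum_ne_top hs (potSq_ne_top hβ hβd hθ h5.ne))
  · filter_upwards [hfin, hcompl, henergy] with ω h1 h2 h3
    have : IsFiniteMeasure (noise Y ω) := ⟨h1⟩
    obtain ⟨θ, hθ, hs⟩ := exists_hsSq_lt_one hβ hβd h3.ne
    have hm : Measurable (energyAt β (noise Y ω)) :=
      measurable_setLIntegral_compl_singleton _
        (F := fun w : Sp d × Sp d => ‖w.1 - w.2‖ₑ ^ (-(4 * β))) (by fun_prop)
    filter_upwards [ae_lt_top hm h3.ne, show ∀ᵐ x ∂(noise Y ω), x ∈ D from h2] with x hx hxD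
    rw [sol, projKer_eq h1]
    exact solvesAt_solKer hDo hDb hu hC h2 hθ ht.1 hxD
      (potSum_ne_top hs (potSq_ne_top hβ hβd hθ hx.ne))

end Solution

/-! ### Thinning -/

section Thinning

lemma norm_le_toReal_of_enorm_le {r : ℝ} {b : ℝ≥0∞} (h : ‖r‖ₑ ≤ b) (hb : b ≠ ∞) :
    ‖r‖ ≤ b.toReal := by
  rw [← toReal_enorm]
  exact ENNReal.toReal_mono hb h

/-- Dominated convergence for integrals over the image of a converging sequence of sets. -/
lemma tendsto_integral_map_restrict {X Z : Type*} [MeasurableSpace X] [MeasurableSpace Z]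
    {μ : Measure Z} {π : Z → X} (hπ : Measurable π) {S : ℕ → Set Z} {S₀ : Set Z}
    (hS : ∀ j, MeasurableSet (S j)) (hS₀ : MeasurableSet S₀)
    (hlim : ∀ᵐ z ∂μ, ∀ᶠ j in atTop, (z ∈ S j ↔ z ∈ S₀)) {g : ℕ → X → ℝ} {g₀ : X → ℝ}
    (hg : ∀ j, Measurable (g j)) (hg₀ : Measurable g₀) {b : X → ℝ≥0∞} (hb : Measurable b)
    (hbfin : ∫⁻ x, b x ∂(μ.map π) ≠ ∞) (hle : ∀ j x, ‖g j x‖ₑ ≤ b x)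
    (hgl : ∀ᵐ x ∂(μ.map π), Tendsto (fun j => g j x) atTop (𝓝 (g₀ x))) :
    Tendsto (fun j => ∫ x, g j x ∂((μ.restrict (S j)).map π)) atTop
      (𝓝 (∫ x, g₀ x ∂((μ.restrict S₀).map π))) := by
  have h1 : ∀ j, ∫ x, g j x ∂((μ.restrict (S j)).map π) = ∫ z, (S j).indicator (g j ∘ π) z ∂μ :=
    fun j => by
      rw [integral_map hπ.aemeasurable (hg j).aestronglyMeasurable, integral_indicator (hS j)]
      rfl
  have h2 : ∫ x, g₀ x ∂((μ.restrict S₀).map π) = ∫ z, S₀.indicator (g₀ ∘ π) z ∂μ := by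
    rw [integral_map hπ.aemeasurable hg₀.aestronglyMeasurable, integral_indicator hS₀]
    rfl
  rw [lintegral_map hb hπ] at hbfin
  have hbt : ∀ᵐ z ∂μ, b (π z) < ∞ := ae_lt_top (hb.comp hπ) hbfin
  simp_rw [h1, h2]
  refine tendsto_integral_of_dominated_convergence (fun z => (b (π z)).toReal)
    (fun j => (((hg j).comp hπ).indicator (hS j)).aestronglyMeasurable)
    (integrable_toReal_of_lintegral_ne_top (hb.comp hπ).aemeasurable hbfin) (fun j => ?_) ?_
  · filter_upwards [hbt] with z hz
    exact (norm_indicator_le_norm_self _ _).trans (norm_le_toReal_of_enorm_le (hle j _) hz.ne)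
  · filter_upwards [hlim, ae_of_ae_map hπ.aemeasurable hgl] with z hz hz'
    by_cases h : z ∈ S₀
    · rw [indicator_of_mem h]
      refine hz'.congr' ?_
      filter_upwards [hz] with j hj
      rw [indicator_of_mem (hj.2 h)]
      rfl
    · rw [indicator_of_notMem h]
      refine tendsto_const_nhds.congr' ?_
      filter_upwards [hz] with j hj
      rw [indicator_of_notMem (fun h' => h (hj.1 h'))]

variable {d : ℕ} {D : Set (Sp d)} (ν : Measure (Sp d × ℝ))

/-- The projection of `ν`, restricted to `S`. -/
def thin (S : Set (Sp d × ℝ)) : Measure (Sp d) := (ν.restrict S).map Prod.fst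

lemma thin_mono {S S' : Set (Sp d × ℝ)} (h : S ⊆ S') : thin ν S ≤ thin ν S' :=
  Measure.map_mono (Measure.restrict_mono h le_rfl) measurable_fst

lemma thin_univ : thin ν univ = ν.map Prod.fst := by rw [thin, Measure.restrict_univ]

variable [IsFiniteMeasure ν]

instance (S : Set (Sp d × ℝ)) : IsFiniteMeasure (thin ν S) := by
  unfold thin; infer_instance

/-- The projection of tuples of atoms. -/
def fstTuple (d n : ℕ) (z : Fin n → Sp d × ℝ) : Fin n → Sp d := fun i => (z i).1

lemma measurable_fstTuple (n : ℕ) : Measurable (fstTuple d n) :=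
  measurable_pi_lambda _ fun i => measurable_fst.comp (measurable_pi_apply i)

/-- Lifting points to atoms turns a change of noise into a change of the domain of integration under
one fixed measure, the form needed for dominated convergence. -/
lemma pi_thin (S : Set (Sp d × ℝ)) (n : ℕ) :
    Measure.pi (fun _ : Fin n => thin ν S)
      = ((Measure.pi fun _ : Fin n => ν).restrict (univ.pi fun _ => S)).map (fstTuple d n) := by
  rw [Measure.restrict_pi_pi]
  exact (Measure.pi_map_pi (μ := fun _ : Fin n => ν.restrict S) (f := fun _ => Prod.fst)
    (fun i => measurable_fst.aemeasurable)).symm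

lemma pi_thin_le (S : Set (Sp d × ℝ)) (n : ℕ) :
    Measure.pi (fun _ : Fin n => thin ν S) ≤ Measure.pi (fun _ : Fin n => thin ν univ) := by
  rw [pi_thin, pi_thin]
  exact Measure.map_mono (Measure.restrict_mono (pi_mono fun i _ => subset_univ _) le_rfl)
    (measurable_fstTuple n)

lemma multLInt_thin_le (S : Set (Sp d × ℝ)) {n : ℕ} (A : Set (Fin n → Sp d))
    (F : (Fin n → Sp d) → ℝ≥0∞) : multLInt (thin ν S) A F ≤ multLInt (thin ν univ) A F :=
  lintegral_mono' (Measure.restrict_mono subset_rfl (pi_thin_le ν S n)) le_rfl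

lemma absSum_thin_le (S : Set (Sp d × ℝ)) (f : Kernels d) (t : ℝ) (x : Sp d) :
    absSum (thin ν S) f t x ≤ absSum (thin ν univ) f t x :=
  ENNReal.tsum_le_tsum fun _ => multLInt_thin_le ν S _ _

lemma absStar_thin_le (S : Set (Sp d × ℝ)) (f : Kernels d) (t : ℝ) (x : Sp d) :
    absStar D (thin ν S) f t x ≤ absStar D (thin ν univ) f t x := by
  refine lintegral_mono' (Measure.restrict_mono subset_rfl
    (Measure.prod_mono (thin_mono ν (subset_univ S)) le_rfl)) fun w => ?_
  gcongr
  exact absSum_thin_le ν S f _ _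

variable {ν} {S : ℕ → Set (Sp d × ℝ)} {S₀ : Set (Sp d × ℝ)}

lemma tendsto_multInt_thin (hS : ∀ j, MeasurableSet (S j)) (hS₀ : MeasurableSet S₀)
    (hlim : ∀ᵐ z ∂ν, ∀ᶠ j in atTop, (z ∈ S j ↔ z ∈ S₀)) {n : ℕ} {A : Set (Fin n → Sp d)}
    (hA : MeasurableSet A) {F : (Fin n → Sp d) → ℝ} (hF : Measurable F)
    (hfin : multLInt (thin ν univ) A (fun ξ => ‖F ξ‖ₑ) ≠ ∞) :
    Tendsto (fun j => multInt (thin ν (S j)) A F) atTop (𝓝 (multInt (thin ν S₀) A F)) := by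
  have h1 : ∀ S : Set (Sp d × ℝ), multInt (thin ν S) A F = ∫ ξ, A.indicator F ξ
      ∂(((Measure.pi fun _ : Fin n => ν).restrict (univ.pi fun _ => S)).map (fstTuple d n)) :=
    fun S => by rw [← pi_thin, integral_indicator hA]; rfl
  simp_rw [h1]
  have hpi : ∀ᵐ z ∂(Measure.pi fun _ : Fin n => ν), ∀ i, ∀ᶠ j in atTop, (z i ∈ S j ↔ z i ∈ S₀) :=
    ae_all_iff.2 fun i =>
      (Measure.tendsto_eval_ae_ae (μ := fun _ : Fin n => ν) (i := i)).eventually hlim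
  refine tendsto_integral_map_restrict (measurable_fstTuple n)
    (fun j => MeasurableSet.univ_pi fun _ => hS j) (MeasurableSet.univ_pi fun _ => hS₀) ?_
    (fun _ => hF.indicator hA) (hF.indicator hA) (hF.indicator hA).enorm ?_
    (fun _ _ => le_rfl) (ae_of_all _ fun _ => tendsto_const_nhds)
  · filter_upwards [hpi] with z hz
    filter_upwards [eventually_all.2 hz] with j hj
    simp only [Set.mem_pi, mem_univ, forall_const, hj]
  · have h2 := pi_thin ν univ n
    rw [pi_univ, Measure.restrict_univ] at h2
    rw [← h2]
    simp_rw [enorm_indicator_eq_indicator_enorm]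
    rw [lintegral_indicator hA]
    exact hfin

lemma tendsto_valSum_thin (hS : ∀ j, MeasurableSet (S j)) (hS₀ : MeasurableSet S₀)
    (hlim : ∀ᵐ z ∂ν, ∀ᶠ j in atTop, (z ∈ S j ↔ z ∈ S₀)) {f : Kernels d} (hf : f.IsMeas)
    {t : ℝ} {x : Sp d} (hfin : absSum (thin ν univ) f t x ≠ ∞) :
    Tendsto (fun j => valSum (thin ν (S j)) f t x) atTop (𝓝 (valSum (thin ν S₀) f t x)) := by
  have hn := ENNReal.ne_top_of_tsum_ne_top hfin
  refine tendsto_tsum_of_dominated_convergence (ENNReal.summable_toReal hfin) (fun n => ?_)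
    (Eventually.of_forall fun j n => ?_)
  · refine tendsto_multInt_thin hS hS₀ hlim (measurableSet_noAdjacentTo x n) ?_ (hn n)
    exact (hf n).comp (by fun_prop : Measurable fun ξ : Fin n → Sp d => (t, x, ξ))
  · exact norm_le_toReal_of_enorm_le
      ((enorm_multInt_le _ _ _).trans (multLInt_thin_le ν (S j) _ _)) (hn n)

lemma tendsto_starSum_thin (hDo : IsOpen D) (hDb : Bornology.IsBounded D)
    (hS : ∀ j, MeasurableSet (S j)) (hS₀ : MeasurableSet S₀)
    (hlim : ∀ᵐ z ∂ν, ∀ᶠ j in atTop, (z ∈ S j ↔ z ∈ S₀)) {f : Kernels d} (hf : f.IsMeas)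
    {t : ℝ} {x : Sp d} (hfin : absStar D (thin ν univ) f t x ≠ ∞) :
    Tendsto (fun j => starSum D (thin ν (S j)) f t x) atTop
      (𝓝 (starSum D (thin ν S₀) f t x)) := by
  set B : Set (Sp d × ℝ) := {x}ᶜ ×ˢ Ioc 0 t with hBdef
  have hB : MeasurableSet B := (measurableSet_singleton x).compl.prod measurableSet_Ioc
  have hker : Measurable fun w : Sp d × ℝ => dirKer D (t - w.2) x w.1 :=
    (measurable_dirKer hDo hDb).comp (by fun_prop :
      Measurable fun w : Sp d × ℝ => (t - w.2, x, w.1))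
  have hmap : ∀ S : Set (Sp d × ℝ), (thin ν S).prod (volume : Measure ℝ)
      = ((ν.prod volume).restrict (S ×ˢ univ)).map (Prod.map Prod.fst id) := fun S => by
    rw [← Measure.prod_restrict, Measure.restrict_univ, ← Measure.map_prod_map _ _ measurable_fst
      measurable_id, Measure.map_id]
    rfl
  have hval : ∀ S : Set (Sp d × ℝ), Measurable (B.indicator fun w : Sp d × ℝ =>
      dirKer D (t - w.2) x w.1 * valSum (thin ν S) f w.2 w.1) := fun S =>
    (hker.mul (measurable_valSum (thin ν S) hf)).indicator hB
  have habs : Measurable (B.indicator fun w : Sp d × ℝ =>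
      ‖dirKer D (t - w.2) x w.1‖ₑ * absSum (thin ν univ) f w.2 w.1) :=
    (hker.enorm.mul (measurable_absSum (thin ν univ) hf)).indicator hB
  have h1 : ∀ S : Set (Sp d × ℝ), starSum D (thin ν S) f t x = ∫ w, B.indicator (fun w =>
      dirKer D (t - w.2) x w.1 * valSum (thin ν S) f w.2 w.1) w
      ∂(((ν.prod volume).restrict (S ×ˢ univ)).map (Prod.map Prod.fst id)) := fun S => by
    rw [← hmap, integral_indicator hB]; rfl
  have hfin' : ∫⁻ w, B.indicator (fun w : Sp d × ℝ =>
      ‖dirKer D (t - w.2) x w.1‖ₑ * absSum (thin ν univ) f w.2 w.1) w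
      ∂((ν.prod volume).map (Prod.map Prod.fst id)) ≠ ∞ := by
    have h2 := hmap univ
    rw [univ_prod_univ, Measure.restrict_univ] at h2
    rw [← h2, lintegral_indicator hB]
    exact hfin
  simp_rw [h1]
  refine tendsto_integral_map_restrict (measurable_fst.prodMap measurable_id)
    (fun j => (hS j).prod MeasurableSet.univ) (hS₀.prod MeasurableSet.univ) ?_
    (fun j => hval (S j)) (hval S₀) habs hfin' (fun j w => ?_) ?_
  · have := (Measure.quasiMeasurePreserving_fst (μ := ν) (ν := (volume : Measure ℝ))).ae hlim
    filter_upwards [this] with z hz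
    filter_upwards [hz] with j hj
    simpa only [mem_prod, mem_univ, and_true] using hj
  · rw [enorm_indicator_eq_indicator_enorm]
    refine indicator_le_indicator ?_
    rw [enorm_mul]
    gcongr
    exact (enorm_valSum_le _ _ _ _).trans (absSum_thin_le ν _ _ _ _)
  · filter_upwards [ae_lt_top habs hfin'] with w hw
    by_cases hwB : w ∈ B
    · simp only [indicator_of_mem hwB] at hw ⊢
      -- Where the kernel vanishes, a finite product does not make `absSum` finite, but then the
      -- integrands are all zero.
      rcases eq_or_ne (dirKer D (t - w.2) x w.1) 0 with h0 | h0
      · simp only [h0, zero_mul]; exact tendsto_const_nhds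
      · refine (tendsto_valSum_thin hS hS₀ hlim hf ?_).const_mul _
        intro htop
        rw [htop, ENNReal.mul_top (by simpa using h0)] at hw
        exact hw.ne rfl
    · simp only [indicator_of_notMem hwB]; exact tendsto_const_nhds

end Thinning

/-! ### Uniqueness for a noise with finitely many atoms -/

section Gronwall

variable {d : ℕ} {D : Set (Sp d)} {θ T : ℝ}

/-- Dual to `lintegral_dirKer_exp_le`: the earlier time is fixed and the later one is integrated. -/
lemma lintegral_exp_dirKer_le (hDo : IsOpen D) (hDb : Bornology.IsBounded D) (r : ℝ)
    (x y : Sp d) :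
    ∫⁻ s in Ioc 0 T, ENNReal.ofReal (Real.exp (-θ * s)) * ‖dirKer D (s - r) x y‖ₑ
      ≤ ENNReal.ofReal (Real.exp (-θ * r)) * potential θ (x - y) := by
  set g : ℝ → ℝ≥0∞ := (Ioi (0 : ℝ)).indicator fun r =>
    ENNReal.ofReal (Real.exp (-θ * r) * heatKernel r (x - y))
  have h1 : ∀ s, ENNReal.ofReal (Real.exp (-θ * s)) * ‖dirKer D (s - r) x y‖ₑ
      ≤ ENNReal.ofReal (Real.exp (-θ * r)) * g (s - r) := fun s => by
    rcases le_or_gt (s - r) 0 with hs | hs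
    · simp [dirKer_of_nonpos hs]
    · have : g (s - r) = ENNReal.ofReal (Real.exp (-θ * (s - r)) * heatKernel (s - r) (x - y)) :=
        indicator_of_mem (s := Ioi (0 : ℝ)) hs _
      rw [this, ← ENNReal.ofReal_mul (Real.exp_pos _).le, ← mul_assoc, ← Real.exp_add,
        show -θ * r + -θ * (s - r) = -θ * s by ring, ENNReal.ofReal_mul (Real.exp_pos _).le]
      gcongr
      exact enorm_dirKer_le hDo hDb hs x y
  calc _ ≤ ∫⁻ s in Ioc 0 T, ENNReal.ofReal (Real.exp (-θ * r)) * g (s - r) := lintegral_mono h1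
    _ ≤ ∫⁻ s, ENNReal.ofReal (Real.exp (-θ * r)) * g (s - r) := setLIntegral_le_lintegral _ _
    _ = ENNReal.ofReal (Real.exp (-θ * r)) * ∫⁻ s, g (s - r) :=
        lintegral_const_mul' _ _ ENNReal.ofReal_ne_top
    _ = ENNReal.ofReal (Real.exp (-θ * r)) * potential θ (x - y) := by
        rw [lintegral_sub_right_eq_self g r, lintegral_indicator measurableSet_Ioi]
        rfl

variable {M : Measure (Sp d)} [IsFiniteMeasure M]

/-- The Laplace transform in time of a field, up to time `T`. -/
def laplace (θ T : ℝ) (W : Sp d × ℝ → ℝ≥0∞) (y : Sp d) : ℝ≥0∞ :=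
  ∫⁻ s in Ioc 0 T, ENNReal.ofReal (Real.exp (-θ * s)) * W (y, s)

lemma measurable_laplace {W : Sp d × ℝ → ℝ≥0∞} (hW : Measurable W) :
    Measurable (laplace θ T W) := by
  have h : Measurable fun w : Sp d × ℝ => ENNReal.ofReal (Real.exp (-θ * w.2)) * W w :=
    (by fun_prop : Measurable fun w : Sp d × ℝ => ENNReal.ofReal (Real.exp (-θ * w.2))).mul hW
  exact h.lintegral_prod_right'

/-- The Laplace transform turns convolution in time into multiplication by the transform of G, which
`potential` dominates. Enlarging the inner time range to (0, T] is free, since the kernel vanishes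
at nonpositive times. -/
lemma laplace_le_potOp (hDo : IsOpen D) (hDb : Bornology.IsBounded D) {W : Sp d × ℝ → ℝ≥0∞}
    (hW : Measurable W) {x : Sp d} (hx : ∀ᵐ s ∂(volume.restrict (Ioc 0 T)), W (x, s) ≤
      ∫⁻ w in {x}ᶜ ×ˢ Ioc 0 s, ‖dirKer D (s - w.2) x w.1‖ₑ * W w ∂(M.prod volume)) :
    laplace θ T W x ≤ potOp M θ (laplace θ T W) x := by
  set M' := M.restrict {x}ᶜ
  set τ := (volume : Measure ℝ).restrict (Ioc 0 T)
  have hker : Measurable fun w : ℝ × (Sp d × ℝ) => ‖dirKer D (w.1 - w.2.2) x w.2.1‖ₑ :=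
    ((measurable_dirKer hDo hDb).comp (by fun_prop :
      Measurable fun w : ℝ × (Sp d × ℝ) => (w.1 - w.2.2, x, w.2.1))).enorm
  have hF : Measurable fun w : ℝ × (Sp d × ℝ) => ENNReal.ofReal (Real.exp (-θ * w.1)) *
      ‖dirKer D (w.1 - w.2.2) x w.2.1‖ₑ * W w.2 :=
    (Measurable.mul (by fun_prop) hker).mul (hW.comp measurable_snd)
  have hk2 : ∀ w : Sp d × ℝ, Measurable fun s : ℝ => ENNReal.ofReal (Real.exp (-θ * s)) *
      ‖dirKer D (s - w.2) x w.1‖ₑ := fun w =>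
    Measurable.mul (by fun_prop) (hker.comp (by fun_prop : Measurable fun s : ℝ => (s, w)))
  have hGm : Measurable fun w : Sp d × ℝ =>
      ENNReal.ofReal (Real.exp (-θ * w.2)) * potential θ (x - w.1) * W w :=
    (Measurable.mul (by fun_prop) ((measurable_potential θ).comp (by fun_prop))).mul hW
  have hsub : ∀ s ∈ Ioc 0 T, ∫⁻ w in {x}ᶜ ×ˢ Ioc 0 s,
      ‖dirKer D (s - w.2) x w.1‖ₑ * W w ∂(M.prod volume)
        ≤ ∫⁻ w, ‖dirKer D (s - w.2) x w.1‖ₑ * W w ∂(M'.prod τ) := fun s hs => by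
    rw [← prod_restrict_compl]
    exact lintegral_mono_set (prod_mono subset_rfl (Ioc_subset_Ioc_right hs.2))
  calc laplace θ T W x
      ≤ ∫⁻ s, ENNReal.ofReal (Real.exp (-θ * s)) *
          ∫⁻ w, ‖dirKer D (s - w.2) x w.1‖ₑ * W w ∂(M'.prod τ) ∂τ := by
        refine lintegral_mono_ae ?_
        filter_upwards [hx, ae_restrict_mem measurableSet_Ioc] with s hs hsT
        gcongr
        exact hs.trans (hsub s hsT)
    _ = ∫⁻ s, ∫⁻ w, ENNReal.ofReal (Real.exp (-θ * s)) *
          ‖dirKer D (s - w.2) x w.1‖ₑ * W w ∂(M'.prod τ) ∂τ := by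
        refine lintegral_congr fun s => ?_
        rw [← lintegral_const_mul' _ _ ENNReal.ofReal_ne_top]
        simp_rw [mul_assoc]
    _ = ∫⁻ w, ∫⁻ s, ENNReal.ofReal (Real.exp (-θ * s)) *
          ‖dirKer D (s - w.2) x w.1‖ₑ * W w ∂τ ∂(M'.prod τ) :=
        lintegral_lintegral_swap hF.aemeasurable
    _ ≤ ∫⁻ w, ENNReal.ofReal (Real.exp (-θ * w.2)) * potential θ (x - w.1) * W w ∂(M'.prod τ) := by
        refine lintegral_mono fun w => ?_
        rw [lintegral_mul_const _ (hk2 w)]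
        gcongr
        exact lintegral_exp_dirKer_le hDo hDb w.2 x w.1
    _ = potOp M θ (laplace θ T W) x := by
        rw [lintegral_prod _ hGm.aemeasurable]
        refine lintegral_congr fun y => ?_
        unfold laplace
        have hW' : Measurable fun s : ℝ => ENNReal.ofReal (Real.exp (-θ * s)) * W (y, s) :=
          Measurable.mul (by fun_prop) (hW.comp measurable_prodMk_left)
        rw [← lintegral_const_mul _ hW']
        refine lintegral_congr fun s => ?_
        rw [mul_right_comm, mul_comm]

/-- If the nonzero values of a finite measure are bounded below, then functions that are finite
almost everywhere are essentially bounded. -/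
lemma l2Norm_ne_top_of_atomic {ε : ℝ≥0∞} (hε : ε ≠ 0)
    (hM : ∀ S, MeasurableSet S → M S = 0 ∨ ε ≤ M S) {H : Sp d → ℝ≥0∞} (hH : Measurable H)
    (hfin : ∀ᵐ y ∂M, H y ≠ ∞) : l2Norm M H ≠ ∞ := by
  have hS : ∀ n : ℕ, MeasurableSet {y | (n : ℝ≥0∞) < H y} := fun n =>
    measurableSet_lt measurable_const hH
  have hlim : Tendsto (fun n : ℕ => M {y | (n : ℝ≥0∞) < H y}) atTop
      (𝓝 (M (⋂ n : ℕ, {y | (n : ℝ≥0∞) < H y}))) := by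
    refine tendsto_measure_iInter_atTop (fun n => (hS n).nullMeasurableSet) ?_
      ⟨0, measure_ne_top _ _⟩
    intro a b hab y hy
    exact lt_of_le_of_lt (Nat.cast_le.2 hab : (a : ℝ≥0∞) ≤ b) hy
  have h0 : M (⋂ n : ℕ, {y | (n : ℝ≥0∞) < H y}) = 0 := by
    refine measure_mono_null (fun y hy => ?_) hfin
    simp only [mem_iInter, mem_ofPred_eq] at hy
    simp only [mem_compl_iff, mem_ofPred_eq, not_not]
    exact ENNReal.eq_top_of_forall_nnreal_le fun r => by
      obtain ⟨n, hn⟩ := exists_nat_ge r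
      exact le_trans (by exact_mod_cast hn) (hy n).le
  rw [h0] at hlim
  -- The sets {H > n} decrease to a null set, so one of them has mass below ε and hence mass zero.
  obtain ⟨n, hn⟩ := (hlim.eventually_lt_const (pos_iff_ne_zero.2 hε)).exists
  have hn0 : M {y | (n : ℝ≥0∞) < H y} = 0 := (hM _ (hS n)).resolve_right (not_le.2 hn)
  refine ENNReal.rpow_ne_top_of_nonneg (by norm_num) (ne_top_of_le_ne_top
    (b := ∫⁻ _, (n : ℝ≥0∞) ^ (2 : ℝ) ∂M) ?_ (lintegral_mono_ae ?_))
  · rw [lintegral_const]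
    exact ENNReal.mul_ne_top (ENNReal.rpow_ne_top_of_nonneg (by norm_num)
      (ENNReal.natCast_ne_top n)) (measure_ne_top _ _)
  · have : ∀ᵐ y ∂M, ¬ (n : ℝ≥0∞) < H y := measure_eq_zero_iff_ae_notMem.1 hn0
    filter_upwards [this] with y hy
    exact ENNReal.rpow_le_rpow (not_lt.1 hy) zero_le_two

variable {f g : Kernels d}

lemma integrableOn_star (hDo : IsOpen D) (hDb : Bornology.IsBounded D) (hf : f.IsMeas) {t : ℝ}
    {x : Sp d} (h : absStar D M f t x ≠ ∞) :
    IntegrableOn (fun w : Sp d × ℝ => dirKer D (t - w.2) x w.1 * valSum M f w.2 w.1)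
      ({x}ᶜ ×ˢ Ioc 0 t) (M.prod volume) := by
  refine ⟨?_, ?_⟩
  · exact (((measurable_dirKer hDo hDb).comp (by fun_prop :
      Measurable fun w : Sp d × ℝ => (t - w.2, x, w.1))).mul
      (measurable_valSum M hf)).aestronglyMeasurable
  · rw [hasFiniteIntegral_iff_enorm]
    refine lt_of_le_of_lt (lintegral_mono fun w => ?_) h.lt_top
    rw [enorm_mul]
    gcongr
    exact enorm_valSum_le _ _ _ _

lemma enorm_starSum_sub_le (hDo : IsOpen D) (hDb : Bornology.IsBounded D) (hf : f.IsMeas)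
    (hg : g.IsMeas) {t : ℝ} {x : Sp d} (h : absStar D M f t x ≠ ∞) (h' : absStar D M g t x ≠ ∞) :
    ‖starSum D M f t x - starSum D M g t x‖ₑ ≤ ∫⁻ w in {x}ᶜ ×ˢ Ioc 0 t,
      ‖dirKer D (t - w.2) x w.1‖ₑ * ‖valSum M f w.2 w.1 - valSum M g w.2 w.1‖ₑ
      ∂(M.prod volume) := by
  unfold starSum
  rw [← integral_sub (integrableOn_star hDo hDb hf h) (integrableOn_star hDo hDb hg h')]
  refine (enorm_integral_le_lintegral_enorm _).trans_eq (lintegral_congr fun w => ?_)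
  rw [← mul_sub, enorm_mul]

/-- Two fields that satisfy the integral equation agree, if the noise has finitely many atoms and
is small in the Hilbert–Schmidt sense. -/
lemma ae_valSum_eq_of_atomic (hDo : IsOpen D) (hDb : Bornology.IsBounded D) (hθ : 0 < θ)
    (hs : hsSq M θ < 1) {ε : ℝ≥0∞} (hε : ε ≠ 0) (hM : ∀ S, MeasurableSet S → M S = 0 ∨ ε ≤ M S)
    (hf : f.IsMeas) (hg : g.IsMeas) {F : ℝ → Sp d → ℝ}
    (hEf : ∀ᵐ w ∂(M.prod (volume.restrict (Ioc 0 T))), absStar D M f w.2 w.1 ≠ ∞ ∧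
      valSum M f w.2 w.1 = F w.2 w.1 + starSum D M f w.2 w.1)
    (hEg : ∀ᵐ w ∂(M.prod (volume.restrict (Ioc 0 T))), absStar D M g w.2 w.1 ≠ ∞ ∧
      valSum M g w.2 w.1 = F w.2 w.1 + starSum D M g w.2 w.1)
    (hIf : ∀ᵐ y ∂M, ∫⁻ s in Ioc 0 T, absSum M f s y ≠ ∞)
    (hIg : ∀ᵐ y ∂M, ∫⁻ s in Ioc 0 T, absSum M g s y ≠ ∞) :
    ∀ᵐ y ∂M, ∀ᵐ s ∂(volume.restrict (Ioc 0 T)), valSum M f s y = valSum M g s y := by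
  set W : Sp d × ℝ → ℝ≥0∞ := fun w => ‖valSum M f w.2 w.1 - valSum M g w.2 w.1‖ₑ with hWdef
  have hW : Measurable W := ((measurable_valSum M hf).sub (measurable_valSum M hg)).enorm
  have hle : ∀ᵐ x ∂M, laplace θ T W x ≤ potOp M θ (laplace θ T W) x := by
    filter_upwards [Measure.ae_ae_of_ae_prod hEf, Measure.ae_ae_of_ae_prod hEg] with x h1 h2
    refine laplace_le_potOp hDo hDb hW ?_
    filter_upwards [h1, h2] with s h1 h2
    simp only [hWdef]
    rw [h1.2, h2.2, add_sub_add_left_eq_sub]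
    exact enorm_starSum_sub_le hDo hDb hf hg h1.1 h2.1
  have hfin : ∀ᵐ y ∂M, laplace θ T W y ≠ ∞ := by
    filter_upwards [hIf, hIg] with y h1 h2
    refine ne_top_of_le_ne_top (ENNReal.add_ne_top.2 ⟨h1, h2⟩) ?_
    have hm : Measurable fun s : ℝ => absSum M f s y :=
      (measurable_absSum M hf).comp measurable_prodMk_left
    rw [← lintegral_add_left hm]
    refine setLIntegral_mono' measurableSet_Ioc fun s hs => ?_
    calc ENNReal.ofReal (Real.exp (-θ * s)) * W (y, s) ≤ 1 * W (y, s) := by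
          gcongr
          rw [ENNReal.ofReal_le_one, Real.exp_le_one_iff]
          nlinarith [hs.1]
      _ ≤ _ := by
          rw [one_mul]
          refine enorm_sub_le.trans ?_
          exact add_le_add (enorm_valSum_le _ _ _ _) (enorm_valSum_le _ _ _ _)
  -- Finiteness of the Laplace transform at almost every point gives a finite L² norm here, because
  -- the masses of M are bounded below.
  have hzero := eq_zero_of_le_potOp hs (measurable_laplace hW)
    (l2Norm_ne_top_of_atomic hε hM (measurable_laplace hW) hfin) hle
  filter_upwards [hzero] with y hy
  have hWy : Measurable fun s : ℝ => ENNReal.ofReal (Real.exp (-θ * s)) * W (y, s) :=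
    Measurable.mul (by fun_prop) (hW.comp measurable_prodMk_left)
  rw [laplace, lintegral_eq_zero_iff hWy] at hy
  filter_upwards [hy] with s hs
  rcases mul_eq_zero.1 hs with h | h
  · exact absurd h (ENNReal.ofReal_pos.2 (Real.exp_pos _)).ne'
  · exact sub_eq_zero.1 (enorm_eq_zero.1 h)

end Gronwall

/-! ### Uniqueness for a noise all of whose thinnings satisfy the equation -/

section Thinned

variable {d : ℕ} {D : Set (Sp d)} {u₀ : Sp d → ℝ} {θ T : ℝ} {ν : Measure (Sp d × ℝ)}

/-- The large atoms. -/
def largeAtoms (d : ℕ) (ε : ℝ) : Set (Sp d × ℝ) := {z | ε < z.2}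

/-- The atoms whose size is not in `(δ, ε]`. -/
def outerAtoms (d : ℕ) (δ ε : ℝ) : Set (Sp d × ℝ) := (univ ×ˢ Ioc δ ε)ᶜ

lemma measurableSet_largeAtoms (ε : ℝ) : MeasurableSet (largeAtoms d ε) :=
  measurableSet_lt measurable_const measurable_snd

lemma measurableSet_outerAtoms (δ ε : ℝ) : MeasurableSet (outerAtoms d δ ε) :=
  (MeasurableSet.univ.prod measurableSet_Ioc).compl

lemma largeAtoms_subset_outerAtoms (δ ε : ℝ) : largeAtoms d ε ⊆ outerAtoms d δ ε :=
  fun _ hz h => not_lt.2 h.2.2 hz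

lemma ae_eventually_outerAtoms {δ : ℕ → ℝ} (hδ : Tendsto δ atTop (𝓝 0))
    (hpos : ∀ᵐ z ∂ν, 0 < z.2) (ε : ℝ) :
    ∀ᵐ z ∂ν, ∀ᶠ j in atTop, (z ∈ outerAtoms d (δ j) ε ↔ z ∈ largeAtoms d ε) := by
  filter_upwards [hpos] with z hz
  filter_upwards [hδ.eventually_lt_const hz] with j hj
  simp only [outerAtoms, largeAtoms, mem_compl_iff, mem_prod, mem_univ, true_and, mem_Ioc, hj,
    mem_ofPred_eq, not_le]

lemma ae_eventually_largeAtoms {δ : ℕ → ℝ} (hδ : Tendsto δ atTop (𝓝 0))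
    (hpos : ∀ᵐ z ∂ν, 0 < z.2) :
    ∀ᵐ z ∂ν, ∀ᶠ j in atTop, z ∈ largeAtoms d (δ j) := by
  filter_upwards [hpos] with z hz
  exact hδ.eventually_lt_const hz

lemma measurableSet_ae {τ : Measure ℝ} [SFinite τ] {q : Sp d × ℝ → Prop}
    (hq : MeasurableSet {w | q w}) : MeasurableSet {y | ∀ᵐ s ∂τ, q (y, s)} :=
  measurable_measure_prodMk_left (ν := τ) hq.compl (measurableSet_singleton 0)

lemma ae_thin_univ {S : ℕ → Set (Sp d × ℝ)} (hS : ∀ j, MeasurableSet (S j))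
    (hex : ∀ᵐ z ∂ν, ∃ j, z ∈ S j) {q : Sp d → Prop} (hq : MeasurableSet {y | q y})
    (h : ∀ j, ∀ᵐ y ∂(thin ν (S j)), q y) : ∀ᵐ y ∂(thin ν univ), q y := by
  rw [thin_univ, ae_map_iff measurable_fst.aemeasurable hq]
  have h' : ∀ j, ∀ᵐ z ∂ν, z ∈ S j → q z.1 := fun j => by
    have := (ae_map_iff measurable_fst.aemeasurable hq).1 (h j)
    rwa [ae_restrict_iff' (hS j)] at this
  filter_upwards [hex, ae_all_iff.2 h'] with z ⟨j, hj⟩ hz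
  exact hz j hj

lemma ae_prod_thin_of_subset {S S' : Set (Sp d × ℝ)} (hSS : S ⊆ S') {τ : Measure ℝ} [SFinite τ]
    {q : Sp d × ℝ → Prop} (h : ∀ᵐ w ∂((thin ν S').prod τ), q w) :
    ∀ᵐ w ∂((thin ν S).prod τ), q w :=
  ae_mono (Measure.prod_mono (thin_mono ν hSS) le_rfl) h

variable [IsFiniteMeasure ν]

/-- The equation for the thinned noises passes to the limit. -/
lemma ae_equation_largeAtoms (hDo : IsOpen D) (hDb : Bornology.IsBounded D)
    (hpos : ∀ᵐ z ∂ν, 0 < z.2) {f : Kernels d} (hf : f.IsMeas) {F : ℝ → Sp d → ℝ}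
    {δ : ℕ → ℝ} (hδ : Tendsto δ atTop (𝓝 0)) {τ : Measure ℝ} [SFinite τ] {ε : ℝ}
    (hfin : ∀ᵐ w ∂((thin ν univ).prod τ), absSum (thin ν univ) f w.2 w.1 ≠ ∞ ∧
      absStar D (thin ν univ) f w.2 w.1 ≠ ∞)
    (hE : ∀ j, ∀ᵐ w ∂((thin ν (outerAtoms d (δ j) ε)).prod τ),
      valSum (thin ν (outerAtoms d (δ j) ε)) f w.2 w.1
        = F w.2 w.1 + starSum D (thin ν (outerAtoms d (δ j) ε)) f w.2 w.1) :
    ∀ᵐ w ∂((thin ν (largeAtoms d ε)).prod τ), absStar D (thin ν (largeAtoms d ε)) f w.2 w.1 ≠ ∞ ∧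
      valSum (thin ν (largeAtoms d ε)) f w.2 w.1
        = F w.2 w.1 + starSum D (thin ν (largeAtoms d ε)) f w.2 w.1 := by
  have hlim := ae_eventually_outerAtoms hδ hpos ε
  -- The large atoms are never removed, so the equation for each outer noise holds at almost all of
  -- them, for all j at once.
  filter_upwards [ae_prod_thin_of_subset (subset_univ _) hfin, ae_all_iff.2 fun j =>
    ae_prod_thin_of_subset (largeAtoms_subset_outerAtoms (δ j) ε) (hE j)] with w h1 h2
  refine ⟨ne_top_of_le_ne_top h1.2 (absStar_thin_le ν _ _ _ _), ?_⟩
  -- As δ j → 0 the outer atoms tend to the large atoms, and both sides converge by dominated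
  -- convergence under the full noise.
  refine tendsto_nhds_unique (tendsto_valSum_thin (fun j => measurableSet_outerAtoms (δ j) ε)
    (measurableSet_largeAtoms ε) hlim hf h1.1) ?_
  simp_rw [h2]
  exact (tendsto_starSum_thin hDo hDb (fun j => measurableSet_outerAtoms (δ j) ε)
    (measurableSet_largeAtoms ε) hlim hf h1.2).const_add _

/-- A field for which all thinned noises satisfy the integral equation is the constructed one. -/
lemma ae_valSum_eq_solKer (hDo : IsOpen D) (hDb : Bornology.IsBounded D) (hu : Measurable u₀)
    {C : ℝ} (hC : ∀ x ∈ D, |u₀ x| ≤ C) (hθ : 0 < θ)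
    (hs : hsSq (thin ν univ) θ < 1) (hpot : ∀ᵐ y ∂(thin ν univ), potSum (thin ν univ) θ y ≠ ∞)
    (hpos : ∀ᵐ z ∂ν, 0 < z.2)
    (hat : ∀ ε : ℝ, 0 < ε → ∀ S, MeasurableSet S → thin ν (largeAtoms d ε) S = 0 ∨
      ENNReal.ofReal ε ≤ thin ν (largeAtoms d ε) S)
    {f : Kernels d} (hf : f.IsMeas) {δ : ℕ → ℝ} (hδ : Tendsto δ atTop (𝓝 0)) (hδ0 : ∀ j, 0 < δ j)
    (hfin : ∀ᵐ w ∂((thin ν univ).prod (volume.restrict (Ioc 0 T))),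
      absSum (thin ν univ) f w.2 w.1 ≠ ∞ ∧ absStar D (thin ν univ) f w.2 w.1 ≠ ∞)
    (hI : ∀ᵐ y ∂(thin ν univ), ∫⁻ s in Ioc 0 T, absSum (thin ν univ) f s y ≠ ∞)
    (hE : ∀ k j, ∀ᵐ w ∂((thin ν (outerAtoms d (δ j) (δ k))).prod (volume.restrict (Ioc 0 T))),
      valSum (thin ν (outerAtoms d (δ j) (δ k))) f w.2 w.1
        = freeTerm D u₀ w.2 w.1 + starSum D (thin ν (outerAtoms d (δ j) (δ k))) f w.2 w.1) :
    ∀ᵐ y ∂(thin ν univ), ∀ᵐ s ∂(volume.restrict (Ioc 0 T)),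
      valSum (thin ν univ) f s y = valSum (thin ν univ) (solKer D u₀) s y := by
  set τ := (volume : Measure ℝ).restrict (Ioc 0 T) with hτ
  set g := solKer D u₀ with hgdef
  have hg : g.IsMeas := isMeas_solKer hDo hDb hu
  set K : ℝ → ℝ≥0∞ := fun t => ENNReal.ofReal C * ENNReal.ofReal (Real.exp (θ * t)) with hK
  have hKtop : ∀ t, K t ≠ ∞ := fun t =>
    ENNReal.mul_ne_top ENNReal.ofReal_ne_top ENNReal.ofReal_ne_top
  have habs : ∀ t, 0 ≤ t → ∀ y, absSum (thin ν univ) g t y ≤ K t * potSum (thin ν univ) θ y :=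
    fun t ht y => absSum_solKer_le hDo hDb hu hC hθ ht y
  have hstar : ∀ t y, absStar D (thin ν univ) g t y ≤ K t * potSum (thin ν univ) θ y :=
    fun t y => absStar_solKer_le hDo hDb hu hC hθ t y
  have hIg : ∀ᵐ y ∂(thin ν univ), ∫⁻ s in Ioc 0 T, absSum (thin ν univ) g s y ≠ ∞ := by
    filter_upwards [hpot] with y hy
    refine ne_top_of_le_ne_top (b := ∫⁻ _ in Ioc 0 T, K T * potSum (thin ν univ) θ y) ?_
      (setLIntegral_mono' measurableSet_Ioc fun s hs' => (habs s hs'.1.le y).trans ?_)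
    · rw [setLIntegral_const]
      exact ENNReal.mul_ne_top (ENNReal.mul_ne_top (hKtop T) hy) measure_Ioc_lt_top.ne
    · simp only [hK]
      gcongr
      exact hs'.2
  have hfing : ∀ᵐ w ∂((thin ν univ).prod τ), 0 ≤ w.2 ∧ potSum (thin ν univ) θ w.1 ≠ ∞ := by
    have h1 := (Measure.quasiMeasurePreserving_fst (μ := thin ν univ) (ν := τ)).ae hpot
    have h2 := (Measure.quasiMeasurePreserving_snd (μ := thin ν univ) (ν := τ)).ae
      (ae_restrict_mem (measurableSet_Ioc (a := (0 : ℝ)) (b := T)))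
    filter_upwards [h1, h2] with w h1 h2
    exact ⟨h2.1.le, h1⟩
  -- At each truncation level both fields solve the same equation: f by the limit of thinned
  -- equations, `solKer` because its series converges for every thinning.
  have hEk : ∀ k, ∀ᵐ y ∂(thin ν (largeAtoms d (δ k))), ∀ᵐ s ∂τ,
      valSum (thin ν (largeAtoms d (δ k))) f s y = valSum (thin ν (largeAtoms d (δ k))) g s y := by
    intro k
    refine ae_valSum_eq_of_atomic (F := freeTerm D u₀) hDo hDb hθ
      ((hsSq_mono (thin_mono ν (subset_univ _))).trans_lt hs)
      (ENNReal.ofReal_pos.2 (hδ0 k)).ne' (hat _ (hδ0 k)) hf hg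
      (ae_equation_largeAtoms hDo hDb hpos hf hδ hfin (hE k)) ?_ ?_ ?_
    · filter_upwards [ae_prod_thin_of_subset (subset_univ _) hfing] with w hw
      have h1 : absSum (thin ν (largeAtoms d (δ k))) g w.2 w.1 ≠ ∞ :=
        ne_top_of_le_ne_top (ENNReal.mul_ne_top (hKtop _) hw.2)
          ((absSum_thin_le ν _ _ _ _).trans (habs _ hw.1 _))
      have h2 : absStar D (thin ν (largeAtoms d (δ k))) g w.2 w.1 ≠ ∞ :=
        ne_top_of_le_ne_top (ENNReal.mul_ne_top (hKtop _) hw.2)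
          ((absStar_thin_le ν _ _ _ _).trans (hstar _ _))
      exact ⟨h2, valSum_solKer hDo hDb hu h1 h2⟩
    · filter_upwards [ae_mono (thin_mono ν (subset_univ _)) hI] with y hy
      exact ne_top_of_le_ne_top hy (lintegral_mono fun s => absSum_thin_le ν _ _ _ _)
    · filter_upwards [ae_mono (thin_mono ν (subset_univ _)) hIg] with y hy
      exact ne_top_of_le_ne_top hy (lintegral_mono fun s => absSum_thin_le ν _ _ _ _)
  have hmeas : ∀ M : Measure (Sp d), IsFiniteMeasure M →
      MeasurableSet {w : Sp d × ℝ | valSum M f w.2 w.1 = valSum M g w.2 w.1} := fun M _ =>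
    measurableSet_eq_fun (measurable_valSum M hf) (measurable_valSum M hg)
  have hlarge := ae_eventually_largeAtoms hδ hpos
  refine ae_thin_univ (fun j => measurableSet_largeAtoms (δ j))
    (hlarge.mono fun z hz => hz.exists)
    (measurableSet_ae (hmeas (thin ν univ) inferInstance)) fun k => ?_
  -- An atom larger than δ k belongs to every finer truncation, so the truncated fields agree at it
  -- along the sequence and l can tend to infinity.
  have hall : ∀ l, ∀ᵐ y ∂(thin ν (largeAtoms d (δ k))), δ l ≤ δ k → ∀ᵐ s ∂τ,
      valSum (thin ν (largeAtoms d (δ l))) f s y = valSum (thin ν (largeAtoms d (δ l))) g s y := by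
    intro l
    by_cases hl : δ l ≤ δ k
    · have hsub : largeAtoms d (δ k) ⊆ largeAtoms d (δ l) := fun z hz => lt_of_le_of_lt hl hz
      filter_upwards [ae_mono (thin_mono ν hsub) (hEk l)] with y hy _ using hy
    · exact ae_of_all _ fun y h => absurd h hl
  have hboth := Measure.ae_ae_of_ae_prod (ae_prod_thin_of_subset (subset_univ (largeAtoms d (δ k)))
    (hfin.and hfing))
  filter_upwards [ae_all_iff.2 hall, hboth] with y h1 h2
  have h1' : ∀ᵐ s ∂τ, ∀ l, δ l ≤ δ k → valSum (thin ν (largeAtoms d (δ l))) f s y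
      = valSum (thin ν (largeAtoms d (δ l))) g s y := by
    rw [ae_all_iff]
    intro l
    by_cases hl : δ l ≤ δ k
    · filter_upwards [h1 l hl] with s hs _ using hs
    · exact ae_of_all _ fun s h => absurd h hl
  filter_upwards [h1', h2] with s h3 h4
  have hlim : ∀ᵐ z ∂ν, ∀ᶠ j in atTop, (z ∈ largeAtoms d (δ j) ↔ z ∈ (univ : Set (Sp d × ℝ))) := by
    filter_upwards [hlarge] with z hz
    filter_upwards [hz] with j hj
    exact ⟨fun _ => trivial, fun _ => hj⟩
  refine tendsto_nhds_unique_of_eventuallyEq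
    (tendsto_valSum_thin (fun j => measurableSet_largeAtoms (δ j)) MeasurableSet.univ hlim hf
      h4.1.1)
    (tendsto_valSum_thin (fun j => measurableSet_largeAtoms (δ j)) MeasurableSet.univ hlim hg
      (ne_top_of_le_ne_top (ENNReal.mul_ne_top (hKtop _) h4.2.2) (habs _ h4.2.1 _))) ?_
  filter_upwards [hδ.eventually_lt_const (hδ0 k)] with l hl
  exact h3 l hl.le

end Thinned

/-! ### Uniqueness -/

section TimeIntegrability

variable {d : ℕ} {D : Set (Sp d)} {L : Measure (Sp d)} [IsFiniteMeasure L] {f : Kernels d} {T : ℝ}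

/-- The `⋆`-integrals at a dense set of points control the time integrals at the atoms. -/
lemma ae_lintegral_absSum_ne_top (hDo : IsOpen D) (hDb : Bornology.IsBounded D) (hL : L Dᶜ = 0)
    (hf : f.IsMeas) (h : ∀ n, TopologicalSpace.denseSeq (Sp d) n ∈ D →
      absStar D L f T (TopologicalSpace.denseSeq (Sp d) n) ≠ ∞ ∧
        L {TopologicalSpace.denseSeq (Sp d) n} = 0) :
    ∀ᵐ y ∂L, ∀ T' < T, ∫⁻ s in Ioc 0 T', absSum L f s y ≠ ∞ := by
  set ξ := TopologicalSpace.denseSeq (Sp d)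
  have h1 : ∀ n, ∀ᵐ y ∂L, ξ n ∈ D →
      ∫⁻ s in Ioc 0 T, ‖dirKer D (T - s) (ξ n) y‖ₑ * absSum L f s y ≠ ∞ := by
    intro n
    by_cases hn : ξ n ∈ D
    · obtain ⟨h2, h3⟩ := h n hn
      have hF : Measurable fun w : Sp d × ℝ =>
          ‖dirKer D (T - w.2) (ξ n) w.1‖ₑ * absSum L f w.2 w.1 :=
        ((measurable_dirKer hDo hDb).comp (by fun_prop :
          Measurable fun w : Sp d × ℝ => (T - w.2, ξ n, w.1))).enorm.mul (measurable_absSum L hf)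
      rw [absStar, prod_restrict_compl, lintegral_prod _ hF.aemeasurable,
        Measure.restrict_eq_self_of_ae_mem (show ∀ᵐ y ∂L, y ∈ ({ξ n}ᶜ : Set (Sp d)) by
          simpa [ae_iff] using h3)] at h2
      filter_upwards [ae_lt_top hF.lintegral_prod_right' h2] with y hy _ using hy.ne
    · exact ae_of_all _ fun y hy => absurd hy hn
  filter_upwards [ae_all_iff.2 h1, show ∀ᵐ y ∂L, y ∈ D from hL] with y hy hyD T' hT'
  obtain ⟨R, hR, hball⟩ := exists_pos_le_dirichletKernel hDo hDb hyD
  -- Only countably many deterministic points can be handled off one null set, so the point near the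
  -- atom y is taken from the dense sequence.
  obtain ⟨x, hx, n, rfl⟩ := (TopologicalSpace.denseRange_denseSeq (Sp d)).inter_open_nonempty
    (Metric.ball y R ∩ D) (Metric.isOpen_ball.inter hDo) ⟨y, Metric.mem_ball_self hR, hyD⟩
  -- Because T' < T, the elapsed time T - s stays away from 0, which is what gives a positive lower
  -- bound for G.
  obtain ⟨c, hc, hle⟩ := hball _ hx.1 (T - T') (sub_pos.2 hT') T
  have hm : Measurable fun s : ℝ => absSum L f s y :=
    (measurable_absSum L hf).comp measurable_prodMk_left
  have hlt : ENNReal.ofReal c * ∫⁻ s in Ioc 0 T', absSum L f s y ≠ ∞ := by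
    refine ne_top_of_le_ne_top (hy n hx.2) ?_
    rw [← lintegral_const_mul _ hm]
    refine (setLIntegral_mono' measurableSet_Ioc fun s hs => ?_).trans
      (lintegral_mono_set (Ioc_subset_Ioc_right hT'.le))
    gcongr
    rw [dirKer_eq (by linarith [hs.2]) hx.2 hyD]
    have hTs : T - s ∈ Icc (T - T') T := ⟨by linarith [hs.2], by linarith [hs.1]⟩
    refine (ENNReal.ofReal_le_ofReal (hle (T - s) hTs)).trans ?_
    rw [Real.enorm_eq_ofReal_abs]
    exact ENNReal.ofReal_le_ofReal (le_abs_self _)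
  intro htop
  rw [htop, ENNReal.mul_top (ENNReal.ofReal_pos.2 hc).ne'] at hlt
  exact hlt rfl

end TimeIntegrability

/-! ### Atoms weighted by their sizes -/

section WeightedAtoms

variable {d : ℕ} (m : Measure (Sp d × ℝ))

/-- The point measure with each atom weighted by its size. -/
def weighted : Measure (Sp d × ℝ) := m.withDensity fun z => ENNReal.ofReal z.2

lemma thin_weighted {S : Set (Sp d × ℝ)} (hS : MeasurableSet S) :
    thin (weighted m) S = proj (m.restrict S) := by
  rw [thin, weighted, restrict_withDensity hS, proj]

lemma thin_weighted_univ : thin (weighted m) univ = proj m := thin_univ _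

variable {m}

/-- A non-null set of atoms has count at least 1, and each of its atoms weighs more than ε. -/
lemma ZeroOrGeOne.thin_largeAtoms (hm : ZeroOrGeOne m) (ε : ℝ) {S : Set (Sp d)}
    (hS : MeasurableSet S) : thin (weighted m) (largeAtoms d ε) S = 0 ∨
      ENNReal.ofReal ε ≤ thin (weighted m) (largeAtoms d ε) S := by
  have hB : MeasurableSet (Prod.fst ⁻¹' S ∩ largeAtoms d ε) :=
    (measurable_fst hS).inter (measurableSet_largeAtoms ε)
  have h1 : thin (weighted m) (largeAtoms d ε) S
      = ∫⁻ z in Prod.fst ⁻¹' S ∩ largeAtoms d ε, ENNReal.ofReal z.2 ∂m := by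
    rw [thin, Measure.map_apply measurable_fst hS, Measure.restrict_apply (measurable_fst hS),
      weighted, withDensity_apply _ hB]
  rw [h1]
  rcases hm _ hB with h | h
  · exact Or.inl (setLIntegral_measure_zero _ _ h)
  · right
    calc ENNReal.ofReal ε ≤ ENNReal.ofReal ε * m (Prod.fst ⁻¹' S ∩ largeAtoms d ε) :=
          le_mul_of_one_le_right' h
      _ = ∫⁻ _ in Prod.fst ⁻¹' S ∩ largeAtoms d ε, ENNReal.ofReal ε ∂m :=
          (setLIntegral_const _ _).symm
      _ ≤ _ := setLIntegral_mono' hB fun z hz => ENNReal.ofReal_le_ofReal (le_of_lt hz.2)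

end WeightedAtoms

/-! ### The equation as a measurable property of the point measure -/

section Equation

variable {d : ℕ} {D : Set (Sp d)} {u₀ : Sp d → ℝ} {f : Kernels d} {T : ℝ}

/-- The field with kernels `f` converges absolutely and solves the equation, at the point `w.1`
and the time `w.2`. -/
def SolvesField (D : Set (Sp d)) (u₀ : Sp d → ℝ) (f : Kernels d) (L : Measure (Sp d))
    (w : Sp d × ℝ) : Prop :=
  (absSum L f w.2 w.1 ≠ ∞ ∧ absStar D L f w.2 w.1 ≠ ∞) ∧
    valSum L f w.2 w.1 = freeTerm D u₀ w.2 w.1 + starSum D L f w.2 w.1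

lemma measurableSet_solvesField (hDo : IsOpen D) (hDb : Bornology.IsBounded D)
    (hu : Measurable u₀) (hf : f.IsMeas) {A : Type*} [MeasurableSpace A] (κ : Kernel A (Sp d))
    [∀ a, IsFiniteMeasure (κ a)] {w : A → Sp d × ℝ} (hw : Measurable w) :
    MeasurableSet {a | SolvesField D u₀ f (κ a) (w a)} := by
  have h1 : Measurable fun a => (w a).1 := measurable_fst.comp hw
  have h2 : Measurable fun a => (w a).2 := measurable_snd.comp hw
  refine MeasurableSet.inter (MeasurableSet.inter ?_ ?_) ?_
  · exact (measurable_kernel_absSum κ hf h2 h1) (measurableSet_singleton ∞).compl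
  · exact (measurable_kernel_absStar κ hDo hDb hf h2 h1) (measurableSet_singleton ∞).compl
  · exact measurableSet_eq_fun (measurable_kernel_valSum κ hf h2 h1)
      (((measurable_freeTerm hDo hDb hu).comp (h2.prodMk h1)).add
        (measurable_kernel_starSum κ hDo hDb hf h2 h1))

/-- The point measures for which the field solves the equation at almost all times and atoms. -/
def goodMeasures (D : Set (Sp d)) (u₀ : Sp d → ℝ) (f : Kernels d) (T : ℝ) :
    Set (Measure (Sp d × ℝ)) :=
  {m | ∀ᵐ w ∂((projKer d m).prod (volume.restrict (Ioc 0 T))), SolvesField D u₀ f (projKer d m) w}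

/-- This measurability makes the property admissible in the thinning theorem `ae_restrict_compl`. -/
lemma measurableSet_goodMeasures (hDo : IsOpen D) (hDb : Bornology.IsBounded D)
    (hu : Measurable u₀) (hf : f.IsMeas) : MeasurableSet (goodMeasures D u₀ f T) := by
  have hS : MeasurableSet {a : Measure (Sp d × ℝ) × (Sp d × ℝ) |
      SolvesField D u₀ f (projKer d a.1) a.2} :=
    measurableSet_solvesField hDo hDb hu hf
      ((projKer d).comap (Prod.fst : Measure (Sp d × ℝ) × (Sp d × ℝ) → _) measurable_fst)
      measurable_snd
  have h := Kernel.measurable_kernel_prodMk_left (κ := projKer d ×ₖ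
    Kernel.const (Measure (Sp d × ℝ)) ((volume : Measure ℝ).restrict (Ioc 0 T))) hS.compl
  have h2 := h (measurableSet_singleton 0)
  convert! h2 using 1
  ext m
  simp only [mem_preimage, Kernel.prod_apply, Kernel.const_apply]
  rfl

variable {Ω : Type*} [MeasurableSpace Ω] {P : Measure Ω} [IsProbabilityMeasure P]
  {Y : Ω → Measure (Sp d × ℝ)}

/-- The definition of a solution gives a null set for each time. Fubini in (t, ω), and then in time
and space, yields one null set off which the equation holds at almost all times and atoms. -/
lemma ae_mem_goodMeasures (hDo : IsOpen D) (hDb : Bornology.IsBounded D) (hu : Measurable u₀)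
    (hf : f.IsMeas) (hYm : Measurable Y) (hfin : ∀ᵐ ω ∂P, noise Y ω univ < ∞)
    (hcompl : ∀ᵐ ω ∂P, noise Y ω Dᶜ = 0) {v : ℝ → Sp d → Ω → ℝ}
    (hv : ∀ t ∈ Ioc 0 T, ∀ᵐ ω ∂P, ∀ᵐ x ∂(noise Y ω),
      SolvesAt D u₀ (noise Y ω) (noAdjacentTo x) f t x (v t x ω)) :
    ∀ᵐ ω ∂P, Y ω ∈ goodMeasures D u₀ f T := by
  have hφ : Measurable fun a : ℝ × Ω => Y a.2 := hYm.comp measurable_snd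
  have hS : MeasurableSet {a : (ℝ × Ω) × Sp d |
      SolvesField D u₀ f (projKer d (Y a.1.2)) (a.2, a.1.1)} :=
    measurableSet_solvesField hDo hDb hu hf
      ((projKer d).comap (fun a : (ℝ × Ω) × Sp d => Y a.1.2) (hφ.comp measurable_fst))
      (w := fun a => (a.2, a.1.1)) (by fun_prop)
  have hpm : MeasurableSet {a : ℝ × Ω | ∀ᵐ y ∂(projKer d (Y a.2)),
      SolvesField D u₀ f (projKer d (Y a.2)) (y, a.1)} :=
    Kernel.measurable_kernel_prodMk_left (κ := (projKer d).comap (fun a : ℝ × Ω => Y a.2) hφ)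
      hS.compl (measurableSet_singleton 0)
  have h1 : ∀ᵐ t ∂((volume : Measure ℝ).restrict (Ioc 0 T)), ∀ᵐ ω ∂P,
      ∀ᵐ y ∂(projKer d (Y ω)), SolvesField D u₀ f (projKer d (Y ω)) (y, t) := by
    filter_upwards [ae_restrict_mem measurableSet_Ioc] with t ht
    filter_upwards [hfin, hcompl, hv t ht] with ω h1 h2 h3
    have : IsFiniteMeasure (noise Y ω) := ⟨h1⟩
    rw [projKer_eq h1]
    filter_upwards [h3, show ∀ᵐ x ∂(noise Y ω), x ∈ D from h2] with x hx hxD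
    obtain ⟨⟨h4, h5⟩, h6, h7⟩ := (solvesAt_iff hDo hDb h2 hf ht.1 hxD).1 hx
    exact ⟨⟨h4, h6⟩, h5.symm.trans h7⟩
  have h2 := (Measure.ae_ae_comm (p := fun t ω => ∀ᵐ y ∂(projKer d (Y ω)),
    SolvesField D u₀ f (projKer d (Y ω)) (y, t)) hpm).1 h1
  filter_upwards [h2] with ω hω
  have hSω : MeasurableSet {w : Sp d × ℝ | SolvesField D u₀ f (projKer d (Y ω)) w} :=
    measurableSet_solvesField hDo hDb hu hf (Kernel.const (Sp d × ℝ) (projKer d (Y ω)))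
      measurable_id
  refine (Measure.ae_prod_iff_ae_ae hSω).2 ?_
  exact (Measure.ae_ae_comm (p := fun y t => SolvesField D u₀ f (projKer d (Y ω)) (y, t)) hSω).2 hω

end Equation

/-! ### Uniqueness for the stable noise -/

section Uniqueness

variable {d : ℕ} {D : Set (Sp d)} {u₀ : Sp d → ℝ} {p c T : ℝ} {Ω : Type*} [MeasurableSpace Ω]
  {P : Measure Ω} [IsProbabilityMeasure P] {Y : Ω → Measure (Sp d × ℝ)}

lemma ae_Ioc_of_forall_lt {q : ℝ → Prop}
    (h : ∀ n : ℕ, ∀ᵐ s ∂(volume.restrict (Ioc 0 (T - 1 / ((n : ℝ) + 1)))), q s) :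
    ∀ᵐ s ∂(volume.restrict (Ioc 0 T)), q s := by
  have h1 : ∀ n : ℕ, ∀ᵐ s : ℝ, s ∈ Ioc 0 (T - 1 / ((n : ℝ) + 1)) → q s := fun n =>
    (ae_restrict_iff' measurableSet_Ioc).1 (h n)
  filter_upwards [ae_Ioc_lt T, ae_restrict_mem measurableSet_Ioc,
    ae_restrict_of_ae (ae_all_iff.2 h1)] with s hs hs' hall
  obtain ⟨n, hn⟩ := exists_nat_one_div_lt (sub_pos.2 hs)
  exact hall n ⟨hs'.1, by linarith⟩

/-- At the atoms, a solution is represented by the same field as the constructed one. -/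
lemma ae_valSum_eq_valSum_solKer (hd : 1 ≤ d) (hp0 : 0 < p) (hp1 : p < 1)
    (hdp : d ≤ 4 ∨ (5 ≤ d ∧ p < 1 / 2 + 1 / ((d : ℝ) - 2))) (hDo : IsOpen D)
    (hDb : Bornology.IsBounded D) (hu : Measurable u₀) (hub : ∃ C : ℝ, ∀ x ∈ D, |u₀ x| ≤ C)
    (hc : 0 < c) (hY : IsPoissonRandomMeasure Y (stableIntensity D p c) P) (hT : 0 < T)
    {f : Kernels d} (hf : f.IsMeas) {v : ℝ → Sp d → Ω → ℝ}
    (hv : ∀ t ∈ Ioc 0 T,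
      (∀ x ∈ D, ∀ᵐ ω ∂P, SolvesAt D u₀ (noise Y ω) noAdjacent f t x (v t x ω)) ∧
      (∀ᵐ ω ∂P, ∀ᵐ x ∂(noise Y ω),
        SolvesAt D u₀ (noise Y ω) (noAdjacentTo x) f t x (v t x ω))) :
    ∀ᵐ ω ∂P, ∀ᵐ y ∂(noise Y ω), ∀ᵐ s ∂(volume.restrict (Ioc 0 T)),
      valSum (noise Y ω) f s y = valSum (noise Y ω) (solKer D u₀) s y := by
  obtain ⟨C, hC⟩ := hub
  obtain ⟨β, q, hβ, hβd, hpq, hq1, hβq⟩ := exists_exponents hd hp0 hp1 hdp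
  have hfin := ae_noise_univ_lt_top hDb hp0 hp1 hc hY
  have hcompl := ae_noise_compl_eq_zero hDo hY
  set δ : ℕ → ℝ := fun n => 1 / ((n : ℝ) + 1) with hδdef
  have hδ : Tendsto δ atTop (𝓝 0) := tendsto_one_div_add_atTop_nhds_zero_nat
  have hδ0 : ∀ j, 0 < δ j := fun j => Nat.one_div_pos_of_nat
  have hgood := ae_mem_goodMeasures hDo hDb hu hf hY.measurable hfin hcompl
    fun t ht => (hv t ht).2
  -- The removed atoms have size greater than δ j, so they form a set of finite intensity.
  have hthin : ∀ k j, ∀ᵐ ω ∂P, (Y ω).restrict (outerAtoms d (δ j) (δ k)) ∈ goodMeasures D u₀ f T :=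
    fun k j => by
      refine hY.ae_restrict_compl (MeasurableSet.univ.prod measurableSet_Ioc) ?_
        (measurableSet_goodMeasures hDo hDb hu hf) hgood
      exact ne_top_of_le_ne_top (stableIntensity_Ioi_ne_top hDb hp0 (hδ0 j))
        (measure_mono (prod_mono subset_rfl Ioc_subset_Ioi_self))
  -- Only the final time T is needed here: convergence of the ⋆-integral at time T controls the
  -- field on all of (0, T'] for T' < T.
  have hdense : ∀ᵐ ω ∂P, ∀ n, TopologicalSpace.denseSeq (Sp d) n ∈ D →
      absStar D (noise Y ω) f T (TopologicalSpace.denseSeq (Sp d) n) ≠ ∞ ∧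
        noise Y ω {TopologicalSpace.denseSeq (Sp d) n} = 0 := by
    rw [ae_all_iff]
    intro n
    by_cases hn : TopologicalSpace.denseSeq (Sp d) n ∈ D
    · filter_upwards [hfin, hcompl, (hv T ⟨hT, le_rfl⟩).1 _ hn,
        ae_noise_singleton_eq_zero hd hY (TopologicalSpace.denseSeq (Sp d) n)] with ω h1 h2 h3 h4 _
      have : IsFiniteMeasure (noise Y ω) := ⟨h1⟩
      rw [solvesAt_noAdjacent_iff h4, solvesAt_iff hDo hDb h2 hf hT hn] at h3
      exact ⟨h3.2.1, h4⟩
    · exact ae_of_all _ fun ω h => absurd h hn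
  filter_upwards [hfin, hcompl, ae_lintegral_energyAt_lt_top hd hDo hDb hp0 hc hY hpq hq1 hβq,
    hgood, ae_all_iff.2 fun k => ae_all_iff.2 fun j => hthin k j, hdense, hY.ae_zeroOrGeOne,
    ae_apply_Iic_eq_zero hY] with ω h1 h2 h3 h4 h5 h6 h7 h8
  have hfinL : IsFiniteMeasure (noise Y ω) := ⟨h1⟩
  set ν := weighted (Y ω) with hν
  have hLν : noise Y ω = thin ν univ := (thin_weighted_univ (Y ω)).symm
  have hνfin : IsFiniteMeasure ν := ⟨by
    have : ν univ = noise Y ω univ := by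
      rw [hLν, thin_univ, Measure.map_apply measurable_fst MeasurableSet.univ, preimage_univ]
    rwa [this]⟩
  have hpos : ∀ᵐ z ∂ν, 0 < z.2 := by
    have h : ∀ᵐ z ∂(Y ω), 0 < z.2 := by
      rw [ae_iff]
      convert! h8 using 2
      ext z
      simp
    exact (withDensity_absolutelyContinuous (Y ω) _).ae_le h
  obtain ⟨θ, hθ, hs⟩ := exists_hsSq_lt_one hβ hβd h3.ne
  have hm : Measurable (energyAt β (noise Y ω)) :=
    measurable_setLIntegral_compl_singleton _
      (F := fun w : Sp d × Sp d => ‖w.1 - w.2‖ₑ ^ (-(4 * β))) (by fun_prop)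
  have hpot : ∀ᵐ y ∂(noise Y ω), potSum (noise Y ω) θ y ≠ ∞ := by
    filter_upwards [ae_lt_top hm h3.ne] with y hy
    exact potSum_ne_top hs (potSq_ne_top hβ hβd hθ hy.ne)
  have hI := ae_lintegral_absSum_ne_top hDo hDb h2 hf h6
  rw [goodMeasures, mem_ofPred_eq, projKer_eq h1] at h4
  change ∀ᵐ w ∂((noise Y ω).prod (volume.restrict (Ioc 0 T))), SolvesField D u₀ f (noise Y ω) w
    at h4
  have hproj : ∀ k j, projKer d ((Y ω).restrict (outerAtoms d (δ j) (δ k)))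
      = thin ν (outerAtoms d (δ j) (δ k)) := fun k j => by
    have h := thin_weighted (Y ω) (measurableSet_outerAtoms (d := d) (δ j) (δ k))
    rw [projKer_eq (by rw [← h]; exact measure_lt_top _ _), h]
  have hE : ∀ k j, ∀ᵐ w ∂((thin ν (outerAtoms d (δ j) (δ k))).prod (volume.restrict (Ioc 0 T))),
      SolvesField D u₀ f (thin ν (outerAtoms d (δ j) (δ k))) w := fun k j => by
    have h := h5 k j
    rwa [goodMeasures, mem_ofPred_eq, hproj] at h
  rw [hLν] at hs hpot hI h4 ⊢
  have hsub : ∀ n : ℕ, (volume : Measure ℝ).restrict (Ioc 0 (T - 1 / ((n : ℝ) + 1)))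
      ≤ volume.restrict (Ioc 0 T) := fun n =>
    Measure.restrict_mono (Ioc_subset_Ioc_right (by
      have : (0 : ℝ) < 1 / ((n : ℝ) + 1) := Nat.one_div_pos_of_nat
      linarith)) le_rfl
  -- Time integrability at the atoms is known only strictly before T, hence the times T - 1/(n+1)
  -- and the union at the end.
  have hconc : ∀ n : ℕ, ∀ᵐ y ∂(thin ν univ),
      ∀ᵐ s ∂(volume.restrict (Ioc 0 (T - 1 / ((n : ℝ) + 1)))),
        valSum (thin ν univ) f s y = valSum (thin ν univ) (solKer D u₀) s y := by
    intro n
    refine ae_valSum_eq_solKer hDo hDb hu hC hθ hs hpot hpos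
      (fun ε _ S hS => h7.thin_largeAtoms ε hS) hf hδ hδ0 ?_ ?_ fun k j => ?_
    · filter_upwards [ae_mono (Measure.prod_mono le_rfl (hsub n)) h4] with w hw using hw.1
    · filter_upwards [hI] with y hy
      exact hy _ (sub_lt_self _ Nat.one_div_pos_of_nat)
    · filter_upwards [ae_mono (Measure.prod_mono le_rfl (hsub n)) (hE k j)] with w hw using hw.2
  filter_upwards [ae_all_iff.2 hconc] with y hy
  exact ae_Ioc_of_forall_lt hy

/-- At a deterministic point the equation expresses the solution through its values at the atoms,
and these are already identified for almost every time. -/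
lemma IsSolution.ae_eq_sol (hd : 1 ≤ d) (hp0 : 0 < p) (hp1 : p < 1)
    (hdp : d ≤ 4 ∨ (5 ≤ d ∧ p < 1 / 2 + 1 / ((d : ℝ) - 2))) (hDo : IsOpen D)
    (hDb : Bornology.IsBounded D) (hu : Measurable u₀) (hub : ∃ C : ℝ, ∀ x ∈ D, |u₀ x| ≤ C)
    (hc : 0 < c) (hY : IsPoissonRandomMeasure Y (stableIntensity D p c) P) (hT : 0 < T)
    {v : ℝ → Sp d → Ω → ℝ} (hv : IsSolution D u₀ (noise Y) P T v) {t : ℝ} (ht : t ∈ Ioc 0 T)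
    {x : Sp d} (hx : x ∈ D) : ∀ᵐ ω ∂P, v t x ω = sol D u₀ Y t x ω := by
  obtain ⟨-, f, hf, hsol⟩ := hv
  obtain ⟨-, g, hg, hsol'⟩ := isSolution_sol hd hp0 hp1 hdp hDo hDb hu hub hc hY T
  have hgm : (solKer D u₀).IsMeas := isMeas_solKer hDo hDb hu
  -- Stated for an arbitrary solution so that it applies both to v and to the constructed one; the
  -- right side mentions neither.
  have key : ∀ {f : Kernels d} {v : ℝ → Sp d → Ω → ℝ}, f.IsMeas → (∀ t ∈ Ioc 0 T,
      (∀ x ∈ D, ∀ᵐ ω ∂P, SolvesAt D u₀ (noise Y ω) noAdjacent f t x (v t x ω)) ∧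
      (∀ᵐ ω ∂P, ∀ᵐ x ∂(noise Y ω),
        SolvesAt D u₀ (noise Y ω) (noAdjacentTo x) f t x (v t x ω))) →
      ∀ᵐ ω ∂P, v t x ω = freeTerm D u₀ t x + starSum D (noise Y ω) (solKer D u₀) t x := by
    intro f v hf hsol
    filter_upwards [ae_noise_univ_lt_top hDb hp0 hp1 hc hY, ae_noise_compl_eq_zero hDo hY,
      ae_noise_singleton_eq_zero hd hY x, (hsol t ht).1 x hx,
      ae_valSum_eq_valSum_solKer hd hp0 hp1 hdp hDo hDb hu hub hc hY hT hf hsol]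
      with ω h1 h2 h3 h4 h5
    have : IsFiniteMeasure (noise Y ω) := ⟨h1⟩
    rw [solvesAt_noAdjacent_iff h3, solvesAt_iff hDo hDb h2 hf ht.1 hx] at h4
    refine h4.2.2.trans (congrArg _ (integral_congr_ae ?_))
    have hm : MeasurableSet {w : Sp d × ℝ |
        valSum (noise Y ω) f w.2 w.1 = valSum (noise Y ω) (solKer D u₀) w.2 w.1} :=
      measurableSet_eq_fun (measurable_valSum _ hf) (measurable_valSum _ hgm)
    have h6 := (Measure.ae_prod_iff_ae_ae (ν := volume.restrict (Ioc 0 T)) hm).2 h5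
    have hle : ((noise Y ω).prod volume).restrict ({x}ᶜ ×ˢ Ioc 0 t)
        ≤ (noise Y ω).prod (volume.restrict (Ioc 0 T)) := by
      rw [prod_restrict_compl]
      exact Measure.prod_mono Measure.restrict_le_self
        (Measure.restrict_mono (Ioc_subset_Ioc_right ht.2) le_rfl)
    filter_upwards [ae_mono hle h6] with w hw
    rw [hw]
  filter_upwards [key hf hsol, key hg hsol'] with ω h1 h2
  rw [h1, h2]

end Uniqueness

end StableHeat

end

theorem theorem1 {d : ℕ} (hd : 1 ≤ d) {p : ℝ} (hp0 : 0 < p) (hp1 : p < 1)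
    (hdp : d ≤ 4 ∨ (5 ≤ d ∧ p < 1 / 2 + 1 / ((d : ℝ) - 2)))
    {D : Set (StableHeat.Sp d)} (hDo : IsOpen D) (hDb : Bornology.IsBounded D)
    (hDs : StableHeat.HasSmoothBoundary D)
    {u₀ : StableHeat.Sp d → ℝ} (hu₀m : Measurable u₀) (hu₀b : ∃ C : ℝ, ∀ x ∈ D, |u₀ x| ≤ C)
    {c : ℝ} (hc : 0 < c)
    {Ω : Type*} [MeasurableSpace Ω] {P : Measure Ω} [IsProbabilityMeasure P]
    {Y : Ω → Measure (StableHeat.Sp d × ℝ)}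
    (hY : StableHeat.IsPoissonRandomMeasure Y (StableHeat.stableIntensity D p c) P) :
    ∃ u : ℝ → StableHeat.Sp d → Ω → ℝ,
      (∀ T > 0, StableHeat.IsSolution D u₀ (StableHeat.noise Y) P T u) ∧
      ∀ T > 0, ∀ v : ℝ → StableHeat.Sp d → Ω → ℝ,
        StableHeat.IsSolution D u₀ (StableHeat.noise Y) P T v →
          ∀ t ∈ Ioc 0 T, ∀ x ∈ D, ∀ᵐ ω ∂P, v t x ω = u t x ω := by
  exact ⟨StableHeat.sol D u₀ Y,
    fun T _ => StableHeat.isSolution_sol hd hp0 hp1 hdp hDo hDb hu₀m hu₀b hc hY T,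
    fun _ hT _ hv _ ht _ hx => hv.ae_eq_sol hd hp0 hp1 hdp hDo hDb hu₀m hu₀b hc hY hT ht hx⟩
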